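/- Let $k$ be a field and $q\in k^\times$ (for instance $k=\mathbb C$, or $k=\mathbb C(q)$). Let $\mathcal K$ be the skew field of fractions of the quantum torus over $k$ generated by the invertible variables $h_1,h_2,e_1,\dots,e_{11},x,y,\sigma_1,\sigma_2,\tau_1,\dots,\tau_{11}$ with the relations $$yx=qxy,\quad \tau_ie_i=q^{-1}e_i\tau_i,\quad \sigma_1h_2=qh_2\sigma_1,\quad \sigma_2h_1=qh_1\sigma_2,$$ all other pairs of variables commuting. There are unique $k$-algebra automorphisms $s_0,\dots,s_8$ of $\mathcal K$ with the following values on the variables (variables not listed are fixed): $$s_0:\ e_{10}\mapsto\tfrac{h_2}{e_{11}},\ e_{11}\mapsto\tfrac{h_2}{e_{10}},\ h_1\mapsto\tfrac{h_1h_2}{e_{10}e_{11}},\ x\mapsto x\,\frac{1+y\frac{h_2}{e_{10}}}{1+ye_{11}},\ \tau_{10}\mapsto(1+ye_{11})\tfrac{\sigma_2}{\tau_{11}},\ \tau_{11}\mapsto\tfrac{\sigma_2}{\tau_{10}}\big(1+y\tfrac{h_2}{e_{10}}\big),\ \sigma_1\mapsto(1+ye_{11})\tfrac{\sigma_1\sigma_2}{\tau_{10}\tau_{11}};$$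 $$s_3:\ e_1\mapsto\tfrac{h_1}{e_7},\ e_7\mapsto\tfrac{h_1}{e_1},\ h_2\mapsto\tfrac{h_1h_2}{e_1e_7},\ y\mapsto\frac{1+x\frac{e_7}{h_1}}{1+\frac{x}{e_1}}\,y,\ \tau_1\mapsto\big(1+x\tfrac{e_7}{h_1}\big)\tfrac{\sigma_1}{\tau_7},\ \tau_7\mapsto\tfrac{\sigma_1}{\tau_1}\big(1+\tfrac{x}{e_1}\big),\ \sigma_2\mapsto\tfrac{\sigma_1\sigma_2}{\tau_1\tau_7}\big(1+\tfrac{x}{e_1}\big);$$ and, for $i\neq 0,3$, $s_i$ exchanges $e_a\leftrightarrow e_b$ and $\tau_a\leftrightarrow\tau_b$, where $(a,b)=(8,9),(7,8),(1,2),(2,3),(3,4),(4,5),(5,6)$ for $i=1,2,4,5,6,7,8$ respectively. For integer data $\lambda=((d_1,d_2),(m_1,\dots,m_{11}))$, i.e. $\lambda=d_1H_1+d_2H_2-\sum_i m_iE_i$, put $e^\lambda=h_1^{d_1}h_2^{d_2}\prod_ie_i^{-m_i}$ and $\tau^\lambda=\sigma_1^{d_1}\sigma_2^{d_2}\prod_i\tau_i^{-m_i}$.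 Let $s_i^*$ act on the data by $$s_0^*:\ d_2\mapsto d_1+d_2-m_{10}-m_{11},\ m_{10}\mapsto d_1-m_{11},\ m_{11}\mapsto d_1-m_{10};\qquad s_3^*:\ d_1\mapsto d_1+d_2-m_1-m_7,\ m_1\mapsto d_2-m_7,\ m_7\mapsto d_2-m_1,$$ and, for $i\ne0,3$, by exchanging $m_a\leftrightarrow m_b$ with the same $(a,b)$ as above; then $s_i(e^\lambda)=e^{s_i^*\lambda}$. Let $\Lambda$ be the orbit of $\{E_1,\dots,E_{11}\}$ under the group generated by $s_0^*,\dots,s_8^*$. Polynomials have coefficients in the field $k(h_i,e_i)$; a polynomial "of degree $n$" means of degree at most $n$ (and is $0$ if $n<0$); sums over $0\le i\le d$ are empty for $d<0$; $\prod_{t=a}^{b}(\cdot)=1$ if $a>b$; $(c)_+=\max(c,0)$. An element $F\in\mathcal K$ satisfies - $(x)_\lambda$ if $F=\sum_{i=0}^{d_1}x^i\prod_{t=i}^{m_{11}-1}(1+q^te_{11}y)\prod_{t=d_1-m_{10}}^{i-1}\big(1+q^t\frac{h_2}{e_{10}}y\big)U_i(y)$ with polynomials $U_i(y)$ of degree $d_2-(i-d_1+m_{10})_+-(m_{11}-i)_+$;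 - $(y)_\lambda$ if $F=\sum_{i=0}^{d_2}\prod_{j=1}^{6}\prod_{t=i-m_j}^{-1}\big(1+q^t\frac1{e_j}x\big)\prod_{j=7}^{9}\prod_{t=0}^{i-d_2+m_j-1}\big(1+q^t\frac{e_j}{h_1}x\big)V_i(x)\,y^i$ with polynomials $V_i(x)$ of degree $d_1-\sum_{j=1}^6(m_j-i)_+-\sum_{j=7}^9(i-d_2+m_j)_+$. **Theorem.** (1) Let $\lambda$ be arbitrary data, let $F_\lambda$ satisfy $(x)_\lambda$ and $(y)_\lambda$, and let $0\le i\le 8$. Then the element $F_{s_i^*\lambda}$ defined by $$s_i(F_\lambda\,\tau^\lambda)=F_{s_i^*\lambda}\,\tau^{s_i^*\lambda}$$ is again a non-commutative polynomial in $x,y$ and satisfies $(x)_{s_i^*\lambda}$ and $(y)_{s_i^*\lambda}$. (2) For each $j$, $F_{E_j}=1$ satisfies $(x)_{E_j}$, $(y)_{E_j}$ and is normalized. For each $\lambda\in\Lambda$ there is exactly one polynomial $F_\lambda$ with $(x)_\lambda$, $(y)_\lambda$ and constant term $F_\lambda(0,0)=1$; every element satisfying $(x)_\lambda$ and $(y)_\lambda$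 is of the form $c\,F_\lambda$ with $c\in k(h_i,e_i)$. It is obtained from $F_{E_j}=1$ by the action in (1): there are a word $i_1,\dots,i_r$ and an index $j$ with $s_{i_1}^*\cdots s_{i_r}^*E_j=\lambda$, and for every such word and index $s_{i_1}\cdots s_{i_r}(1\cdot\tau^{E_j})=F_\lambda\,\tau^\lambda$. -/

import Mathlib

noncomputable section

namespace QuantumE8

open Module

/-! ### The quantum torus and its skew field of fractions

Indices are zero-based: `e i` is the variable usually written `e_{i+1}`, and likewise for
`h`, `σ`, `τ`.  The simple reflections `s_0, …, s_8` are indexed by `Fin 9` without a shift. -/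

/-- Labels of the `28` variables `h₁, h₂, e₁, …, e₁₁, x, y, σ₁, σ₂, τ₁, …, τ₁₁`. -/
inductive QVar : Type
  | h (i : Fin 2)
  | e (i : Fin 11)
  | x
  | y
  | σ (i : Fin 2)
  | τ (i : Fin 11)
  deriving DecidableEq, Fintype

/-- Exponent vectors of Laurent monomials in the `28` variables. -/
abbrev Expo : Type := QVar → ℤ

/-- The power of `q` produced by normal ordering: writing `X^a` for the monomial with exponents
`a` in which `h, e, x` stand to the left of `y, σ, τ`, one has `X^a X^b = q ^ (form a b) X^(a+b)`.
The four terms encode `y x = q x y`, `σ₁ h₂ = q h₂ σ₁`, `σ₂ h₁ = q h₁ σ₂` and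
`τ_i e_i = q⁻¹ e_i τ_i`; all other pairs of variables commute. -/
def form (a b : Expo) : ℤ :=
  a .y * b .x + a (.σ 0) * b (.h 1) + a (.σ 1) * b (.h 0) - ∑ i, a (.τ i) * b (.e i)

theorem form_add_left (a b c : Expo) : form (a + b) c = form a c + form b c := by
  simp only [form, Pi.add_apply, add_mul, Finset.sum_add_distrib]; ring

theorem form_add_right (a b c : Expo) : form a (b + c) = form a b + form a c := by
  simp only [form, Pi.add_apply, mul_add, Finset.sum_add_distrib]; ring

/-- The quantum torus: Laurent polynomials in the `28` variables over `k`, with the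
`q`-commutation relations.  An element is the finitely supported family of the coefficients of
its normally ordered monomials. -/
def Torus (k : Type*) [Field k] (_q : kˣ) : Type _ := Expo →₀ k

namespace Torus

variable {k : Type*} [Field k] {q : kˣ}

instance : AddCommGroup (Torus k q) := inferInstanceAs (AddCommGroup (Expo →₀ k))
instance : Module k (Torus k q) := inferInstanceAs (Module k (Expo →₀ k))

/-- The family of coefficients of an element. -/
def coeffs : Torus k q ≃ₗ[k] (Expo →₀ k) := LinearEquiv.refl k (Expo →₀ k)

/-- The term `c X^a`. -/
def term (a : Expo) (c : k) : Torus k q := coeffs.symm (Finsupp.single a c)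

variable (k q) in
/-- The multiplication, as a bilinear map determined by `X^a X^b = q ^ (form a b) X^(a+b)`. -/
def mulLin : Torus k q →ₗ[k] Torus k q →ₗ[k] Torus k q :=
  (Finsupp.linearCombination k fun a =>
    (Finsupp.linearCombination k fun b =>
      (term (a + b) ((q ^ form a b : kˣ) : k) : Torus k q)) ∘ₗ coeffs.toLinearMap) ∘ₗ
    coeffs.toLinearMap

instance : Mul (Torus k q) := ⟨fun f g => mulLin k q f g⟩
instance : One (Torus k q) := ⟨term 0 1⟩

theorem mul_def (f g : Torus k q) : f * g = mulLin k q f g := rfl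
theorem one_def : (1 : Torus k q) = term 0 1 := rfl

theorem smul_term (a : Expo) (c d : k) : c • (term a d : Torus k q) = term a (c * d) := by
  rw [term, ← map_smul, Finsupp.smul_single, smul_eq_mul, term]

theorem term_mul_term (a b : Expo) (c d : k) :
    (term a c * term b d : Torus k q) = term (a + b) (c * d * ((q ^ form a b : kˣ) : k)) := by
  rw [mul_def, mulLin, LinearMap.comp_apply]
  simp only [LinearEquiv.coe_coe]
  rw [term, LinearEquiv.apply_symm_apply, Finsupp.linearCombination_single, LinearMap.smul_apply,
    LinearMap.comp_apply, LinearEquiv.coe_coe, term, LinearEquiv.apply_symm_apply,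
    Finsupp.linearCombination_single, smul_term, smul_term, mul_assoc]

theorem induct {p : Torus k q → Prop} (f : Torus k q) (h0 : p 0)
    (hadd : ∀ f g, p f → p g → p (f + g)) (hs : ∀ a c, p (term a c)) : p f :=
  Finsupp.induction_linear (motive := p) f h0 hadd hs

protected theorem mul_add' (f g h : Torus k q) : f * (g + h) = f * g + f * h :=
  map_add (mulLin k q f) g h

protected theorem add_mul' (f g h : Torus k q) : (f + g) * h = f * h + g * h :=
  (congrArg (fun t => t h) (map_add (mulLin k q) f g) :)

protected theorem mul_zero' (f : Torus k q) : f * 0 = 0 := map_zero (mulLin k q f)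

protected theorem zero_mul' (f : Torus k q) : 0 * f = 0 :=
  (congrArg (fun t => t f) (map_zero (mulLin k q)) :)

protected theorem mul_assoc' (f g h : Torus k q) : f * g * h = f * (g * h) := by
  induction f using induct with
  | h0 => simp only [Torus.zero_mul']
  | hadd f₁ f₂ h₁ h₂ => simp only [Torus.add_mul', h₁, h₂]
  | hs a c =>
    induction g using induct with
    | h0 => simp only [Torus.zero_mul', Torus.mul_zero']
    | hadd f₁ f₂ h₁ h₂ => simp only [Torus.add_mul', Torus.mul_add', h₁, h₂]
    | hs b d =>
      induction h using induct with
      | h0 => simp only [Torus.mul_zero']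
      | hadd f₁ f₂ h₁ h₂ => simp only [Torus.mul_add', h₁, h₂]
      | hs b' d' =>
        simp only [term_mul_term, form_add_left, form_add_right, zpow_add, Units.val_mul, add_assoc]
        congr 1; ring

theorem form_zero_left (a : Expo) : form 0 a = 0 := by simp [form]
theorem form_zero_right (a : Expo) : form a 0 = 0 := by simp [form]

protected theorem one_mul' (f : Torus k q) : 1 * f = f := by
  induction f using induct with
  | h0 => exact Torus.mul_zero' _
  | hadd f₁ f₂ h₁ h₂ => rw [Torus.mul_add', h₁, h₂]
  | hs a c => simp [one_def, term_mul_term, form_zero_left]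

protected theorem mul_one' (f : Torus k q) : f * 1 = f := by
  induction f using induct with
  | h0 => exact Torus.zero_mul' _
  | hadd f₁ f₂ h₁ h₂ => rw [Torus.add_mul', h₁, h₂]
  | hs a c => simp [one_def, term_mul_term, form_zero_right]

instance : Ring (Torus k q) :=
  { (inferInstance : AddCommGroup (Torus k q)) with
    mul := (· * ·)
    one := 1
    mul_assoc := Torus.mul_assoc'
    one_mul := Torus.one_mul'
    mul_one := Torus.mul_one'
    left_distrib := Torus.mul_add'
    right_distrib := Torus.add_mul'
    zero_mul := Torus.zero_mul'
    mul_zero := Torus.mul_zero' }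

instance : Algebra k (Torus k q) :=
  Algebra.ofModule
    (fun c f g => (congrArg (fun t => t g) (map_smul (mulLin k q) c f) :))
    (fun c f g => map_smul (mulLin k q f) c g)

instance : Nontrivial (Torus k q) := inferInstanceAs (Nontrivial (Expo →₀ k))

/-- The coefficient of `X^a`. -/
def coeff (f : Torus k q) (a : Expo) : k := coeffs f a

/-- The exponents that occur in `f`. -/
def supp (f : Torus k q) : Finset Expo := (coeffs f).support

theorem mem_supp {f : Torus k q} {a : Expo} : a ∈ f.supp ↔ f.coeff a ≠ 0 :=
  Finsupp.mem_support_iff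

theorem eq_sum (f : Torus k q) : f = ∑ a ∈ f.supp, term a (f.coeff a) :=
  by
  conv_lhs => rw [← coeffs.symm_apply_apply f, ← Finsupp.sum_single (coeffs f), Finsupp.sum, map_sum]
  rfl

theorem coeff_term (a b : Expo) (c : k) :
    (term a c : Torus k q).coeff b = if a = b then c else 0 := by
  classical
  exact Finsupp.single_apply

theorem coeff_sum {ι : Type*} (s : Finset ι) (F : ι → Torus k q) (a : Expo) :
    (∑ i ∈ s, F i).coeff a = ∑ i ∈ s, (F i).coeff a := by
  simp only [coeff, map_sum, Finsupp.finsetSum_apply]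

theorem mul_eq_sum (f g : Torus k q) :
    f * g = ∑ a ∈ f.supp, ∑ b ∈ g.supp,
      term (a + b) (f.coeff a * g.coeff b * ((q ^ form a b : kˣ) : k)) := by
  conv_lhs => rw [eq_sum f, eq_sum g]
  rw [Finset.sum_mul]
  simp only [Finset.mul_sum, term_mul_term]

theorem coeff_mul (f g : Torus k q) (c : Expo) :
    (f * g).coeff c = ∑ a ∈ f.supp, ∑ b ∈ g.supp,
      if a + b = c then f.coeff a * g.coeff b * ((q ^ form a b : kˣ) : k) else 0 := by
  rw [mul_eq_sum, coeff_sum]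
  refine Finset.sum_congr rfl fun a _ => ?_
  rw [coeff_sum]
  exact Finset.sum_congr rfl fun b _ => coeff_term _ _ _

theorem supp_nonempty {f : Torus k q} (hf : f ≠ 0) : f.supp.Nonempty :=
  Finsupp.support_nonempty_iff.mpr hf

instance : NoZeroDivisors (Torus k q) where
  eq_zero_or_eq_zero_of_mul_eq_zero := by
    intro f g hfg
    by_contra! hne
    obtain ⟨a, ha, b, hb, hu⟩ :=
      UniqueSums.uniqueAdd_of_nonempty (supp_nonempty hne.1) (supp_nonempty hne.2)
    have h0 : (f * g).coeff (a + b) = 0 := by rw [hfg]; rfl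
    rw [coeff_mul, Finset.sum_eq_single_of_mem a ha, Finset.sum_eq_single_of_mem b hb,
      if_pos rfl] at h0
    · exact mul_ne_zero (mul_ne_zero (mem_supp.mp ha) (mem_supp.mp hb)) (Units.ne_zero _) h0
    · intro b' hb' hne'
      exact if_neg fun h => hne' (hu ha hb' h).2
    · intro a' ha' hne'
      refine Finset.sum_eq_zero fun b' hb' => if_neg fun h => hne' (hu ha' hb' h).1

/-- The exponents of absolute value at most `N`. -/
def box (N : ℕ) : Finset Expo := Fintype.piFinset fun _ => Finset.Icc (-(N : ℤ)) N

theorem mem_box {N : ℕ} {a : Expo} : a ∈ box N ↔ ∀ v, |a v| ≤ N := by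
  simp [box, abs_le]

theorem card_box (N : ℕ) : (box N).card = (2 * N + 1) ^ 28 := by
  have h : Fintype.card QVar = 28 := by decide
  have h' : ((N : ℤ) + 1 - -(N : ℤ)).toNat = 2 * N + 1 := by omega
  simp only [box, Fintype.card_piFinset, Int.card_Icc, h', Finset.prod_const, Finset.card_univ, h]

variable (k q) in
/-- The elements supported in a box. -/
def boxed (N : ℕ) : Submodule k (Torus k q) :=
  (Finsupp.supported k k (box N : Set Expo)).comap (coeffs (k := k) (q := q)).toLinearMap

theorem mem_boxed {N : ℕ} {f : Torus k q} : f ∈ boxed k q N ↔ f.supp ⊆ box N :=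
  Iff.rfl.trans Finset.coe_subset

theorem exists_boxed (f : Torus k q) : ∃ c : ℕ, f ∈ boxed k q c := by
  refine ⟨f.supp.sup fun a => Finset.univ.sup fun v => (a v).natAbs, ?_⟩
  refine mem_boxed.mpr fun a ha => mem_box.mpr fun v => ?_
  have h1 : (a v).natAbs ≤ Finset.univ.sup fun v => (a v).natAbs :=
    Finset.le_sup (f := fun v => (a v).natAbs) (Finset.mem_univ v)
  have h2 : (Finset.univ.sup fun v => (a v).natAbs) ≤
      f.supp.sup fun a => Finset.univ.sup fun v => (a v).natAbs :=
    Finset.le_sup (f := fun a : Expo => Finset.univ.sup fun v => (a v).natAbs) ha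
  rw [Int.abs_eq_natAbs]
  exact_mod_cast h1.trans h2

theorem boxed_mono {M N : ℕ} (h : M ≤ N) : boxed k q M ≤ boxed k q N := fun f hf =>
  mem_boxed.mpr fun a ha =>
    mem_box.mpr fun v => (mem_box.mp (mem_boxed.mp hf ha) v).trans (by exact_mod_cast h)

theorem term_mem_boxed {N : ℕ} {a : Expo} (ha : a ∈ box N) (c : k) : term a c ∈ boxed k q N := by
  rw [boxed, Submodule.mem_comap, LinearEquiv.coe_coe, term, LinearEquiv.apply_symm_apply]
  exact Finsupp.single_mem_supported k _ ha

theorem mul_boxed {M N : ℕ} {f g : Torus k q} (hf : f ∈ boxed k q M) (hg : g ∈ boxed k q N) :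
    f * g ∈ boxed k q (M + N) := by
  rw [mul_eq_sum]
  refine Submodule.sum_mem _ fun a ha => Submodule.sum_mem _ fun b hb => ?_
  refine term_mem_boxed (mem_box.mpr fun v => ?_) _
  have h1 := mem_box.mp (mem_boxed.mp hf ha) v
  have h2 := mem_box.mp (mem_boxed.mp hg hb) v
  push_cast
  exact (abs_add_le _ _).trans (add_le_add h1 h2)

variable (k q) in
/-- Elements supported in a box are given by their coefficients. -/
def boxedEquiv (N : ℕ) : boxed k q N ≃ₗ[k] ((box N : Set Expo) →₀ k) :=
  (LinearEquiv.ofSubmodule' coeffs _).trans (Finsupp.supportedEquivFinsupp (box N : Set Expo))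

instance (N : ℕ) : Module.Finite k (boxed k q N) :=
  Module.Finite.equiv (boxedEquiv k q N).symm

theorem finrank_boxed (N : ℕ) : finrank k (boxed k q N) = (2 * N + 1) ^ 28 := by
  rw [(boxedEquiv k q N).finrank_eq, Module.finrank_finsupp_self, ← card_box]
  exact Fintype.card_coe (box N)

theorem pow_lt (c : ℕ) :
    (2 * (100 * c + c) + 1) ^ 28 < (2 * (100 * c) + 1) ^ 28 + (2 * (100 * c) + 1) ^ 28 := by
  have hle : 100 * (2 * (100 * c + c) + 1) ≤ 101 * (2 * (100 * c) + 1) := by omega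
  have hpow := Nat.pow_le_pow_left hle 28
  have hpos : 0 < (2 * (100 * c) + 1) ^ 28 := Nat.pow_pos (Nat.succ_pos _)
  rw [mul_pow, mul_pow] at hpow
  generalize (2 * (100 * c + c) + 1) ^ 28 = A at *
  generalize (2 * (100 * c) + 1) ^ 28 = B at *
  norm_num at hpow
  omega

/-- The left Ore condition, by counting dimensions: for large `N` the left multiples of `f` and of
`g` by elements supported in the box of size `N` cannot be independent. -/
theorem exists_common_multiple (f g : Torus k q) (hg : g ≠ 0) :
    ∃ u v : Torus k q, u ≠ 0 ∧ u * f = v * g := by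
  obtain ⟨c₁, h₁⟩ := exists_boxed f
  obtain ⟨c₂, h₂⟩ := exists_boxed g
  obtain ⟨c, hf', hg'⟩ : ∃ c, f ∈ boxed k q c ∧ g ∈ boxed k q c :=
    ⟨max c₁ c₂, boxed_mono (le_max_left c₁ c₂) h₁, boxed_mono (le_max_right c₁ c₂) h₂⟩
  let L₀ : (boxed k q (100 * c) × boxed k q (100 * c)) →ₗ[k] Torus k q :=
    (LinearMap.mulRight k f ∘ₗ Submodule.subtype _).coprod
      (-(LinearMap.mulRight k g ∘ₗ Submodule.subtype _))
  have hL₀ : ∀ p, L₀ p = p.1.1 * f - p.2.1 * g := fun p => by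
    simp [L₀, sub_eq_add_neg]
  let L : (boxed k q (100 * c) × boxed k q (100 * c)) →ₗ[k] boxed k q (100 * c + c) :=
    L₀.codRestrict _ fun p => by
      rw [hL₀]
      exact Submodule.sub_mem _ (mul_boxed p.1.2 hf') (mul_boxed p.2.2 hg')
  have hlt : finrank k (boxed k q (100 * c + c)) <
      finrank k (boxed k q (100 * c) × boxed k q (100 * c)) := by
    rw [Module.finrank_prod, finrank_boxed, finrank_boxed]
    exact pow_lt c
  obtain ⟨p, hp, hp0⟩ := Submodule.exists_mem_ne_zero_of_ne_bot
    (LinearMap.ker_ne_bot_of_finrank_lt (f := L) hlt)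
  have heq : p.1.1 * f = p.2.1 * g := by
    rw [← sub_eq_zero, ← hL₀]
    exact congrArg Subtype.val (LinearMap.mem_ker.mp hp)
  refine ⟨p.1.1, p.2.1, fun h1 => hp0 ?_, heq⟩
  rw [h1, zero_mul] at heq
  have h2 : p.2.1 = 0 := (mul_eq_zero.mp heq.symm).resolve_right hg
  exact Prod.ext (Subtype.ext h1) (Subtype.ext h2)

theorem nonempty_oreSet :
    Nonempty (OreLocalization.OreSet (nonZeroDivisors (Torus k q))) := by
  rw [OreLocalization.nonempty_oreSet_iff_of_noZeroDivisors]
  intro r s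
  obtain ⟨u, v, hu, h⟩ := exists_common_multiple r s (nonZeroDivisors.ne_zero s.2)
  exact ⟨v, ⟨u, mem_nonZeroDivisors_of_ne_zero hu⟩, h⟩

instance : OreLocalization.OreSet (nonZeroDivisors (Torus k q)) := nonempty_oreSet.some

end Torus

/-- The skew field `𝒦`: the field of (left Ore) fractions of the quantum torus. -/
abbrev SkewField (k : Type*) [Field k] (q : kˣ) : Type _ :=
  OreLocalization (nonZeroDivisors (Torus k q)) (Torus k q)

variable {k : Type*} [Field k] {q : kˣ}

/-- The generators of the skew field. -/
def X (v : QVar) : SkewField k q :=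
  OreLocalization.numeratorRingHom (Torus.term (Pi.single v 1) 1 : Torus k q)

/-! ### The birational action of the simple reflections -/

/-- The values on the generators of the exchange `e_a ↔ e_b`, `τ_a ↔ τ_b`. -/
def exchange (a b : Fin 11) : QVar → SkewField k q
  | .e i => X (.e (Equiv.swap a b i))
  | .τ i => X (.τ (Equiv.swap a b i))
  | v => X v

/-- The values of `s_0` on the generators. -/
def reflect₀ : QVar → SkewField k q
  | .e 9 => X (.h 1) / X (.e 10)
  | .e 10 => X (.h 1) / X (.e 9)
  | .h 0 => X (.h 0) * X (.h 1) / (X (.e 9) * X (.e 10))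
  | .x => X .x * ((1 + X .y * (X (.h 1) / X (.e 9))) / (1 + X .y * X (.e 10)))
  | .τ 9 => (1 + X .y * X (.e 10)) * (X (.σ 1) / X (.τ 10))
  | .τ 10 => (X (.σ 1) / X (.τ 9)) * (1 + X .y * (X (.h 1) / X (.e 9)))
  | .σ 0 => (1 + X .y * X (.e 10)) * (X (.σ 0) * X (.σ 1) / (X (.τ 9) * X (.τ 10)))
  | v => X v

/-- The values of `s_3` on the generators. -/
def reflect₃ : QVar → SkewField k q
  | .e 0 => X (.h 0) / X (.e 6)
  | .e 6 => X (.h 0) / X (.e 0)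
  | .h 1 => X (.h 0) * X (.h 1) / (X (.e 0) * X (.e 6))
  | .y => ((1 + X .x * (X (.e 6) / X (.h 0))) / (1 + X .x / X (.e 0))) * X .y
  | .τ 0 => (1 + X .x * (X (.e 6) / X (.h 0))) * (X (.σ 0) / X (.τ 6))
  | .τ 6 => (X (.σ 0) / X (.τ 0)) * (1 + X .x / X (.e 0))
  | .σ 1 => (X (.σ 0) * X (.σ 1) / (X (.τ 0) * X (.τ 6))) * (1 + X .x / X (.e 0))
  | v => X v

/-- The values of the simple reflections `s_0, …, s_8` on the generators. -/
def reflect : Fin 9 → QVar → SkewField k q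
  | 0 => reflect₀
  | 1 => exchange 7 8
  | 2 => exchange 6 7
  | 3 => reflect₃
  | 4 => exchange 0 1
  | 5 => exchange 1 2
  | 6 => exchange 2 3
  | 7 => exchange 3 4
  | 8 => exchange 4 5

/-- `s 0, …, s 8` are the automorphisms of the skew field with the prescribed values on the
generators. -/
def IsReflections (s : Fin 9 → (SkewField k q ≃ₐ[k] SkewField k q)) : Prop :=
  ∀ i v, s i (X v) = reflect i v

/-! ### Degree/multiplicity data -/

/-- The data `λ = (d_i, m_i)`, i.e. the class `d₁H₁ + d₂H₂ - m₁E₁ - ⋯ - m₁₁E₁₁`. -/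
@[ext]
structure Pic where
  d : Fin 2 → ℤ
  m : Fin 11 → ℤ

/-- The class `E_i`. -/
def E (i : Fin 11) : Pic := ⟨0, -Pi.single i 1⟩

/-- The multiplicative notation `e^λ`. -/
def ePow (l : Pic) : SkewField k q :=
  X (.h 0) ^ l.d 0 * X (.h 1) ^ l.d 1 * (List.ofFn fun i => X (.e i) ^ (-l.m i)).prod

/-- The multiplicative notation `τ^λ`. -/
def tauPow (l : Pic) : SkewField k q :=
  X (.σ 0) ^ l.d 0 * X (.σ 1) ^ l.d 1 * (List.ofFn fun i => X (.τ i) ^ (-l.m i)).prod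

/-- The action `s_i^*` of the simple reflections on the data `λ`. -/
def sStar : Fin 9 → Pic → Pic
  | 0, l => ⟨Function.update l.d 1 (l.d 0 + l.d 1 - l.m 9 - l.m 10),
      Function.update (Function.update l.m 9 (l.d 0 - l.m 10)) 10 (l.d 0 - l.m 9)⟩
  | 1, l => ⟨l.d, l.m ∘ Equiv.swap 7 8⟩
  | 2, l => ⟨l.d, l.m ∘ Equiv.swap 6 7⟩
  | 3, l => ⟨Function.update l.d 0 (l.d 0 + l.d 1 - l.m 0 - l.m 6),
      Function.update (Function.update l.m 0 (l.d 1 - l.m 6)) 6 (l.d 1 - l.m 0)⟩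
  | 4, l => ⟨l.d, l.m ∘ Equiv.swap 0 1⟩
  | 5, l => ⟨l.d, l.m ∘ Equiv.swap 1 2⟩
  | 6, l => ⟨l.d, l.m ∘ Equiv.swap 2 3⟩
  | 7, l => ⟨l.d, l.m ∘ Equiv.swap 3 4⟩
  | 8, l => ⟨l.d, l.m ∘ Equiv.swap 4 5⟩

theorem sStar_involutive (i : Fin 9) : Function.Involutive (sStar i) := by
  intro l
  fin_cases i
  all_goals
    ext j
    · fin_cases j <;> simp [sStar] <;> ring
    · fin_cases j <;> simp [sStar, Equiv.swap_apply_def]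

/-- The group of transformations of the data generated by the simple reflections. -/
def weylGroup : Subgroup (Equiv.Perm Pic) :=
  Subgroup.closure (Set.range fun i => (sStar_involutive i).toPerm)

/-- The orbit `Λ` of `{E₁, …, E₁₁}` under the Weyl group. -/
def excOrbit : Set Pic := {l | ∃ w ∈ weylGroup, ∃ i, l = w (E i)}

/-- The action of the word `s_{i₁} ⋯ s_{iᵣ}` on the data. -/
def wordStar (w : List (Fin 9)) (l : Pic) : Pic := w.foldr sStar l

/-- The action of the word `s_{i₁} ⋯ s_{iᵣ}` on the skew field. -/
def wordAct (s : Fin 9 → (SkewField k q ≃ₐ[k] SkewField k q)) (w : List (Fin 9))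
    (G : SkewField k q) : SkewField k q :=
  w.foldr (fun i G => s i G) G

/-! ### Non-commutative polynomials and the conditions `(x)_λ`, `(y)_λ` -/

variable (k q) in
/-- The field `k(h_i, e_i)` of parameters. -/
def params : Subfield (SkewField k q) :=
  Subfield.closure (Set.range (algebraMap k (SkewField k q)) ∪
    (Set.range (fun i => X (.h i)) ∪ Set.range fun i => X (.e i)))

/-- The non-commutative polynomial `∑ c_{ij} x^i y^j`. -/
def polyEval (c : ℕ × ℕ →₀ params k q) : SkewField k q :=
  c.sum fun p a => (a : SkewField k q) * X .x ^ p.1 * X .y ^ p.2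

/-- `F` is a non-commutative polynomial in `x`, `y` with coefficients in `k(h_i, e_i)`. -/
def IsNCPoly (F : SkewField k q) : Prop := ∃ c, polyEval c = F

/-- `F` is a non-commutative polynomial in `x`, `y` and `F(0,0) = 1`. -/
def IsNormalized (F : SkewField k q) : Prop := ∃ c, polyEval c = F ∧ c (0, 0) = 1

/-- `U` is a polynomial in `z` of degree at most `n` with coefficients in `k(h_i, e_i)`
(so `U = 0` if `n < 0`). -/
def IsPolyOfDegreeLE (z : SkewField k q) (n : ℤ) (U : SkewField k q) : Prop :=
  ∃ c : ℕ → params k q, U = ∑ j ∈ Finset.range (n + 1).toNat, (c j : SkewField k q) * z ^ j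

/-- The product `∏_{t=a}^{b-1} (1 + q^t z)`, equal to `1` if `b ≤ a`. -/
def qProd (z : SkewField k q) (a b : ℤ) : SkewField k q :=
  ((List.range (b - a).toNat).map fun j : ℕ => 1 + ((q ^ (a + j) : kˣ) : k) • z).prod

/-- The condition `(x)_λ`. -/
def CondX (l : Pic) (F : SkewField k q) : Prop :=
  ∃ U : ℕ → SkewField k q,
    (∀ i ∈ Finset.range (l.d 0 + 1).toNat,
      IsPolyOfDegreeLE (X .y)
        (l.d 1 - max ((i : ℤ) - l.d 0 + l.m 9) 0 - max (l.m 10 - i) 0) (U i)) ∧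
    F = ∑ i ∈ Finset.range (l.d 0 + 1).toNat,
      X .x ^ i * qProd (X (.e 10) * X .y) i (l.m 10) *
        qProd (X (.h 1) / X (.e 9) * X .y) (l.d 0 - l.m 9) i * U i

/-- The condition `(y)_λ`. -/
def CondY (l : Pic) (F : SkewField k q) : Prop :=
  ∃ V : ℕ → SkewField k q,
    (∀ i ∈ Finset.range (l.d 1 + 1).toNat,
      IsPolyOfDegreeLE (X .x)
        (l.d 0 - (([0, 1, 2, 3, 4, 5] : List (Fin 11)).map fun j => max (l.m j - i) 0).sum -
          (([6, 7, 8] : List (Fin 11)).map fun j => max ((i : ℤ) - l.d 1 + l.m j) 0).sum) (V i)) ∧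
    F = ∑ i ∈ Finset.range (l.d 1 + 1).toNat,
      (([0, 1, 2, 3, 4, 5] : List (Fin 11)).map fun j =>
          qProd (1 / X (.e j) * X .x) (i - l.m j) 0).prod *
        (([6, 7, 8] : List (Fin 11)).map fun j =>
          qProd (X (.e j) / X (.h 0) * X .x) 0 (i - l.d 1 + l.m j)).prod *
        V i * X .y ^ i

/-- `F` satisfies both conditions `(x)_λ` and `(y)_λ`. -/
def IsF (l : Pic) (F : SkewField k q) : Prop := CondX l F ∧ CondY l F

end QuantumE8

end

open QuantumE8

noncomputable section

namespace QuantumE8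

/-! ### Automorphisms of the skew field: construction, uniqueness, involutivity. -/

section Torus

open Module

variable {k : Type*} [Field k] {q : kˣ}

/-! ### Monomials in the skew field -/

/-! Existence of the `s_i`. Each of `s_0`, `s_3` is a change of monomials preserving the commutation
form, followed by an inverse mutation in `W` and a mutation in `Z`; the mutation in `X^c` multiplies
`X^a` by the q-shifted factorial `gq (X^c) n`, where `q^n` is the commutation factor of `X^a` with
`X^c`. For `s_0` one takes `Z = e₁₁ y`, `W = (h₂/e₁₀) y`, for `s_3` one takes `Z = (e₇/h₁) x`, `W =
x/e₁`. The cocycle identity `QRegular.gq_add` makes a mutation a homomorphism on the torus, and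
`mutLift_injective` lets it extend to fractions. The resulting `s_i` are involutions
(`sRefl_sRefl`).

Geometry of the conditions. Besides bounding the bidegree by `(d₁, d₂)`, `(x)_λ` prescribes
q-multiplicities `m₁₁`, `m₁₀` at one point of the line `x = 0` and one of `x = ∞`, and `(y)_λ`
prescribes `m₁, …, m₆` at six points of `y = 0` and `m₇, m₈, m₉` at three points of `y = ∞`. A
q-multiplicity on the line `v = 0` means: in `F = ∑ f_i(u) v^i` the coefficient `f_i` is divisible
by a product of `m - i` linear factors whose roots form a q-string (`condX_iff`, `condY_iff`).

Part (1). The reflection `s_0` fixes `y` and multiplies `x` by a rational function of `y`. It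
therefore treats `(x)_λ` term by term: `x^i τ^λ` becomes `x^i τ^{s_0^*λ}` times a quotient of
q-factorials in `y`, and this quotient replaces the old divisor of the `i`-th coefficient exactly by
the new one (`gq_mul_evu`, `exists_form_of_reflection`). In particular the result is a polynomial.
The condition `(y)_λ` is local at `y = 0` and `y = ∞`. There the substitution is regular, the extra
factor is a unit after a power of `y` accounting for the change of `d₂`, and the points move as the
parameters do. Hence q-multiplicities survive up to denominators that are invertible at the line
(`IsSubst.map_mem_hat`), and such denominators do not affect divisibility of the coefficients of a
polynomial (`dvd_coeff_of_mem_hat`). The divisors at `0` and at `∞` are coprime, so they combine.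
The same argument with `x` and `y` interchanged serves `s_3` (`exists_form_step` covers both), and
the other `s_i` only permute points lying on the same line.

Part (2). For `E_j` the bidegree is zero, so the solutions are the constants. Since `s_i` is an
involution, it identifies the solutions for `λ` with those for `s_i^*λ` semilinearly over the
parameters; thus all solution spaces along the orbit are lines. The constant term is only acted on
by the automorphism of the parameters, so the value `1` persists and fixes the generator
(`exists_wordAct_eq`). -/

variable (k q) in
/-- The embedding of the quantum torus in its skew field of fractions. -/
def numA : Torus k q →ₐ[k] SkewField k q :=
  { (OreLocalization.numeratorRingHom : Torus k q →+* SkewField k q) with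
    commutes' := fun _ => rfl }

theorem numA_injective : Function.Injective (numA k q) :=
  OreLocalization.numeratorHom_inj fun _ ha => (mem_nonZeroDivisors_iff.mp ha).1

theorem numA_ne_zero {f : Torus k q} (hf : f ≠ 0) : numA k q f ≠ 0 :=
  (map_ne_zero_iff _ numA_injective).mpr hf

/-- The Laurent monomial `X^a`. -/
def mono (a : Expo) : SkewField k q := numA k q (Torus.term a 1)

theorem X_eq_mono (v : QVar) : (X v : SkewField k q) = mono (Pi.single v 1) := rfl

theorem Torus.term_ne_zero (a : Expo) {c : k} (hc : c ≠ 0) : (Torus.term a c : Torus k q) ≠ 0 := by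
  intro h
  have h2 := Torus.coeff_term (q := q) a a c
  rw [if_pos rfl, h] at h2
  exact hc h2.symm

theorem mono_ne_zero (a : Expo) : (mono a : SkewField k q) ≠ 0 :=
  numA_ne_zero (Torus.term_ne_zero a one_ne_zero)

theorem mono_zero : (mono 0 : SkewField k q) = 1 := map_one (numA k q)

theorem numA_term (a : Expo) (c : k) : numA k q (Torus.term a c) = c • mono a := by
  rw [mono, ← map_smul, Torus.smul_term, mul_one]

theorem mono_mul_mono (a b : Expo) :
    (mono a * mono b : SkewField k q) = ((q ^ form a b : kˣ) : k) • mono (a + b) := by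
  rw [mono, mono, ← map_mul, Torus.term_mul_term, numA_term, one_mul, one_mul]

theorem mono_mul_mono_of_form_eq_zero {a b : Expo} (h : form a b = 0) :
    (mono a * mono b : SkewField k q) = mono (a + b) := by
  rw [mono_mul_mono, h, zpow_zero, Units.val_one, one_smul]

theorem mono_div_mono {a b : Expo} (h : form (a - b) b = 0) :
    (mono a / mono b : SkewField k q) = mono (a - b) := by
  rw [div_eq_iff (mono_ne_zero b), mono_mul_mono_of_form_eq_zero h, sub_add_cancel]

theorem mono_commute {a b : Expo} (h : form a b = form b a) :
    Commute (mono a : SkewField k q) (mono b) := by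
  rw [Commute, SemiconjBy, mono_mul_mono, mono_mul_mono, h, add_comm]

theorem form_neg_right (a b : Expo) : form a (-b) = -form a b := by
  have := form_add_right a (-b) b
  rw [neg_add_cancel, Torus.form_zero_right] at this
  linarith

theorem mono_inv {a : Expo} (h : form a a = 0) : (mono a : SkewField k q)⁻¹ = mono (-a) := by
  rw [inv_eq_iff_eq_inv, eq_comm, inv_eq_of_mul_eq_one_left, ]
  rw [mono_mul_mono_of_form_eq_zero (by rw [form_neg_right, h, neg_zero]), add_neg_cancel, mono_zero]

theorem form_nsmul_left (n : ℕ) (a b : Expo) : form (n • a) b = n * form a b := by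
  induction n with
  | zero => simp [Torus.form_zero_left]
  | succ n ih => rw [succ_nsmul, form_add_left, ih]; push_cast; ring

theorem form_nsmul_right (n : ℕ) (a b : Expo) : form a (n • b) = n * form a b := by
  induction n with
  | zero => simp [Torus.form_zero_right]
  | succ n ih => rw [succ_nsmul, form_add_right, ih]; push_cast; ring

theorem mono_pow {a : Expo} (h : form a a = 0) (n : ℕ) :
    (mono a : SkewField k q) ^ n = mono (n • a) := by
  induction n with
  | zero => simp [mono_zero]
  | succ n ih =>
    rw [pow_succ, ih, mono_mul_mono_of_form_eq_zero (by rw [form_nsmul_left, h, mul_zero]), succ_nsmul]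

theorem mono_zpow {a : Expo} (h : form a a = 0) (n : ℤ) :
    (mono a : SkewField k q) ^ n = mono (n • a) := by
  obtain ⟨n, rfl | rfl⟩ := n.eq_nat_or_neg
  · rw [zpow_natCast, mono_pow h, natCast_zsmul]
  · rw [zpow_neg, zpow_natCast, mono_pow h, mono_inv (by rw [form_nsmul_left, form_nsmul_right, h]; simp),
      neg_smul, natCast_zsmul]

/-- The exponent of `q` in the commutation relation of `X^a` with `X^c`. -/
def kap (c : Expo) : Expo →+ ℤ where
  toFun a := form a c - form c a
  map_zero' := by simp [Torus.form_zero_left, Torus.form_zero_right]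
  map_add' a b := by rw [form_add_left, form_add_right]; ring

theorem kap_apply (c a : Expo) : kap c a = form a c - form c a := rfl

theorem mono_mul_comm (a c : Expo) : (mono a * mono c : SkewField k q) =
    (((q ^ kap c a : kˣ) : k) • mono c) * mono a := by
  rw [smul_mul_assoc, mono_mul_mono, mono_mul_mono, smul_smul, ← Units.val_mul, ← zpow_add, kap_apply,
    sub_add_cancel, add_comm]

/-! ### Homomorphisms from the torus and the skew field -/

/-- Every `z` satisfies `s z = r` with `r`, `s` in the torus and `s ≠ 0`. The image of `s` is
invertible in a division ring, so the values on the torus determine the image of `z`. -/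
theorem SkewField.hom_ext {A : Type*} [DivisionRing A] [Algebra k A] {φ ψ : SkewField k q →ₐ[k] A}
    (h : ∀ a, φ (mono a) = ψ (mono a)) : φ = ψ := by
  have hn : ∀ f, φ (numA k q f) = ψ (numA k q f) := by
    intro f
    induction f using Torus.induct with
    | h0 => simp
    | hadd f g hf hg => simp only [map_add, hf, hg]
    | hs a c => rw [numA_term, map_smul, map_smul, h]
  ext z
  induction z using OreLocalization.ind with
  | _ r s =>
    have hs : numA k q s ≠ 0 := numA_ne_zero (nonZeroDivisors.ne_zero s.2)
    have hz : numA k q s * (r /ₒ s : SkewField k q) = numA k q r := by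
      change (s : Torus k q) /ₒ 1 * (r /ₒ s) = r /ₒ 1
      exact OreLocalization.mul_cancel
    have h1 := congrArg φ hz
    have h2 := congrArg ψ hz
    rw [map_mul] at h1 h2
    rw [hn, hn, ← h2] at h1
    exact mul_left_cancel₀ ((map_ne_zero ψ).mpr hs) h1

/-- Up to powers of `q`, sums and negatives of exponents correspond to products and inverses of
monomials. The exponents on which two homomorphisms agree thus form a subgroup, which contains the
unit vectors. -/
theorem SkewField.hom_ext_X {A : Type*} [DivisionRing A] [Algebra k A]
    {φ ψ : SkewField k q →ₐ[k] A} (h : ∀ v, φ (X v) = ψ (X v)) : φ = ψ := by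
  let S : AddSubgroup Expo :=
    { carrier := {a | φ (mono a) = ψ (mono a)}
      zero_mem' := by simp [mono_zero]
      add_mem' := by
        intro a b ha hb
        have h3 : (mono (a + b) : SkewField k q) =
            (((q ^ form a b : kˣ) : k))⁻¹ • (mono a * mono b) := by
          rw [mono_mul_mono, smul_smul, inv_mul_cancel₀ (Units.ne_zero _), one_smul]
        simp only [Set.mem_ofPred_eq] at *
        rw [h3, map_smul, map_smul, map_mul, map_mul, ha, hb]
      neg_mem' := by
        intro a ha
        have h3 : (mono (-a) : SkewField k q) = (((q ^ form (-a) a : kˣ) : k)) • (mono a)⁻¹ := by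
          rw [← mul_inv_cancel_right₀ (mono_ne_zero a) (mono (-a)), mono_mul_mono, neg_add_cancel,
            mono_zero, smul_mul_assoc, one_mul]
        simp only [Set.mem_ofPred_eq] at *
        rw [h3, map_smul, map_smul, map_inv₀, map_inv₀, ha] }
  refine SkewField.hom_ext fun a => ?_
  have ha : a ∈ S := by
    rw [← Finset.univ_sum_single a]
    refine sum_mem fun v _ => ?_
    have : Pi.single v (a v) = a v • (Pi.single v 1 : Expo) := by
      rw [← Pi.single_smul]; simp
    rw [this]
    exact zsmul_mem (K := S) (h v) _
  exact ha

/-- The homomorphism from the torus with prescribed values on monomials. -/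
def Torus.lift {A : Type*} [Ring A] [Algebra k A] (g : Expo → A) (h0 : g 0 = 1)
    (hg : ∀ a b, g a * g b = ((q ^ form a b : kˣ) : k) • g (a + b)) : Torus k q →ₐ[k] A :=
  AlgHom.ofLinearMap (Finsupp.linearCombination k g ∘ₗ Torus.coeffs.toLinearMap)
    (by
      change Finsupp.linearCombination k g (Finsupp.single 0 1) = 1
      rw [Finsupp.linearCombination_single, h0, one_smul])
    (by
      have ht : ∀ a c, (Finsupp.linearCombination k g ∘ₗ Torus.coeffs.toLinearMap)
          (Torus.term a c : Torus k q) = c • g a := fun a c =>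
        Finsupp.linearCombination_single _ _ _
      intro x y
      induction x using Torus.induct with
      | h0 => simp only [zero_mul, map_zero]
      | hadd f₁ f₂ h₁ h₂ => simp only [add_mul, map_add, h₁, h₂]
      | hs a c =>
        induction y using Torus.induct with
        | h0 => simp only [mul_zero, map_zero]
        | hadd f₁ f₂ h₁ h₂ => simp only [mul_add, map_add, h₁, h₂]
        | hs b d =>
          rw [Torus.term_mul_term, ht, ht, ht, smul_mul_smul_comm, hg, smul_smul])

theorem Torus.lift_term {A : Type*} [Ring A] [Algebra k A] (g : Expo → A) (h0 : g 0 = 1)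
    (hg : ∀ a b, g a * g b = ((q ^ form a b : kˣ) : k) • g (a + b)) (a : Expo) (c : k) :
    Torus.lift (q := q) g h0 hg (Torus.term a c) = c • g a :=
  Finsupp.linearCombination_single _ _ _

/-- An injective homomorphism from the torus extends to the skew field. -/
def SkewField.extend (φ : Torus k q →ₐ[k] SkewField k q) (hφ : Function.Injective φ) :
    SkewField k q →ₐ[k] SkewField k q :=
  { OreLocalization.universalHom (φ : Torus k q →+* SkewField k q)
      { toFun := fun s => Units.mk0 (φ s)
          ((map_ne_zero_iff φ hφ).mpr (nonZeroDivisors.ne_zero s.2))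
        map_one' := by ext; simp
        map_mul' := fun a b => by ext; simp } (fun _ => rfl) with
    commutes' := fun r => by
      refine (OreLocalization.universalHom_commutes _ _ _ (r := algebraMap k (Torus k q) r)).trans ?_
      exact φ.commutes r }

theorem SkewField.extend_numA (φ : Torus k q →ₐ[k] SkewField k q) (hφ : Function.Injective φ)
    (f : Torus k q) : SkewField.extend φ hφ (numA k q f) = φ f :=
  OreLocalization.universalHom_commutes _ _ _

/-- A homomorphism from the torus is injective if, up to denominators, it has a left inverse. -/
theorem injective_of_quasi_left_inverse (φ ψ : Torus k q →ₐ[k] SkewField k q)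
    (h : ∀ f, ∃ d g : Torus k q, d ≠ 0 ∧ numA k q g = numA k q d * φ f ∧
      ψ g = numA k q d * numA k q f) : Function.Injective φ := by
  refine (injective_iff_map_eq_zero φ).mpr fun f hf => ?_
  obtain ⟨d, g, hd, h1, h2⟩ := h f
  rw [hf, mul_zero] at h1
  -- The numerator `g` of the image of `f` vanishes, and applying `ψ` turns this into `d f = 0` in a
  -- domain.
  have hg : g = 0 := numA_injective (h1.trans (map_zero _).symm)
  rw [hg, map_zero, ← map_mul] at h2
  have := numA_injective (h2.symm.trans (map_zero _).symm)
  exact (mul_eq_zero.mp this).resolve_left hd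

/-! ### Monomial automorphisms -/

theorem mono_map_mul_mono_map {M : Expo ≃+ Expo} (hM : ∀ a b, form (M a) (M b) = form a b)
    (a b : Expo) : (mono (M a) * mono (M b) : SkewField k q) =
      ((q ^ form a b : kˣ) : k) • mono (M (a + b)) := by
  rw [mono_mul_mono, hM, map_add]

theorem form_symm_map {M : Expo ≃+ Expo} (hM : ∀ a b, form (M a) (M b) = form a b) (a b : Expo) :
    form (M.symm a) (M.symm b) = form a b := by
  rw [← hM, M.apply_symm_apply, M.apply_symm_apply]

variable (k q) in
/-- The homomorphism of the torus given by a form preserving change of monomials. -/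
def monoLift (M : Expo ≃+ Expo) (hM : ∀ a b, form (M a) (M b) = form a b) :
    Torus k q →ₐ[k] SkewField k q :=
  Torus.lift (fun a => mono (M a)) (by rw [map_zero, mono_zero]) (mono_map_mul_mono_map hM)

theorem monoLift_term (M : Expo ≃+ Expo) (hM : ∀ a b, form (M a) (M b) = form a b) (a : Expo)
    (c : k) : monoLift k q M hM (Torus.term a c) = c • mono (M a) :=
  Torus.lift_term _ _ _ _ _

theorem monoLift_injective (M : Expo ≃+ Expo) (hM : ∀ a b, form (M a) (M b) = form a b) :
    Function.Injective (monoLift k q M hM) := by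
  refine injective_of_quasi_left_inverse _ (monoLift k q M.symm (form_symm_map hM)) ?_
  intro f
  refine ⟨1, ?_⟩
  induction f using Torus.induct with
  | h0 => exact ⟨0, one_ne_zero, by simp, by simp⟩
  | hadd f₁ f₂ h₁ h₂ =>
    obtain ⟨g₁, -, h₁, h₁'⟩ := h₁
    obtain ⟨g₂, -, h₂, h₂'⟩ := h₂
    exact ⟨g₁ + g₂, one_ne_zero, by simp only [map_add, h₁, h₂, mul_add],
      by simp only [map_add, h₁', h₂', mul_add]⟩
  | hs a c =>
    refine ⟨Torus.term (M a) c, one_ne_zero, ?_, ?_⟩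
    · rw [numA_term, monoLift_term, map_one, one_mul]
    · rw [numA_term, monoLift_term, map_one, one_mul, M.symm_apply_apply]

/-- The endomorphism of the skew field given by a form preserving change of monomials. -/
def monoHom (M : Expo ≃+ Expo) (hM : ∀ a b, form (M a) (M b) = form a b) :
    SkewField k q →ₐ[k] SkewField k q :=
  SkewField.extend (monoLift k q M hM) (monoLift_injective M hM)

theorem monoHom_mono (M : Expo ≃+ Expo) (hM : ∀ a b, form (M a) (M b) = form a b) (a : Expo) :
    monoHom (q := q) (k := k) M hM (mono a) = mono (M a) := by
  rw [monoHom, mono, SkewField.extend_numA, monoLift_term, one_smul]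

/-- The automorphism of the skew field given by a form preserving change of monomials. -/
def monoEquiv (M : Expo ≃+ Expo) (hM : ∀ a b, form (M a) (M b) = form a b) :
    SkewField k q ≃ₐ[k] SkewField k q :=
  AlgEquiv.ofAlgHom (monoHom M hM) (monoHom M.symm (form_symm_map hM))
    (SkewField.hom_ext fun a => by simp [monoHom_mono])
    (SkewField.hom_ext fun a => by simp [monoHom_mono])

theorem monoEquiv_mono (M : Expo ≃+ Expo) (hM : ∀ a b, form (M a) (M b) = form a b) (a : Expo) :
    monoEquiv (q := q) (k := k) M hM (mono a) = mono (M a) :=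
  monoHom_mono M hM a

/-! ### The `q`-shifted factorial with integer index -/

theorem qProd_of_le {z : SkewField k q} {a b : ℤ} (h : b ≤ a) : qProd z a b = 1 := by
  rw [qProd, Int.toNat_eq_zero.mpr (by omega)]; rfl

theorem qProd_add_one {z : SkewField k q} {a b : ℤ} (h : a ≤ b) :
    qProd z a (b + 1) = qProd z a b * (1 + ((q ^ b : kˣ) : k) • z) := by
  have h1 : (b + 1 - a).toNat = (b - a).toNat + 1 := by omega
  have h2 : a + (((b - a).toNat : ℕ) : ℤ) = b := by omega
  rw [qProd, h1, List.range_succ, List.map_append, List.prod_append, List.map_singleton,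
    List.prod_singleton, h2]
  rfl

theorem qProd_eq_mul {z : SkewField k q} {a b : ℤ} (h : a < b) :
    qProd z a b = (1 + ((q ^ a : kˣ) : k) • z) * qProd z (a + 1) b := by
  have h1 : (b - a).toNat = (b - (a + 1)).toNat + 1 := by omega
  rw [qProd, h1, List.range_succ_eq_map, List.map_cons, List.prod_cons, List.map_map, Nat.cast_zero,
    add_zero, qProd]
  congr 2
  refine List.map_congr_left fun j _ => ?_
  simp only [Function.comp_apply]
  rw [show a + ((j.succ : ℕ) : ℤ) = a + 1 + j by push_cast; ring]

theorem qProd_commute {z w : SkewField k q} (h : Commute z w) (a b : ℤ) :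
    Commute (qProd z a b) w := by
  rw [qProd]
  refine Commute.list_prod_left _ _ fun t ht => ?_
  obtain ⟨j, -, rfl⟩ := List.mem_map.mp ht
  exact (Commute.one_left w).add_left (h.smul_left _)

theorem map_qProd (φ : SkewField k q →ₐ[k] SkewField k q) (z : SkewField k q) (a b : ℤ) :
    φ (qProd z a b) = qProd (φ z) a b := by
  rw [qProd, map_list_prod, List.map_map, qProd]
  congr 1
  refine List.map_congr_left fun j _ => ?_
  simp

/-- None of the factors `1 + q^t z` vanishes. -/
def QRegular (z : SkewField k q) : Prop := ∀ t : ℤ, 1 + ((q ^ t : kˣ) : k) • z ≠ 0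

theorem QRegular.qProd_ne_zero {z : SkewField k q} (hz : QRegular z) (a b : ℤ) :
    qProd z a b ≠ 0 := by
  rw [qProd]
  refine List.prod_ne_zero fun h => ?_
  obtain ⟨j, -, h⟩ := List.mem_map.mp h
  exact hz _ h

theorem qRegular_mono {c : Expo} (hc : c ≠ 0) : QRegular (mono c : SkewField k q) := by
  intro t h
  rw [← numA_term, ← map_one (numA k q), ← map_add] at h
  have h1 : (1 + Torus.term c ((q ^ t : kˣ) : k) : Torus k q) = 0 :=
    numA_injective (h.trans (map_zero _).symm)
  have h2 : (1 + Torus.term c ((q ^ t : kˣ) : k) : Torus k q).coeff 0 = 0 := by rw [h1]; rfl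
  have h3 : (1 + Torus.term c ((q ^ t : kˣ) : k) : Torus k q).coeff 0 =
    (Torus.term 0 1 : Torus k q).coeff 0 + (Torus.term c ((q ^ t : kˣ) : k) : Torus k q).coeff 0 :=
    rfl
  rw [h2, Torus.coeff_term, Torus.coeff_term, if_pos rfl, if_neg hc, add_zero] at h3
  exact one_ne_zero h3.symm

/-- The product of `1 + q^t z` over `0 ≤ t < n`, or its analogue for negative `n`. -/
def gq (z : SkewField k q) (n : ℤ) : SkewField k q := qProd z 0 n * (qProd z n 0)⁻¹

theorem gq_zero (z : SkewField k q) : gq z 0 = 1 := by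
  rw [gq, qProd_of_le le_rfl, inv_one, mul_one]

theorem gq_of_nonneg (z : SkewField k q) {n : ℤ} (hn : 0 ≤ n) : gq z n = qProd z 0 n := by
  rw [gq, qProd_of_le (b := 0) hn, inv_one, mul_one]

theorem gq_of_nonpos (z : SkewField k q) {n : ℤ} (hn : n ≤ 0) : gq z n = (qProd z n 0)⁻¹ := by
  rw [gq, qProd_of_le (a := 0) hn, one_mul]

theorem gq_one (z : SkewField k q) : gq z 1 = 1 + z := by
  have := qProd_add_one (z := z) (le_refl 0)
  rw [zero_add, qProd_of_le le_rfl] at this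
  rw [gq_of_nonneg z zero_le_one, this]; simp

theorem gq_neg_one (z : SkewField k q) : gq z (-1) = (1 + ((q⁻¹ : kˣ) : k) • z)⁻¹ := by
  have := qProd_eq_mul (z := z) (a := -1) (b := 0) (by norm_num)
  rw [gq_of_nonpos z (by norm_num), this, neg_add_cancel, qProd_of_le le_rfl]; simp

theorem QRegular.gq_ne_zero {z : SkewField k q} (hz : QRegular z) (n : ℤ) : gq z n ≠ 0 :=
  mul_ne_zero (hz.qProd_ne_zero _ _) (inv_ne_zero (hz.qProd_ne_zero _ _))

/-- One of the two products is always empty, so this form of the definition needs no distinction by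
the sign of `n`. -/
theorem QRegular.gq_mul_qProd {z : SkewField k q} (hz : QRegular z) (n : ℤ) :
    gq z n * qProd z n 0 = qProd z 0 n := by
  rw [gq, mul_assoc, inv_mul_cancel₀ (hz.qProd_ne_zero _ _), mul_one]

theorem gq_commute {z w : SkewField k q} (h : Commute z w) (n : ℤ) : Commute (gq z n) w :=
  (qProd_commute h _ _).mul_left (qProd_commute h _ _).inv_left₀

theorem gq_commute_gq {z w : SkewField k q} (h : Commute z w) (m n : ℤ) :
    Commute (gq z m) (gq w n) :=
  gq_commute (gq_commute h.symm n).symm m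

theorem map_gq (φ : SkewField k q →ₐ[k] SkewField k q) (z : SkewField k q) (n : ℤ) :
    φ (gq z n) = gq (φ z) n := by
  rw [gq, map_mul, map_inv₀, map_qProd, map_qProd, gq]

theorem QRegular.gq_add_one {z : SkewField k q} (hz : QRegular z) (n : ℤ) :
    gq z (n + 1) = gq z n * (1 + ((q ^ n : kˣ) : k) • z) := by
  rcases le_or_gt 0 n with hn | hn
  · rw [gq_of_nonneg z hn, gq_of_nonneg z (by omega), qProd_add_one hn]
  · rw [gq_of_nonpos z hn.le, gq_of_nonpos z (by omega), qProd_eq_mul hn, mul_inv_rev, mul_assoc,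
      inv_mul_cancel₀ (hz n), mul_one]

theorem QRegular.smul {z : SkewField k q} (hz : QRegular z) (n : ℤ) :
    QRegular (((q ^ n : kˣ) : k) • z) := by
  intro t
  rw [smul_smul, ← Units.val_mul, ← zpow_add]
  exact hz _

/-- The cocycle identity behind mutations. It follows from `gq_add_one` by induction in both
directions from `m = 0`. -/
theorem QRegular.gq_add {z : SkewField k q} (hz : QRegular z) (n m : ℤ) :
    gq z (n + m) = gq z n * gq (((q ^ n : kˣ) : k) • z) m := by
  have key : ∀ m, 1 + ((q ^ m : kˣ) : k) • ((q ^ n : kˣ) : k) • z =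
      1 + ((q ^ (n + m) : kˣ) : k) • z := fun m => by
    rw [smul_smul, ← Units.val_mul, ← zpow_add, add_comm m]
  induction m using Int.induction_on with
  | zero => rw [add_zero, gq_zero, mul_one]
  | succ m ih =>
    rw [← add_assoc, hz.gq_add_one, ih, (hz.smul n).gq_add_one, key, mul_assoc]
  | pred m ih =>
    have h1 := hz.gq_add_one (n + (-m - 1))
    have h2 := (hz.smul n).gq_add_one (-m - 1)
    rw [sub_add_cancel, key] at h2
    rw [show n + (-(m : ℤ) - 1) + 1 = n + -m by ring, ih, h2, ← mul_assoc] at h1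
    exact (mul_right_cancel₀ (hz _) h1).symm

/-! ### Mutations -/

/-- `X^a` commutes with `X^c` up to the factor `q^(kap c a)`, so moving it through a function of
`X^c` rescales the argument. -/
theorem mono_mul_gq (a c : Expo) (n : ℤ) : (mono a * gq (mono c) n : SkewField k q) =
    gq (((q ^ kap c a : kˣ) : k) • mono c) n * mono a := by
  have hs : ∀ t u, (mono a * qProd (mono c) t u : SkewField k q) =
      qProd (((q ^ kap c a : kˣ) : k) • mono c) t u * mono a := by
    intro t u
    rw [qProd, qProd]
    generalize List.range _ = L
    induction L with
    | nil => simp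
    | cons j L ih =>
      simp only [List.map_cons, List.prod_cons]
      rw [mul_assoc, ← ih, ← mul_assoc, ← mul_assoc]
      congr 1
      rw [mul_add, add_mul, mul_one, one_mul, mul_smul_comm, mono_mul_comm]
      simp only [smul_mul_assoc]
  have hs' : ∀ t u, (mono a * (qProd (mono c) t u)⁻¹ : SkewField k q) =
      (qProd (((q ^ kap c a : kˣ) : k) • mono c) t u)⁻¹ * mono a := fun t u =>
    SemiconjBy.inv_right₀ (hs t u)
  rw [gq, gq, ← mul_assoc, hs, mul_assoc, hs', mul_assoc]

/-- A cocycle of the kind that defines a mutation: `E` is `gq (mono c)` or its inverse. -/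
structure IsMutation (c : Expo) (E : ℤ → SkewField k q) : Prop where
  zero : E 0 = 1
  add : ∀ a m, E (kap c a + m) * mono a = E (kap c a) * (mono a * E m)

theorem isMutation_gq {c : Expo} (hc : c ≠ 0) :
    IsMutation c (gq (mono c) : ℤ → SkewField k q) where
  zero := gq_zero _
  add a m := by rw [mono_mul_gq, ← mul_assoc, (qRegular_mono hc).gq_add]

theorem isMutation_gq_inv {c : Expo} (hc : c ≠ 0) :
    IsMutation c (fun n => (gq (mono c) n)⁻¹ : ℤ → SkewField k q) where
  zero := by rw [gq_zero, inv_one]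
  add a m := by
    have h1 : (mono a * (gq (mono c) m)⁻¹ : SkewField k q) =
        (gq (((q ^ kap c a : kˣ) : k) • mono c) m)⁻¹ * mono a :=
      SemiconjBy.inv_right₀ (mono_mul_gq a c m)
    rw [h1, ← mul_assoc, (qRegular_mono hc).gq_add, mul_inv_rev]
    congr 1
    -- Inversion reverses the two factors; both are functions of `X^c`, so their order is
    -- immaterial.
    exact (gq_commute_gq (w := ((q ^ kap c a : kˣ) : k) • (mono c : SkewField k q))
      ((Commute.refl _).smul_right _) _ _).inv_left₀.inv_right₀.eq.symm

/-- The cocycle property collects both factors `E` on the left, which is the relation that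
`Torus.lift` requires. -/
theorem IsMutation.mul {c : Expo} {E : ℤ → SkewField k q} (hE : IsMutation c E) (a b : Expo) :
    E (kap c a) * mono a * (E (kap c b) * mono b) =
      ((q ^ form a b : kˣ) : k) • (E (kap c (a + b)) * mono (a + b)) := by
  rw [← mul_smul_comm, ← mono_mul_mono, map_add, ← mul_assoc (E _) (mono a), hE.add]
  simp only [mul_assoc]

/-- The homomorphism `X^a ↦ E(n) X^a` from the torus, `n` being the exponent of `q` in the
commutation relation of `X^a` with `X^c`. -/
def mutLift (c : Expo) (E : ℤ → SkewField k q) (hE : IsMutation c E) :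
    Torus k q →ₐ[k] SkewField k q :=
  Torus.lift (fun a => E (kap c a) * mono a) (by rw [map_zero, hE.zero, mono_zero, one_mul]) hE.mul

theorem mutLift_term (c : Expo) (E : ℤ → SkewField k q) (hE : IsMutation c E) (a : Expo) (r : k) :
    mutLift c E hE (Torus.term a r) = r • (E (kap c a) * mono a) :=
  Torus.lift_term _ _ _ _ _

theorem kap_self (c : Expo) : kap c c = 0 := sub_self _

/-- `X^c` commutes with itself, so a mutation in direction `c` fixes `k[X^c]` pointwise.
Denominators taken from there pass through it unchanged. -/
theorem mutLift_adjoin {c : Expo} {E : ℤ → SkewField k q} (hE : IsMutation c E) {d : Torus k q}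
    (hd : d ∈ Algebra.adjoin k {(Torus.term c 1 : Torus k q)}) : mutLift c E hE d = numA k q d := by
  have hle : Algebra.adjoin k {(Torus.term c 1 : Torus k q)} ≤
      AlgHom.equalizer (mutLift c E hE) (numA k q) := by
    refine Algebra.adjoin_le (Set.singleton_subset_iff.mpr ?_)
    change mutLift c E hE _ = numA k q _
    rw [mutLift_term, kap_self, hE.zero, one_mul, one_smul, mono]
  exact hle hd

theorem qProd_mem_adjoin (c : Expo) (a b : ℤ) :
    ∃ d ∈ Algebra.adjoin k {(Torus.term c 1 : Torus k q)}, numA k q d = qProd (mono c) a b := by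
  have h : qProd (mono c) a b ∈
      (Algebra.adjoin k {(Torus.term c 1 : Torus k q)}).map (numA k q) := by
    rw [qProd]
    refine Subalgebra.list_prod_mem _ fun t ht => ?_
    obtain ⟨j, -, rfl⟩ := List.mem_map.mp ht
    refine add_mem (one_mem _) (Subalgebra.smul_mem _ ?_ _)
    exact ⟨_, Algebra.subset_adjoin rfl, rfl⟩
  exact h

theorem exists_mul_mutation {c : Expo} (hc : c ≠ 0) {E : ℤ → SkewField k q}
    (hE' : (E = fun n => gq (mono c) n) ∨ E = fun n => (gq (mono c) n)⁻¹) (n : ℤ) :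
    ∃ d ∈ Algebra.adjoin k {(Torus.term c 1 : Torus k q)},
      ∃ e ∈ Algebra.adjoin k {(Torus.term c 1 : Torus k q)}, d ≠ 0 ∧
        numA k q d * E n = numA k q e := by
  have hz := qRegular_mono (k := k) (q := q) hc
  obtain ⟨d₁, hd₁, h₁⟩ := qProd_mem_adjoin (k := k) (q := q) c 0 n
  obtain ⟨d₂, hd₂, h₂⟩ := qProd_mem_adjoin (k := k) (q := q) c n 0
  have hne : ∀ {d : Torus k q} {a b}, numA k q d = qProd (mono c) a b → d ≠ 0 := by
    rintro d a b h rfl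
    exact hz.qProd_ne_zero a b (h.symm.trans (map_zero _))
  have hcomm : Commute (gq (mono c : SkewField k q) n) (qProd (mono c) n 0) :=
    gq_commute (qProd_commute (Commute.refl _) _ _).symm _
  rcases hE' with rfl | rfl
  · exact ⟨d₂, hd₂, d₁, hd₁, hne h₂, by rw [h₁, h₂, ← hcomm.eq, hz.gq_mul_qProd]⟩
  · exact ⟨d₁, hd₁, d₂, hd₂, hne h₁, by
      rw [h₁, h₂, mul_inv_eq_iff_eq_mul₀ (hz.gq_ne_zero n), ← hz.gq_mul_qProd, hcomm.eq]⟩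

/-- The mutation by `E'` inverts the one by `E`, but only up to denominators, since values lie
outside the torus. All denominators are kept in `k[X^c]`: there they commute, so sums have common
denominators, and `mutLift_adjoin` applies to them. -/
theorem mutLift_injective {c : Expo} (hc : c ≠ 0) {E E' : ℤ → SkewField k q}
    (hE : IsMutation c E) (hE' : IsMutation c E')
    (h : (E = fun n => gq (mono c) n) ∨ E = fun n => (gq (mono c) n)⁻¹)
    (hinv : ∀ n, E n * E' n = 1) : Function.Injective (mutLift c E hE) := by
  refine injective_of_quasi_left_inverse _ (mutLift c E' hE') fun f => ?_
  suffices hs : ∃ d ∈ Algebra.adjoin k {(Torus.term c 1 : Torus k q)}, ∃ g : Torus k q, d ≠ 0 ∧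
      numA k q g = numA k q d * mutLift c E hE f ∧
      mutLift c E' hE' g = numA k q d * numA k q f by
    obtain ⟨d, -, h⟩ := hs
    exact ⟨d, h⟩
  induction f using Torus.induct with
  | h0 => exact ⟨1, one_mem _, 0, one_ne_zero, by simp, by simp⟩
  | hadd f₁ f₂ h₁ h₂ =>
    obtain ⟨d₁, hd₁, g₁, hn₁, h₁, h₁'⟩ := h₁
    obtain ⟨d₂, hd₂, g₂, hn₂, h₂, h₂'⟩ := h₂
    have hcomm : d₁ * d₂ = d₂ * d₁ := by
      have := Algebra.isMulCommutative_adjoin_singleton k (Torus.term c 1 : Torus k q)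
      exact congrArg Subtype.val (mul_comm' (⟨d₁, hd₁⟩ : Algebra.adjoin k {(Torus.term c 1 : Torus k q)}) ⟨d₂, hd₂⟩)
    refine ⟨d₁ * d₂, mul_mem hd₁ hd₂, d₂ * g₁ + d₁ * g₂, mul_ne_zero hn₁ hn₂, ?_, ?_⟩
    · rw [map_add, map_add, mul_add, map_mul, map_mul, h₁, h₂, ← mul_assoc, ← mul_assoc, ← map_mul,
        ← map_mul, hcomm]
    · rw [map_add, map_add, mul_add, map_mul, map_mul, h₁', h₂', mutLift_adjoin hE' hd₁,
        mutLift_adjoin hE' hd₂, ← mul_assoc, ← mul_assoc, ← map_mul (numA k q) d₁ d₂,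
        ← map_mul (numA k q) d₂ d₁, hcomm]
  | hs a r =>
    obtain ⟨d, hd, e, he, hn, h1⟩ := exists_mul_mutation hc h (kap c a)
    refine ⟨d, hd, e * Torus.term a r, hn, ?_, ?_⟩
    · rw [mutLift_term, map_mul, ← h1, numA_term]
      simp only [mul_smul_comm, mul_assoc]
    · rw [map_mul, mutLift_adjoin hE' he, mutLift_term, ← h1, numA_term]
      simp only [mul_smul_comm]
      rw [mul_assoc (numA k q d), ← mul_assoc (E _), hinv, one_mul]

/-- The endomorphism `X^a ↦ gq (X^c) n X^a` of the skew field. -/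
def mutHom (c : Expo) (hc : c ≠ 0) : SkewField k q →ₐ[k] SkewField k q :=
  SkewField.extend (mutLift c _ (isMutation_gq hc)) <|
    mutLift_injective hc (isMutation_gq hc) (isMutation_gq_inv hc) (Or.inl rfl) fun n =>
      mul_inv_cancel₀ ((qRegular_mono hc).gq_ne_zero n)

/-- The inverse of `mutHom`. -/
def mutHomInv (c : Expo) (hc : c ≠ 0) : SkewField k q →ₐ[k] SkewField k q :=
  SkewField.extend (mutLift c _ (isMutation_gq_inv hc)) <|
    mutLift_injective hc (isMutation_gq_inv hc) (isMutation_gq hc) (Or.inr rfl) fun n =>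
      inv_mul_cancel₀ ((qRegular_mono hc).gq_ne_zero n)

theorem mutHom_mono (c : Expo) (hc : c ≠ 0) (a : Expo) :
    mutHom (k := k) (q := q) c hc (mono a) = gq (mono c) (kap c a) * mono a := by
  change mutHom c hc (numA k q (Torus.term a 1)) = _
  rw [mutHom, SkewField.extend_numA, mutLift_term, one_smul]

theorem mutHomInv_mono (c : Expo) (hc : c ≠ 0) (a : Expo) :
    mutHomInv (k := k) (q := q) c hc (mono a) = (gq (mono c) (kap c a))⁻¹ * mono a := by
  change mutHomInv c hc (numA k q (Torus.term a 1)) = _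
  rw [mutHomInv, SkewField.extend_numA, mutLift_term, one_smul]

theorem mutHom_mono_of_kap_eq_zero {c : Expo} (hc : c ≠ 0) {a : Expo} (h : kap c a = 0) :
    mutHom (k := k) (q := q) c hc (mono a) = mono a := by
  rw [mutHom_mono, h, gq_zero, one_mul]

theorem mutHomInv_mono_of_kap_eq_zero {c : Expo} (hc : c ≠ 0) {a : Expo} (h : kap c a = 0) :
    mutHomInv (k := k) (q := q) c hc (mono a) = mono a := by
  rw [mutHomInv_mono, h, gq_zero, inv_one, one_mul]

/-- The automorphism `X^a ↦ gq (X^c) n X^a` of the skew field. -/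
def mutEquiv (c : Expo) (hc : c ≠ 0) : SkewField k q ≃ₐ[k] SkewField k q :=
  AlgEquiv.ofAlgHom (mutHom c hc) (mutHomInv c hc)
    (SkewField.hom_ext fun a => by
      rw [AlgHom.comp_apply, mutHomInv_mono, map_mul, map_inv₀, map_gq,
        mutHom_mono_of_kap_eq_zero hc (kap_self c), mutHom_mono,
        inv_mul_cancel_left₀ ((qRegular_mono hc).gq_ne_zero _)]
      rfl)
    (SkewField.hom_ext fun a => by
      rw [AlgHom.comp_apply, mutHom_mono, map_mul, map_gq,
        mutHomInv_mono_of_kap_eq_zero hc (kap_self c), mutHomInv_mono,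
        mul_inv_cancel_left₀ ((qRegular_mono hc).gq_ne_zero _)]
      rfl)

/-- A change of monomials followed by a mutation and an inverse mutation. -/
def mutRefl (M : Expo ≃+ Expo) (hM : ∀ a b, form (M a) (M b) = form a b) (c d : Expo)
    (hc : c ≠ 0) (hd : d ≠ 0) : SkewField k q ≃ₐ[k] SkewField k q :=
  ((monoEquiv M hM).trans (mutEquiv d hd).symm).trans (mutEquiv c hc)

theorem mutRefl_mono (M : Expo ≃+ Expo) (hM : ∀ a b, form (M a) (M b) = form a b) {c d : Expo}
    (hc : c ≠ 0) (hd : d ≠ 0) (h : kap c d = 0) (a : Expo) :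
    mutRefl (k := k) (q := q) M hM c d hc hd (mono a) =
      (gq (mono d) (kap d (M a)))⁻¹ * gq (mono c) (kap c (M a)) * mono (M a) := by
  change mutHom c hc (mutHomInv d hd (monoEquiv M hM (mono a))) = _
  rw [monoEquiv_mono, mutHomInv_mono, map_mul, map_inv₀, map_gq, mutHom_mono_of_kap_eq_zero hc h,
    mutHom_mono, mul_assoc]

/-! ### The simple reflections -/

/-- The exponent vector of a variable. -/
abbrev δ (v : QVar) : Expo := Pi.single v 1

/-- The permutation of the variables exchanging `e_a ↔ e_b` and `τ_a ↔ τ_b`. -/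
def varSwap (a b : Fin 11) : QVar → QVar
  | .e i => .e (Equiv.swap a b i)
  | .τ i => .τ (Equiv.swap a b i)
  | v => v

theorem varSwap_involutive (a b : Fin 11) : Function.Involutive (varSwap a b) := by
  intro v; cases v <;> simp [varSwap]

/-- The change of exponents of an exchange. -/
def expoSwap (a b : Fin 11) : Expo ≃+ Expo where
  toFun f v := f (varSwap a b v)
  invFun f v := f (varSwap a b v)
  left_inv f := by ext v; simp [varSwap_involutive a b v]
  right_inv f := by ext v; simp [varSwap_involutive a b v]
  map_add' f g := rfl

theorem form_expoSwap (a b : Fin 11) (f g : Expo) :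
    form (expoSwap a b f) (expoSwap a b g) = form f g := by
  simp only [form, expoSwap, AddEquiv.coe_mk, Equiv.coe_fn_mk, varSwap]
  rw [Equiv.sum_comp (Equiv.swap a b) fun i => f (.τ i) * g (.e i)]

/-- The change of exponents underlying `s_0`. -/
def expoFun₀ (a : Expo) : Expo
  | .e 9 => -a (.e 10) - a (.h 0)
  | .e 10 => -a (.e 9) - a (.h 0)
  | .h 1 => a (.h 1) + a (.h 0) + a (.e 9) + a (.e 10)
  | .τ 9 => -a (.τ 10) - a (.σ 0)
  | .τ 10 => -a (.τ 9) - a (.σ 0)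
  | .σ 1 => a (.σ 1) + a (.σ 0) + a (.τ 9) + a (.τ 10)
  | v => a v

/-- The change of exponents underlying `s_3`. -/
def expoFun₃ (a : Expo) : Expo
  | .e 0 => -a (.e 6) - a (.h 1)
  | .e 6 => -a (.e 0) - a (.h 1)
  | .h 0 => a (.h 0) + a (.h 1) + a (.e 0) + a (.e 6)
  | .τ 0 => -a (.τ 6) - a (.σ 1)
  | .τ 6 => -a (.τ 0) - a (.σ 1)
  | .σ 0 => a (.σ 0) + a (.σ 1) + a (.τ 0) + a (.τ 6)
  | v => a v

theorem Expo.ext_iff' {a b : Expo} : a = b ↔ (∀ i, a (.h i) = b (.h i)) ∧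
    (∀ i, a (.e i) = b (.e i)) ∧ a .x = b .x ∧ a .y = b .y ∧ (∀ i, a (.σ i) = b (.σ i)) ∧
    ∀ i, a (.τ i) = b (.τ i) := by
  constructor
  · rintro rfl; simp
  · rintro ⟨h1, h2, h3, h4, h5, h6⟩
    ext v
    cases v
    exacts [h1 _, h2 _, h3, h4, h5 _, h6 _]

theorem expoFun₀_involutive : Function.Involutive expoFun₀ := by
  intro a
  rw [Expo.ext_iff']
  refine ⟨fun i => ?_, fun i => ?_, rfl, rfl, fun i => ?_, fun i => ?_⟩ <;> fin_cases i <;>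
    simp [expoFun₀] <;> ring

theorem expoFun₃_involutive : Function.Involutive expoFun₃ := by
  intro a
  rw [Expo.ext_iff']
  refine ⟨fun i => ?_, fun i => ?_, rfl, rfl, fun i => ?_, fun i => ?_⟩ <;> fin_cases i <;>
    simp [expoFun₃] <;> ring

theorem expoFun₀_add (a b : Expo) : expoFun₀ (a + b) = expoFun₀ a + expoFun₀ b := by
  rw [Expo.ext_iff']
  refine ⟨fun i => ?_, fun i => ?_, rfl, rfl, fun i => ?_, fun i => ?_⟩ <;> fin_cases i <;>
    simp [expoFun₀] <;> ring

theorem expoFun₃_add (a b : Expo) : expoFun₃ (a + b) = expoFun₃ a + expoFun₃ b := by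
  rw [Expo.ext_iff']
  refine ⟨fun i => ?_, fun i => ?_, rfl, rfl, fun i => ?_, fun i => ?_⟩ <;> fin_cases i <;>
    simp [expoFun₃] <;> ring

/-- The change of exponents underlying `s_0`, as an automorphism. -/
def expoRefl₀ : Expo ≃+ Expo :=
  { expoFun₀_involutive.toPerm with map_add' := expoFun₀_add }

/-- The change of exponents underlying `s_3`, as an automorphism. -/
def expoRefl₃ : Expo ≃+ Expo :=
  { expoFun₃_involutive.toPerm with map_add' := expoFun₃_add }

theorem expoRefl₀_apply (a : Expo) : expoRefl₀ a = expoFun₀ a := rfl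
theorem expoRefl₃_apply (a : Expo) : expoRefl₃ a = expoFun₃ a := rfl

theorem form_expoRefl₀ (a b : Expo) : form (expoRefl₀ a) (expoRefl₀ b) = form a b := by
  simp only [form, expoRefl₀_apply, Fin.sum_univ_succ]
  simp [expoFun₀]
  ring

theorem form_expoRefl₃ (a b : Expo) : form (expoRefl₃ a) (expoRefl₃ b) = form a b := by
  simp only [form, expoRefl₃_apply, Fin.sum_univ_succ]
  simp [expoFun₃]
  ring

/-- Exponents of `e₁₁ y`. -/
def expoZ₀ : Expo := δ (.e 10) + δ .y
/-- Exponents of `(h₂ / e₁₀) y`. -/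
def expoW₀ : Expo := δ (.h 1) - δ (.e 9) + δ .y
/-- Exponents of `(e₇ / h₁) x`. -/
def expoZ₃ : Expo := δ (.e 6) - δ (.h 0) + δ .x
/-- Exponents of `(1 / e₁) x`. -/
def expoW₃ : Expo := -δ (.e 0) + δ .x

theorem expoZ₀_ne_zero : expoZ₀ ≠ 0 := by decide
theorem expoW₀_ne_zero : expoW₀ ≠ 0 := by decide
theorem expoZ₃_ne_zero : expoZ₃ ≠ 0 := by decide
theorem expoW₃_ne_zero : expoW₃ ≠ 0 := by decide

theorem kap_expoZ₀ (a : Expo) : kap expoZ₀ a = -a .x - a (.τ 10) := by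
  simp [kap_apply, form, expoZ₀, Pi.single_apply]; ring

theorem kap_expoW₀ (a : Expo) : kap expoW₀ a = -a .x + a (.σ 0) + a (.τ 9) := by
  simp [kap_apply, form, expoW₀, Pi.single_apply]; ring

theorem kap_expoZ₃ (a : Expo) : kap expoZ₃ a = a .y - a (.σ 1) - a (.τ 6) := by
  simp [kap_apply, form, expoZ₃, Pi.single_apply]; ring

theorem kap_expoW₃ (a : Expo) : kap expoW₃ a = a .y + a (.τ 0) := by
  simp [kap_apply, form, expoW₃, Pi.single_apply]

/-- The permuted indices of the exchanges among the simple reflections. -/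
def swapIdx : Fin 9 → Fin 11 × Fin 11
  | 1 => (7, 8)
  | 2 => (6, 7)
  | 4 => (0, 1)
  | 5 => (1, 2)
  | 6 => (2, 3)
  | 7 => (3, 4)
  | 8 => (4, 5)
  -- A default for the two reflections `0` and `3` that are not exchanges; it is not used in
  -- `sRefl`.
  | _ => (0, 0)

variable (k q) in
/-- The simple reflections. -/
def sRefl (i : Fin 9) : SkewField k q ≃ₐ[k] SkewField k q :=
  if i = 0 then mutRefl expoRefl₀ form_expoRefl₀ expoZ₀ expoW₀ expoZ₀_ne_zero expoW₀_ne_zero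
  else if i = 3 then mutRefl expoRefl₃ form_expoRefl₃ expoZ₃ expoW₃ expoZ₃_ne_zero expoW₃_ne_zero
  else monoEquiv (expoSwap (swapIdx i).1 (swapIdx i).2) (form_expoSwap _ _)

theorem sRefl_zero_mono (a : Expo) : sRefl k q 0 (mono a) =
    (gq (mono expoW₀) (kap expoW₀ (expoFun₀ a)))⁻¹ *
      gq (mono expoZ₀) (kap expoZ₀ (expoFun₀ a)) * mono (expoFun₀ a) := by
  rw [sRefl, if_pos rfl]
  exact mutRefl_mono _ _ _ _ (by rw [kap_expoZ₀]; decide) _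

theorem sRefl_three_mono (a : Expo) : sRefl k q 3 (mono a) =
    (gq (mono expoW₃) (kap expoW₃ (expoFun₃ a)))⁻¹ *
      gq (mono expoZ₃) (kap expoZ₃ (expoFun₃ a)) * mono (expoFun₃ a) := by
  rw [sRefl, if_neg (by decide), if_pos rfl]
  exact mutRefl_mono _ _ _ _ (by rw [kap_expoZ₃]; decide) _

theorem sRefl_mono {i : Fin 9} (h0 : i ≠ 0) (h3 : i ≠ 3) (a : Expo) :
    sRefl k q i (mono a) = mono (expoSwap (swapIdx i).1 (swapIdx i).2 a) := by
  rw [sRefl, if_neg h0, if_neg h3]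
  exact monoEquiv_mono _ _ _

theorem expoSwap_δ (a b : Fin 11) (v : QVar) : expoSwap a b (δ v) = δ (varSwap a b v) := by
  ext w
  change (Pi.single v 1 : Expo) (varSwap a b w) = (Pi.single (varSwap a b v) 1 : Expo) w
  rw [Pi.single_apply, Pi.single_apply]
  congr 1
  rw [eq_iff_iff]
  exact ⟨fun h => by rw [← h, varSwap_involutive], fun h => by rw [h, varSwap_involutive]⟩

theorem sRefl_X {i : Fin 9} (h0 : i ≠ 0) (h3 : i ≠ 3) (v : QVar) :
    sRefl k q i (X v) = exchange (swapIdx i).1 (swapIdx i).2 v := by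
  rw [X_eq_mono, sRefl_mono h0 h3, expoSwap_δ]
  cases v <;> rfl

theorem mono_mul_one_add (a c : Expo) : (mono a * (1 + mono c) : SkewField k q) =
    (1 + ((q ^ kap c a : kˣ) : k) • mono c) * mono a := by
  rw [mul_add, add_mul, mul_one, one_mul, mono_mul_comm]

/-- The shift by `q⁻¹` inside `gq _ (-1)` is undone by moving `X^a` to the left. This explains why
some factors in the prescribed values stand to the right of the variable. -/
theorem gq_neg_one_mul_mono {a c : Expo} (h : kap c a = -1) :
    (gq (mono c) (-1) * mono a : SkewField k q) = mono a * (1 + mono c)⁻¹ := by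
  have h1 := mono_mul_one_add (k := k) (q := q) a c
  rw [h, zpow_neg_one] at h1
  rw [gq_neg_one]
  exact (SemiconjBy.inv_right₀ (a := (mono a : SkewField k q)) h1).eq.symm

theorem gq_neg_one_inv_mul_mono {a c : Expo} (h : kap c a = -1) :
    ((gq (mono c) (-1))⁻¹ * mono a : SkewField k q) = mono a * (1 + mono c) := by
  rw [gq_neg_one, inv_inv, mono_mul_one_add, h, zpow_neg_one]

/-- Reduces a value of `s_0` to an equality of exponent vectors and two integers, which `decide`
settles for concrete exponents. -/
theorem sRefl_zero_of_kap {a b : Expo} (h : expoFun₀ a = b) {m n : ℤ} (hZ : -b .x - b (.τ 10) = m)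
    (hW : -b .x + b (.σ 0) + b (.τ 9) = n) :
    sRefl k q 0 (mono a) = (gq (mono expoW₀) n)⁻¹ * gq (mono expoZ₀) m * mono b := by
  rw [sRefl_zero_mono, h, kap_expoZ₀, kap_expoW₀, hZ, hW]

theorem sRefl_zero_of_kap_eq_zero {a b : Expo} (h : expoFun₀ a = b)
    (hZ : -b .x - b (.τ 10) = 0) (hW : -b .x + b (.σ 0) + b (.τ 9) = 0) :
    sRefl k q 0 (mono a) = mono b := by
  rw [sRefl_zero_of_kap h hZ hW, gq_zero, gq_zero, inv_one, one_mul, one_mul]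

theorem sRefl_three_of_kap {a b : Expo} (h : expoFun₃ a = b) {m n : ℤ}
    (hZ : b .y - b (.σ 1) - b (.τ 6) = m) (hW : b .y + b (.τ 0) = n) :
    sRefl k q 3 (mono a) = (gq (mono expoW₃) n)⁻¹ * gq (mono expoZ₃) m * mono b := by
  rw [sRefl_three_mono, h, kap_expoZ₃, kap_expoW₃, hZ, hW]

theorem sRefl_three_of_kap_eq_zero {a b : Expo} (h : expoFun₃ a = b)
    (hZ : b .y - b (.σ 1) - b (.τ 6) = 0) (hW : b .y + b (.τ 0) = 0) :
    sRefl k q 3 (mono a) = mono b := by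
  rw [sRefl_three_of_kap h hZ hW, gq_zero, gq_zero, inv_one, one_mul, one_mul]

theorem mono_expoZ₀ : (mono expoZ₀ : SkewField k q) = X (.e 10) * X .y := by
  rw [X_eq_mono, X_eq_mono, mono_mul_mono_of_form_eq_zero (by decide)]; rfl

theorem mono_expoW₀ : (mono expoW₀ : SkewField k q) = X (.h 1) / X (.e 9) * X .y := by
  rw [X_eq_mono, X_eq_mono, X_eq_mono, mono_div_mono (by decide),
    mono_mul_mono_of_form_eq_zero (by decide)]; rfl

theorem mono_expoZ₃ : (mono expoZ₃ : SkewField k q) = X (.e 6) / X (.h 0) * X .x := by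
  rw [X_eq_mono, X_eq_mono, X_eq_mono, mono_div_mono (by decide),
    mono_mul_mono_of_form_eq_zero (by decide)]; rfl

theorem mono_expoW₃ : (mono expoW₃ : SkewField k q) = 1 / X (.e 0) * X .x := by
  rw [X_eq_mono, X_eq_mono, one_div, mono_inv (by decide),
    mono_mul_mono_of_form_eq_zero (by decide)]; rfl

theorem X_y_mul_e : (X .y * X (.e 10) : SkewField k q) = mono expoZ₀ := by
  rw [X_eq_mono, X_eq_mono, mono_mul_mono_of_form_eq_zero (by decide), add_comm]; rfl

theorem X_y_mul_h_div_e : (X .y * (X (.h 1) / X (.e 9)) : SkewField k q) = mono expoW₀ := by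
  rw [X_eq_mono, X_eq_mono, X_eq_mono, mono_div_mono (by decide),
    mono_mul_mono_of_form_eq_zero (by decide), add_comm]; rfl

theorem X_x_mul_e_div_h : (X .x * (X (.e 6) / X (.h 0)) : SkewField k q) = mono expoZ₃ := by
  rw [X_eq_mono, X_eq_mono, X_eq_mono, mono_div_mono (by decide),
    mono_mul_mono_of_form_eq_zero (by decide), add_comm]; rfl

theorem X_x_div_e : (X .x / X (.e 0) : SkewField k q) = mono expoW₃ := by
  rw [X_eq_mono, X_eq_mono, mono_div_mono (by decide), sub_eq_add_neg, add_comm]; rfl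

theorem sRefl_zero_X (v : QVar) : sRefl k q 0 (X v) = reflect₀ v := by
  rw [X_eq_mono]
  cases v with
  | x =>
    rw [sRefl_zero_of_kap (b := δ .x) (m := -1) (n := -1) (by decide) (by decide) (by decide)]
    simp only [reflect₀]
    rw [X_y_mul_e, X_y_mul_h_div_e, mul_assoc, gq_neg_one_mul_mono (by rw [kap_expoZ₀]; decide),
      ← mul_assoc, gq_neg_one_inv_mul_mono (by rw [kap_expoW₀]; decide), mul_assoc, div_eq_mul_inv]
    rfl
  | y => exact sRefl_zero_of_kap_eq_zero (by decide) (by decide) (by decide)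
  | h i =>
    fin_cases i
    · simp only [reflect₀, Fin.zero_eta]
      rw [sRefl_zero_of_kap_eq_zero (b := δ (.h 0) + δ (.h 1) - (δ (.e 9) + δ (.e 10)))
        (by decide) (by decide) (by decide)]
      simp only [X_eq_mono]
      rw [mono_mul_mono_of_form_eq_zero (by decide), mono_mul_mono_of_form_eq_zero (by decide),
        mono_div_mono (by decide)]
    · exact sRefl_zero_of_kap_eq_zero (by decide) (by decide) (by decide)
  | σ i =>
    fin_cases i
    · simp only [reflect₀, Fin.zero_eta]
      rw [sRefl_zero_of_kap (b := δ (.σ 0) + δ (.σ 1) - (δ (.τ 9) + δ (.τ 10))) (m := 1) (n := 0)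
        (by decide) (by decide) (by decide), X_y_mul_e, gq_zero, inv_one, one_mul, gq_one]
      simp only [X_eq_mono]
      rw [mono_mul_mono_of_form_eq_zero (by decide), mono_mul_mono_of_form_eq_zero (by decide),
        mono_div_mono (by decide)]
    · exact sRefl_zero_of_kap_eq_zero (by decide) (by decide) (by decide)
  | e i =>
    by_cases h9 : i = 9
    · subst h9
      simp only [reflect₀, X_eq_mono]
      rw [mono_div_mono (by decide)]
      exact sRefl_zero_of_kap_eq_zero (by decide) (by decide) (by decide)
    by_cases h10 : i = 10
    · subst h10
      simp only [reflect₀, X_eq_mono]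
      rw [mono_div_mono (by decide)]
      exact sRefl_zero_of_kap_eq_zero (by decide) (by decide) (by decide)
    · have : reflect₀ (.e i) = (X (.e i) : SkewField k q) := by
        fin_cases i <;> first | rfl | contradiction
      rw [this]
      clear this
      refine sRefl_zero_of_kap_eq_zero ?_ ?_ ?_ <;> revert i <;> decide
  | τ i =>
    by_cases h9 : i = 9
    · subst h9
      rw [sRefl_zero_of_kap (b := δ (.σ 1) - δ (.τ 10)) (m := 1) (n := 0)
        (by decide) (by decide) (by decide), gq_zero, inv_one, one_mul, gq_one]
      simp only [reflect₀]
      rw [X_y_mul_e, X_eq_mono (.σ 1), X_eq_mono (.τ 10), mono_div_mono (by decide)]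
    by_cases h10 : i = 10
    · subst h10
      rw [sRefl_zero_of_kap (b := δ (.σ 1) - δ (.τ 9)) (m := 0) (n := -1)
        (by decide) (by decide) (by decide), gq_zero, mul_one,
        gq_neg_one_inv_mul_mono (by rw [kap_expoW₀]; decide)]
      simp only [reflect₀]
      rw [X_y_mul_h_div_e, X_eq_mono (.σ 1), X_eq_mono (.τ 9), mono_div_mono (by decide)]
    · have : reflect₀ (.τ i) = (X (.τ i) : SkewField k q) := by
        fin_cases i <;> first | rfl | contradiction
      rw [this]
      clear this
      refine sRefl_zero_of_kap_eq_zero ?_ ?_ ?_ <;> revert i <;> decide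

theorem sRefl_three_X (v : QVar) : sRefl k q 3 (X v) = reflect₃ v := by
  rw [X_eq_mono]
  cases v with
  | y =>
    rw [sRefl_three_of_kap (b := δ .y) (m := 1) (n := 1) (by decide) (by decide) (by decide)]
    simp only [reflect₃]
    rw [X_x_mul_e_div_h, X_x_div_e, gq_one, gq_one, div_eq_mul_inv, X_eq_mono .y]
    congr 1
    have h1 : Commute (1 + mono expoZ₃ : SkewField k q) (1 + mono expoW₃) :=
      ((Commute.one_right _).add_right
        ((Commute.one_left _).add_left (mono_commute (by decide))))
    exact h1.inv_right₀.eq.symm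
  | x => exact sRefl_three_of_kap_eq_zero (by decide) (by decide) (by decide)
  | h i =>
    fin_cases i
    · exact sRefl_three_of_kap_eq_zero (by decide) (by decide) (by decide)
    · simp only [reflect₃, Fin.mk_one]
      rw [sRefl_three_of_kap_eq_zero (b := δ (.h 0) + δ (.h 1) - (δ (.e 0) + δ (.e 6)))
        (by decide) (by decide) (by decide)]
      simp only [X_eq_mono]
      rw [mono_mul_mono_of_form_eq_zero (by decide), mono_mul_mono_of_form_eq_zero (by decide),
        mono_div_mono (by decide)]
  | σ i =>
    fin_cases i
    · exact sRefl_three_of_kap_eq_zero (by decide) (by decide) (by decide)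
    · simp only [reflect₃, Fin.mk_one]
      rw [sRefl_three_of_kap (b := δ (.σ 0) + δ (.σ 1) - (δ (.τ 0) + δ (.τ 6))) (m := 0) (n := -1)
        (by decide) (by decide) (by decide), X_x_div_e, gq_zero, mul_one,
        gq_neg_one_inv_mul_mono (by rw [kap_expoW₃]; decide)]
      simp only [X_eq_mono]
      rw [mono_mul_mono_of_form_eq_zero (by decide), mono_mul_mono_of_form_eq_zero (by decide),
        mono_div_mono (by decide)]
  | e i =>
    by_cases h0 : i = 0
    · subst h0
      simp only [reflect₃, X_eq_mono]
      rw [mono_div_mono (by decide)]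
      exact sRefl_three_of_kap_eq_zero (by decide) (by decide) (by decide)
    by_cases h6 : i = 6
    · subst h6
      simp only [reflect₃, X_eq_mono]
      rw [mono_div_mono (by decide)]
      exact sRefl_three_of_kap_eq_zero (by decide) (by decide) (by decide)
    · have : reflect₃ (.e i) = (X (.e i) : SkewField k q) := by
        fin_cases i <;> first | rfl | contradiction
      rw [this]
      clear this
      refine sRefl_three_of_kap_eq_zero ?_ ?_ ?_ <;> revert i <;> decide
  | τ i =>
    by_cases h0 : i = 0
    · subst h0
      rw [sRefl_three_of_kap (b := δ (.σ 0) - δ (.τ 6)) (m := 1) (n := 0)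
        (by decide) (by decide) (by decide), gq_zero, inv_one, one_mul, gq_one]
      simp only [reflect₃]
      rw [X_x_mul_e_div_h, X_eq_mono (.σ 0), X_eq_mono (.τ 6), mono_div_mono (by decide)]
    by_cases h6 : i = 6
    · subst h6
      rw [sRefl_three_of_kap (b := δ (.σ 0) - δ (.τ 0)) (m := 0) (n := -1)
        (by decide) (by decide) (by decide), gq_zero, mul_one,
        gq_neg_one_inv_mul_mono (by rw [kap_expoW₃]; decide)]
      simp only [reflect₃]
      rw [X_x_div_e, X_eq_mono (.σ 0), X_eq_mono (.τ 0), mono_div_mono (by decide)]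
    · have : reflect₃ (.τ i) = (X (.τ i) : SkewField k q) := by
        fin_cases i <;> first | rfl | contradiction
      rw [this]
      clear this
      refine sRefl_three_of_kap_eq_zero ?_ ?_ ?_ <;> revert i <;> decide

theorem isReflections_sRefl : IsReflections (sRefl k q) := by
  intro i v
  fin_cases i
  · exact sRefl_zero_X v
  · exact sRefl_X (by decide) (by decide) v
  · exact sRefl_X (by decide) (by decide) v
  · exact sRefl_three_X v
  · exact sRefl_X (by decide) (by decide) v
  · exact sRefl_X (by decide) (by decide) v
  · exact sRefl_X (by decide) (by decide) v
  · exact sRefl_X (by decide) (by decide) v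
  · exact sRefl_X (by decide) (by decide) v

theorem IsReflections.unique {s t : Fin 9 → (SkewField k q ≃ₐ[k] SkewField k q)}
    (hs : IsReflections s) (ht : IsReflections t) : s = t := by
  funext i
  have h : (s i : SkewField k q →ₐ[k] SkewField k q) = t i :=
    SkewField.hom_ext_X fun v => (hs i v).trans (ht i v).symm
  exact AlgEquiv.ext fun z => congrArg (fun f => f z) h

/-! ### The reflections are involutive and act on `e^λ` -/

/-- `expoFun₀` preserves the form and exchanges the exponents of `Z` and `W`, hence also the
commutation exponents with them. -/
theorem kap_expoZ₀_expoFun₀ (a : Expo) : kap expoZ₀ (expoFun₀ a) = kap expoW₀ a := by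
  rw [kap_expoZ₀, kap_expoW₀]; simp only [expoFun₀]; ring

theorem kap_expoW₀_expoFun₀ (a : Expo) : kap expoW₀ (expoFun₀ a) = kap expoZ₀ a := by
  rw [← kap_expoZ₀_expoFun₀, expoFun₀_involutive]

theorem kap_expoZ₃_expoFun₃ (a : Expo) : kap expoZ₃ (expoFun₃ a) = kap expoW₃ a := by
  rw [kap_expoZ₃, kap_expoW₃]; simp only [expoFun₃]; ring

theorem kap_expoW₃_expoFun₃ (a : Expo) : kap expoW₃ (expoFun₃ a) = kap expoZ₃ a := by
  rw [← kap_expoZ₃_expoFun₃, expoFun₃_involutive]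

theorem sRefl_zero_expoZ₀ : sRefl k q 0 (mono expoZ₀) = mono expoW₀ :=
  sRefl_zero_of_kap_eq_zero (by decide) (by decide) (by decide)

theorem sRefl_zero_expoW₀ : sRefl k q 0 (mono expoW₀) = mono expoZ₀ :=
  sRefl_zero_of_kap_eq_zero (by decide) (by decide) (by decide)

theorem sRefl_three_expoZ₃ : sRefl k q 3 (mono expoZ₃) = mono expoW₃ :=
  sRefl_three_of_kap_eq_zero (by decide) (by decide) (by decide)

theorem sRefl_three_expoW₃ : sRefl k q 3 (mono expoW₃) = mono expoZ₃ :=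
  sRefl_three_of_kap_eq_zero (by decide) (by decide) (by decide)

/-- Applied twice, `s_0` or `s_3` produces the mutation factors in `Z` and `W` once with the roles
exchanged and once without; by the exchange of `kap` they cancel in pairs. -/
theorem sRefl_sRefl (i : Fin 9) (z : SkewField k q) : sRefl k q i (sRefl k q i z) = z := by
  have h : ((sRefl k q i).trans (sRefl k q i) : SkewField k q →ₐ[k] SkewField k q) =
      AlgHom.id k _ := by
    refine SkewField.hom_ext fun a => ?_
    change sRefl k q i (sRefl k q i (mono a)) = mono a
    have hmap : ∀ i (z : SkewField k q) n, sRefl k q i (gq z n) = gq (sRefl k q i z) n :=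
      fun i z n => map_gq (sRefl k q i : SkewField k q →ₐ[k] SkewField k q) z n
    by_cases h0 : i = 0
    · subst h0
      rw [sRefl_zero_mono, map_mul, map_mul, map_inv₀, hmap, hmap, sRefl_zero_expoZ₀,
        sRefl_zero_expoW₀, sRefl_zero_mono, expoFun₀_involutive, kap_expoZ₀_expoFun₀,
        kap_expoW₀_expoFun₀, mul_assoc, mul_assoc (_⁻¹) _ (mono a),
        mul_inv_cancel_left₀ ((qRegular_mono expoW₀_ne_zero).gq_ne_zero _),
        inv_mul_cancel_left₀ ((qRegular_mono expoZ₀_ne_zero).gq_ne_zero _)]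
    by_cases h3 : i = 3
    · subst h3
      rw [sRefl_three_mono, map_mul, map_mul, map_inv₀, hmap, hmap, sRefl_three_expoZ₃,
        sRefl_three_expoW₃, sRefl_three_mono, expoFun₃_involutive, kap_expoZ₃_expoFun₃,
        kap_expoW₃_expoFun₃, mul_assoc, mul_assoc (_⁻¹) _ (mono a),
        mul_inv_cancel_left₀ ((qRegular_mono expoW₃_ne_zero).gq_ne_zero _),
        inv_mul_cancel_left₀ ((qRegular_mono expoZ₃_ne_zero).gq_ne_zero _)]
    · rw [sRefl_mono h0 h3, sRefl_mono h0 h3]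
      congr 1
      exact (expoSwap (swapIdx i).1 (swapIdx i).2).left_inv a
  exact congrArg (fun f => f z) h

/-- The exponents of `e^λ`. -/
def heExp (l : Pic) : Expo
  | .h i => l.d i
  | .e i => -l.m i
  | _ => 0

/-- The exponents of `τ^λ`. -/
def tauExp (l : Pic) : Expo
  | .σ i => l.d i
  | .τ i => -l.m i
  | _ => 0

theorem form_sum_right {ι : Type*} (s : Finset ι) (a : Expo) (g : ι → Expo) :
    form a (∑ i ∈ s, g i) = ∑ i ∈ s, form a (g i) := by
  classical
  induction s using Finset.induction_on with
  | empty => simp [Torus.form_zero_right]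
  | insert i s hi ih => rw [Finset.sum_insert hi, Finset.sum_insert hi, form_add_right, ih]

theorem mono_list_ofFn_prod {n : ℕ} (g : Fin n → Expo) (h : ∀ i j, form (g i) (g j) = 0) :
    (List.ofFn fun i => (mono (g i) : SkewField k q)).prod = mono (∑ i, g i) := by
  induction n with
  | zero => simp [mono_zero]
  | succ n ih =>
    rw [List.ofFn_succ, List.prod_cons, Fin.sum_univ_succ, ih _ fun i j => h _ _,
      mono_mul_mono_of_form_eq_zero]
    rw [form_sum_right]
    exact Finset.sum_eq_zero fun j _ => h _ _

theorem X_zpow (v : QVar) (n : ℤ) : (X v : SkewField k q) ^ n = mono (Pi.single v n) := by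
  rw [X_eq_mono, mono_zpow]
  · congr 1
    rw [← Pi.single_smul]; simp
  · revert v; decide

theorem ePow_eq_mono (l : Pic) : (ePow l : SkewField k q) = mono (heExp l) := by
  simp only [ePow, X_zpow]
  rw [mono_list_ofFn_prod _ (by intro i j; simp [form])]
  rw [mono_mul_mono_of_form_eq_zero (by simp [form]), mono_mul_mono_of_form_eq_zero (by simp [form])]
  congr 1
  rw [Expo.ext_iff']
  refine ⟨fun i => ?_, fun i => ?_, ?_, ?_, fun i => ?_, fun i => ?_⟩
  · fin_cases i <;> simp [heExp, Finset.sum_apply]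
  all_goals simp [heExp, Finset.sum_apply, Pi.single_apply]

theorem tauPow_eq_mono (l : Pic) : (tauPow l : SkewField k q) = mono (tauExp l) := by
  simp only [tauPow, X_zpow]
  rw [mono_list_ofFn_prod _ (by intro i j; simp [form])]
  rw [mono_mul_mono_of_form_eq_zero (by simp [form]),
    mono_mul_mono_of_form_eq_zero (by simp [form])]
  congr 1
  rw [Expo.ext_iff']
  refine ⟨fun i => ?_, fun i => ?_, ?_, ?_, fun i => ?_, fun i => ?_⟩
  rotate_left 4
  · fin_cases i <;> simp [tauExp, Finset.sum_apply]
  all_goals simp [tauExp, Finset.sum_apply, Pi.single_apply]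

theorem expoFun₀_heExp (l : Pic) : expoFun₀ (heExp l) = heExp (sStar 0 l) := by
  rw [Expo.ext_iff']
  refine ⟨fun i => ?_, fun i => ?_, rfl, rfl, fun i => ?_, fun i => ?_⟩ <;> fin_cases i <;>
    simp [expoFun₀, heExp, sStar] <;> ring

theorem expoFun₀_tauExp (l : Pic) : expoFun₀ (tauExp l) = tauExp (sStar 0 l) := by
  rw [Expo.ext_iff']
  refine ⟨fun i => ?_, fun i => ?_, rfl, rfl, fun i => ?_, fun i => ?_⟩ <;> fin_cases i <;>
    simp [expoFun₀, tauExp, sStar] <;> ring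

theorem expoFun₃_heExp (l : Pic) : expoFun₃ (heExp l) = heExp (sStar 3 l) := by
  rw [Expo.ext_iff']
  refine ⟨fun i => ?_, fun i => ?_, rfl, rfl, fun i => ?_, fun i => ?_⟩ <;> fin_cases i <;>
    simp [expoFun₃, heExp, sStar] <;> ring

theorem expoFun₃_tauExp (l : Pic) : expoFun₃ (tauExp l) = tauExp (sStar 3 l) := by
  rw [Expo.ext_iff']
  refine ⟨fun i => ?_, fun i => ?_, rfl, rfl, fun i => ?_, fun i => ?_⟩ <;> fin_cases i <;>
    simp [expoFun₃, tauExp, sStar] <;> ring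

theorem sStar_eq {i : Fin 9} (h0 : i ≠ 0) (h3 : i ≠ 3) (l : Pic) :
    sStar i l = ⟨l.d, l.m ∘ Equiv.swap (swapIdx i).1 (swapIdx i).2⟩ := by
  fin_cases i <;> first | rfl | contradiction

theorem expoSwap_heExp {i : Fin 9} (h0 : i ≠ 0) (h3 : i ≠ 3) (l : Pic) :
    expoSwap (swapIdx i).1 (swapIdx i).2 (heExp l) = heExp (sStar i l) := by
  rw [sStar_eq h0 h3]
  ext v
  cases v <;> rfl

theorem expoSwap_tauExp {i : Fin 9} (h0 : i ≠ 0) (h3 : i ≠ 3) (l : Pic) :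
    expoSwap (swapIdx i).1 (swapIdx i).2 (tauExp l) = tauExp (sStar i l) := by
  rw [sStar_eq h0 h3]
  ext v
  cases v <;> rfl

/-- Monomials in `h`, `e` commute with `Z` and `W`, so the mutations leave them alone and only the
change of exponents acts. -/
theorem sRefl_ePow (i : Fin 9) (l : Pic) : sRefl k q i (ePow l) = ePow (sStar i l) := by
  rw [ePow_eq_mono, ePow_eq_mono]
  by_cases h0 : i = 0
  · subst h0
    exact sRefl_zero_of_kap_eq_zero (expoFun₀_heExp l) rfl rfl
  by_cases h3 : i = 3
  · subst h3
    exact sRefl_three_of_kap_eq_zero (expoFun₃_heExp l) rfl rfl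
  · rw [sRefl_mono h0 h3, expoSwap_heExp h0 h3]

end Torus

open Polynomial

/-! ### Ideals of `q`-multiplicities at a point of a coordinate axis -/

section Local

variable {P K : Type*} [Field P] [DivisionRing K] {ι : P →+* K}

/-- Two elements `u`, `v` with `v u = ρ u v` and coefficients in a commutative field, such that
the monomials in `u`, `v` are linearly independent. -/
structure QPair (ι : P →+* K) where
  u : K
  v : K
  ρ : P
  comm_u : ∀ a, Commute (ι a) u
  comm_v : ∀ a, Commute (ι a) v
  rel : v * u = ι ρ * (u * v)
  ρ_ne_zero : ρ ≠ 0
  indep : ∀ g : P[X][X], g.eval₂ (eval₂RingHom' ι u comm_u) v = 0 → g = 0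

/-- The substitution `X ↦ a X`. -/
def scale (a : P) : P[X] →+* P[X] := compRingHom (C a * Polynomial.X)

theorem scale_coeff (a : P) (p : P[X]) (n : ℕ) : (scale a p).coeff n = p.coeff n * a ^ n :=
  comp_C_mul_X_coeff

theorem scale_C (a b : P) : scale a (C b) = C b := C_comp

theorem scale_X (a : P) : scale a Polynomial.X = C a * Polynomial.X := X_comp

namespace QPair

variable (S : QPair ι)

/-- Evaluation of polynomials at `u`. -/
def evu : P[X] →+* K := eval₂RingHom' ι S.u S.comm_u

/-- Evaluation of polynomials at `v`. -/
def evv : P[X] →+* K := eval₂RingHom' ι S.v S.comm_v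

/-- Evaluation of polynomials in two variables at `u`, `v`, with `u` to the left. -/
def ev (g : P[X][X]) : K := g.eval₂ S.evu S.v

theorem evu_C (a : P) : S.evu (C a) = ι a := eval₂_C _ _
theorem evu_X : S.evu Polynomial.X = S.u := eval₂_X _ _
theorem evv_C (a : P) : S.evv (C a) = ι a := eval₂_C _ _
theorem evv_X : S.evv Polynomial.X = S.v := eval₂_X _ _

theorem ev_add (g h : P[X][X]) : S.ev (g + h) = S.ev g + S.ev h := eval₂_add _ _

theorem ev_monomial (n : ℕ) (p : P[X]) : S.ev (monomial n p) = S.evu p * S.v ^ n :=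
  eval₂_monomial _ _

theorem ev_zero : S.ev 0 = 0 := eval₂_zero _ _

theorem ev_neg (g : P[X][X]) : S.ev (-g) = -S.ev g := by
  rw [eq_neg_iff_add_eq_zero, ← ev_add, neg_add_cancel, ev_zero]

theorem ev_injective : Function.Injective S.ev := by
  intro g h hgh
  rw [← sub_eq_zero]
  refine S.indep _ ?_
  change S.ev (g - h) = 0
  rw [sub_eq_add_neg, ev_add, ev_neg, hgh, add_neg_cancel]

theorem evv_commute (p r : P[X]) : Commute (S.evv p) (S.evv r) := by
  rw [Commute, SemiconjBy, ← map_mul, ← map_mul, mul_comm]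

theorem evv_commute_v (p : P[X]) : Commute (S.evv p) S.v := by
  rw [← evv_X]; exact S.evv_commute _ _

theorem evv_mul_u (p : P[X]) : S.evv p * S.u = S.u * S.evv (scale S.ρ p) := by
  induction p using Polynomial.induction_on' with
  | add p r hp hr => simp only [map_add, add_mul, mul_add, hp, hr]
  | monomial n a =>
    induction n with
    | zero => rw [monomial_zero_left, scale_C, evv_C, (S.comm_u a).eq]
    | succ n ih =>
      rw [← monomial_mul_X, map_mul, map_mul, map_mul, scale_X, map_mul, evv_X, mul_assoc, S.rel,
        ← mul_assoc, ← mul_assoc, (evv_C S S.ρ).symm, mul_assoc _ (S.evv _) S.u, (S.evv_C _),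
        (S.comm_u S.ρ).eq, ← mul_assoc, ih]
      simp only [mul_assoc]

theorem v_mul_evu (p : P[X]) : S.v * S.evu p = S.evu (scale S.ρ p) * S.v := by
  induction p using Polynomial.induction_on' with
  | add p r hp hr => simp only [map_add, add_mul, mul_add, hp, hr]
  | monomial n a =>
    induction n with
    | zero => rw [monomial_zero_left, scale_C, evu_C, (S.comm_v a).eq]
    | succ n ih =>
      rw [← monomial_mul_X, map_mul, map_mul, map_mul, scale_X, map_mul, evu_X, ← mul_assoc, ih,
        mul_assoc, S.rel, evu_C]
      simp only [mul_assoc]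

theorem scale_scale (a b : P) (p : P[X]) : scale a (scale b p) = scale (a * b) p := by
  ext n
  simp only [scale_coeff]; ring

theorem v_pow_mul_evu (i : ℕ) (p : P[X]) :
    S.v ^ i * S.evu p = S.evu (scale (S.ρ ^ i) p) * S.v ^ i := by
  induction i with
  | zero =>
    have : scale (S.ρ ^ 0) p = p := by ext n; simp [scale_coeff]
    rw [this]; simp
  | succ i ih =>
    rw [pow_succ', mul_assoc, ih, ← mul_assoc, v_mul_evu, scale_scale, ← pow_succ', mul_assoc]

theorem evv_eq_ev (p : P[X]) : S.evv p = S.ev (p.map C) := by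
  induction p using Polynomial.induction_on' with
  | add p r hp hr => rw [map_add, Polynomial.map_add, ev_add, hp, hr]
  | monomial n a =>
    rw [Polynomial.map_monomial, ev_monomial, ← C_mul_X_pow_eq_monomial, map_mul, map_pow, evv_C,
      evv_X, evu_C]

theorem evv_ne_zero {p : P[X]} (hp : p ≠ 0) : S.evv p ≠ 0 := by
  rw [evv_eq_ev, ← S.ev_zero]
  exact fun h => hp ((Polynomial.map_eq_zero_iff C_injective).mp (S.ev_injective h))

theorem evv_ne_zero_of_coeff {p : P[X]} (hp : p.coeff 0 ≠ 0) : S.evv p ≠ 0 :=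
  S.evv_ne_zero fun h => hp (by rw [h, coeff_zero])

theorem ev_mul_map_C (g : P[X][X]) (p : P[X]) : S.ev (g * p.map C) = S.ev g * S.evv p := by
  induction p using Polynomial.induction_on' with
  | add p r hp hr => rw [Polynomial.map_add, mul_add, ev_add, hp, hr, map_add, mul_add]
  | monomial n a =>
    induction g using Polynomial.induction_on' with
    | add g h hg hh => rw [add_mul, ev_add, hg, hh, ev_add, add_mul]
    | monomial m b =>
      rw [Polynomial.map_monomial, monomial_mul_monomial, ev_monomial, ev_monomial,
        ← C_mul_X_pow_eq_monomial, map_mul, map_mul, map_pow, evv_C, evv_X, evu_C, pow_add,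
        mul_assoc, mul_assoc, ← mul_assoc (ι a), ((S.comm_v a).pow_right m).eq, mul_assoc]

/-- The elements `∑ f_i(u) v^i` with `D i ∣ f_i`. -/
def ideal (D : ℕ → P[X]) : AddSubgroup K where
  carrier := {F | ∃ g : P[X][X], (∀ i, D i ∣ g.coeff i) ∧ S.ev g = F}
  zero_mem' := ⟨0, fun i => by simp, S.ev_zero⟩
  add_mem' := by
    rintro _ _ ⟨g, hg, rfl⟩ ⟨h, hh, rfl⟩
    exact ⟨g + h, fun i => by rw [coeff_add]; exact dvd_add (hg i) (hh i), S.ev_add g h⟩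
  neg_mem' := by
    rintro _ ⟨g, hg, rfl⟩
    exact ⟨-g, fun i => by rw [coeff_neg]; exact (dvd_neg).mpr (hg i), S.ev_neg g⟩

variable {S} {D D' : ℕ → P[X]}

theorem term_mem_ideal {p : P[X]} {i : ℕ} (h : D i ∣ p) : S.evu p * S.v ^ i ∈ S.ideal D := by
  refine ⟨monomial i p, fun j => ?_, S.ev_monomial i p⟩
  rw [coeff_monomial]
  split_ifs with hij
  · rwa [← hij]
  · exact dvd_zero _

theorem ideal_induction {p : (F : K) → F ∈ S.ideal D → Prop} (h0 : p 0 (zero_mem _))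
    (hadd : ∀ F G hF hG, p F hF → p G hG → p (F + G) (add_mem hF hG))
    (ht : ∀ i r (h : D i ∣ r), p (S.evu r * S.v ^ i) (term_mem_ideal h)) {F : K}
    (hF : F ∈ S.ideal D) : p F hF := by
  suffices h : ∃ h, p F h from h.2
  obtain ⟨g, hg, rfl⟩ := hF
  rw [ev, eval₂_eq_sum, Polynomial.sum_def]
  exact Finset.sum_induction _ (fun F => ∃ h, p F h)
    (fun F G ⟨hF, hF'⟩ ⟨hG, hG'⟩ => ⟨_, hadd F G hF hG hF' hG'⟩) ⟨_, h0⟩ fun i _ => ⟨_, ht i _ (hg i)⟩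

/-- Multiplication by `v` on the right raises the order in `v`, where the required divisor is
weaker. -/
theorem mul_evv_mem_ideal (hD : ∀ i, D (i + 1) ∣ D i) {F : K} (hF : F ∈ S.ideal D) (p : P[X]) :
    F * S.evv p ∈ S.ideal D := by
  induction hF using ideal_induction with
  | h0 => rw [zero_mul]; exact zero_mem _
  | hadd F G _ _ hF hG => rw [add_mul]; exact add_mem hF hG
  | ht i r hr =>
    induction p using Polynomial.induction_on' with
    | add p t hp ht => rw [map_add, mul_add]; exact add_mem hp ht
    | monomial n a =>
      have h1 : S.evu r * S.v ^ i * S.evv (monomial n a) = S.evu (r * C a) * S.v ^ (i + n) := by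
        rw [← C_mul_X_pow_eq_monomial, map_mul, map_mul, map_pow, evv_C, evv_X, evu_C, pow_add,
          mul_assoc, mul_assoc, ← mul_assoc (S.v ^ i), ← ((S.comm_v a).pow_right i).eq]
        simp only [mul_assoc]
      rw [h1]
      refine term_mem_ideal (Dvd.dvd.mul_right ?_ _)
      clear h1
      induction n with
      | zero => exact hr
      | succ n ih => exact (hD (i + n)).trans ih

theorem mul_u_mem_ideal {F : K} (hF : F ∈ S.ideal D) : F * S.u ∈ S.ideal D := by
  induction hF using ideal_induction with
  | h0 => rw [zero_mul]; exact zero_mem _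
  | hadd F G _ _ hF hG => rw [add_mul]; exact add_mem hF hG
  | ht i r hr =>
    rw [← evu_X, mul_assoc, v_pow_mul_evu, ← mul_assoc, ← map_mul]
    exact term_mem_ideal (hr.mul_right _)

theorem evv_eq_divX (p : P[X]) : S.evv p = ι (p.coeff 0) + S.v * S.evv p.divX := by
  conv_lhs => rw [← divX_mul_X_add p]
  rw [map_add, map_mul, evv_C, evv_X, (S.evv_commute_v _).eq, add_comm]

/-- The basic way to gain one unit of multiplicity. Modulo `v`, the new factor is `α(0) (1 + b u)`
by the relation `hb`. Moving it to the left of `v^i` replaces `b` by `ρ^i b`, which is the linear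
factor in `h1`. All remaining terms have order at least `i + 1` in `v` and are covered by `h2`. -/
theorem mul_linear_mem_ideal (hD' : ∀ i, D' (i + 1) ∣ D' i) {b b' : P} {α β : P[X]}
    (h1 : ∀ i, D' i ∣ D i * (1 + C (S.ρ ^ i * b) * Polynomial.X)) (h2 : ∀ i, D' (i + 1) ∣ D i)
    (hb : b' * β.coeff 0 = b * α.coeff 0) {F : K} (hF : F ∈ S.ideal D) :
    F * (S.evv α + ι b' * S.u * S.evv β) ∈ S.ideal D' := by
  induction hF using ideal_induction with
  | h0 => rw [zero_mul]; exact zero_mem _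
  | hadd F G _ _ hF hG => rw [add_mul]; exact add_mem hF hG
  | ht i r hr =>
    have e1 : S.v ^ i * S.u = S.evu (C (S.ρ ^ i) * Polynomial.X) * S.v ^ i := by
      rw [← scale_X, ← v_pow_mul_evu, evu_X]
    have hsplit : S.evu r * S.v ^ i * (S.evv α + ι b' * S.u * S.evv β) =
        S.evu (r * (1 + C (S.ρ ^ i * b) * Polynomial.X) * C (α.coeff 0)) * S.v ^ i +
          S.evu r * S.v ^ (i + 1) * S.evv α.divX +
          S.evu (r * (C b' * (C (S.ρ ^ i) * Polynomial.X))) * S.v ^ (i + 1) * S.evv β.divX := by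
      have hp : r * (1 + C (S.ρ ^ i * b) * Polynomial.X) * C (α.coeff 0) =
          r * C (α.coeff 0) + r * (C b' * (C (S.ρ ^ i) * Polynomial.X)) * C (β.coeff 0) := by
        have hC : C b' * C (β.coeff 0) = C b * C (α.coeff 0) := by rw [← C_mul, ← C_mul, hb]
        rw [C_mul]
        linear_combination (-(r * C (S.ρ ^ i) * Polynomial.X)) * hC
      have c1 : ∀ a : P, S.v ^ i * ι a = ι a * S.v ^ i := fun a =>
        ((S.comm_v a).pow_right i).eq.symm
      have e2 : S.evu r * S.v ^ i * (ι b' * S.u) = S.evu (r * (C b' * (C (S.ρ ^ i) * Polynomial.X))) * S.v ^ i := by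
        rw [map_mul, map_mul, evu_C, mul_assoc, ← mul_assoc (S.v ^ i), c1, mul_assoc (ι b'), e1]
        simp only [mul_assoc]
      rw [hp, map_add, map_mul, map_mul _ (r * _), evu_C, evu_C, mul_add, ← mul_assoc, e2,
        evv_eq_divX α, evv_eq_divX β, mul_add, mul_add, add_mul, pow_succ]
      have c2 : ∀ a : P, ∀ z : K, z * S.v ^ i * ι a = z * ι a * S.v ^ i := fun a z => by
        rw [mul_assoc, c1, mul_assoc]
      rw [c2, c2]
      simp only [mul_assoc]
      abel
    rw [hsplit]
    refine add_mem (add_mem ?_ ?_) ?_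
    · exact term_mem_ideal (((h1 i).trans (mul_dvd_mul_right hr _)).mul_right _)
    · exact mul_evv_mem_ideal hD' (term_mem_ideal ((h2 i).trans hr)) _
    · exact mul_evv_mem_ideal hD' (term_mem_ideal (((h2 i).trans hr).mul_right _)) _

variable (S) in
/-- The elements that lie in `ideal D` up to denominators in `v` that are invertible at `0`. -/
def hat (D : ℕ → P[X]) : Set K := {F | ∃ p : P[X], p.coeff 0 ≠ 0 ∧ F * S.evv p ∈ S.ideal D}

theorem mem_hat_of_mem {F : K} (hF : F ∈ S.ideal D) : F ∈ S.hat D :=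
  ⟨1, by simp, by rwa [map_one, mul_one]⟩

theorem hat_add (hD : ∀ i, D (i + 1) ∣ D i) {F G : K} (hF : F ∈ S.hat D) (hG : G ∈ S.hat D) :
    F + G ∈ S.hat D := by
  obtain ⟨p, hp, hF⟩ := hF
  obtain ⟨r, hr, hG⟩ := hG
  refine ⟨p * r, by rw [mul_coeff_zero]; exact mul_ne_zero hp hr, ?_⟩
  rw [add_mul]
  refine add_mem ?_ ?_
  · rw [map_mul, ← mul_assoc]; exact mul_evv_mem_ideal hD hF r
  · rw [mul_comm p, map_mul, ← mul_assoc]; exact mul_evv_mem_ideal hD hG p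

theorem hat_mul_evv (hD : ∀ i, D (i + 1) ∣ D i) {F : K} (hF : F ∈ S.hat D) (r : P[X]) :
    F * S.evv r ∈ S.hat D := by
  obtain ⟨p, hp, hF⟩ := hF
  refine ⟨p, hp, ?_⟩
  rw [mul_assoc, (S.evv_commute _ _).eq, ← mul_assoc]
  exact mul_evv_mem_ideal hD hF r

theorem hat_mul_evv_inv {F : K} (hF : F ∈ S.hat D) {r : P[X]} (hr : r.coeff 0 ≠ 0) :
    F * (S.evv r)⁻¹ ∈ S.hat D := by
  obtain ⟨p, hp, hF⟩ := hF
  refine ⟨r * p, by rw [mul_coeff_zero]; exact mul_ne_zero hr hp, ?_⟩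
  rwa [map_mul, mul_assoc, inv_mul_cancel_left₀ (S.evv_ne_zero_of_coeff hr)]

/-- A denominator in `v` passes through `u` as its rescaling by `ρ`, which has the same constant
term. -/
theorem hat_mul_u {F : K} (hF : F ∈ S.hat D) : F * S.u ∈ S.hat D := by
  obtain ⟨p, hp, hF⟩ := hF
  refine ⟨scale S.ρ p, by rwa [scale_coeff, pow_zero, mul_one], ?_⟩
  rw [mul_assoc, ← evv_mul_u, ← mul_assoc]
  exact mul_u_mem_ideal hF

/-- If `p` clears the denominator of `F`, then `p` times its rescaling `p'` clears that of the
product: pulling `p` to the left turns the factor into `α p' + b' u β p`. As `p` and `p'` have equal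
constant terms, the hypothesis `hb` survives and `mul_linear_mem_ideal` applies. -/
theorem hat_mul_linear (hD' : ∀ i, D' (i + 1) ∣ D' i) {b b' : P} {α β : P[X]}
    (h1 : ∀ i, D' i ∣ D i * (1 + C (S.ρ ^ i * b) * Polynomial.X)) (h2 : ∀ i, D' (i + 1) ∣ D i)
    (hb : b' * β.coeff 0 = b * α.coeff 0) {F : K} (hF : F ∈ S.hat D) :
    F * (S.evv α + ι b' * S.u * S.evv β) ∈ S.hat D' := by
  obtain ⟨p, hp, hF⟩ := hF
  have hc : (scale S.ρ p).coeff 0 = p.coeff 0 := by rw [scale_coeff, pow_zero, mul_one]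
  refine ⟨p * scale S.ρ p, by rw [mul_coeff_zero, hc]; exact mul_ne_zero hp hp, ?_⟩
  have key : F * (S.evv α + ι b' * S.u * S.evv β) * S.evv (p * scale S.ρ p) =
      F * S.evv p * (S.evv (α * scale S.ρ p) + ι b' * S.u * S.evv (β * p)) := by
    have e1 : S.evv α * S.evv (p * scale S.ρ p) = S.evv p * S.evv (α * scale S.ρ p) := by
      rw [← map_mul, ← map_mul]; congr 1; ring
    have e2 : ι b' * S.u * S.evv β * S.evv (p * scale S.ρ p) =
        S.evv p * (ι b' * S.u * S.evv (β * p)) := by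
      rw [mul_assoc _ (S.evv β), ← map_mul,
        show β * (p * scale S.ρ p) = scale S.ρ p * (β * p) by ring, map_mul, ← mul_assoc,
        mul_assoc (ι b'), ← evv_mul_u, ← mul_assoc, ← mul_assoc, ← mul_assoc, ← S.evv_C b',
        (S.evv_commute _ _).eq]
    rw [mul_assoc, add_mul, e1, e2, ← mul_add, mul_assoc F]
  rw [key]
  refine mul_linear_mem_ideal hD' h1 h2 ?_ hF
  rw [mul_coeff_zero, mul_coeff_zero, hc, ← mul_assoc, hb, mul_assoc]

/-- Multiplication by `p(v)` is triangular: the `n`-th coefficient of the product is `p(0)` times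
that of `g` plus multiples of earlier coefficients. By induction the earlier ones are divisible by
even stronger divisors, and `p(0)` is a unit. -/
theorem dvd_coeff_of_mem_hat (hD : ∀ i, D (i + 1) ∣ D i) {g : P[X][X]} (hg : S.ev g ∈ S.hat D)
    (n : ℕ) : D n ∣ g.coeff n := by
  obtain ⟨p, hp, h, hh, he⟩ := hg
  rw [← ev_mul_map_C] at he
  have he := S.ev_injective he
  have hD' : ∀ {i j}, i ≤ j → D j ∣ D i := fun {i j} hij => by
    induction hij with
    | refl => exact dvd_rfl
    | step _ ih => exact (hD _).trans ih
  induction n using Nat.strong_induction_on with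
  | _ n ih =>
    have h1 := hh n
    rw [he, coeff_mul, ← Finset.add_sum_erase _ _
      (Finset.HasAntidiagonal.mem_antidiagonal.mpr (add_zero n) : (n, 0) ∈ Finset.HasAntidiagonal.antidiagonal n)] at h1
    have h2 : D n ∣ ∑ x ∈ (Finset.HasAntidiagonal.antidiagonal n).erase (n, 0),
        g.coeff x.1 * (p.map C).coeff x.2 := by
      refine Finset.dvd_sum fun x hx => ?_
      obtain ⟨hx1, hx2⟩ := Finset.mem_erase.mp hx
      have hx3 := Finset.HasAntidiagonal.mem_antidiagonal.mp hx2
      have hlt : x.1 < n := by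
        rcases Nat.lt_or_ge x.1 n with h | h
        · exact h
        · exact absurd (Prod.ext (by simp; omega) (by simp; omega)) hx1
      exact ((hD' hlt.le).trans (ih _ hlt)).mul_right _
    have h3 := (dvd_add_left h2).mp h1
    rw [coeff_map] at h3
    exact ((isUnit_C.mpr (isUnit_iff_ne_zero.mpr hp)).dvd_mul_right).mp h3

end QPair

/-! ### q-multiplicities and their behaviour under substitutions. -/

/-- The product of the factors `1 + ρ^{-t} c X` for `1 ≤ t ≤ n`. -/
def linProd (ρ c : P) (n : ℕ) : P[X] := ∏ t ∈ Finset.range n, (1 + C ((ρ ^ (t + 1))⁻¹ * c) * Polynomial.X)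

theorem linProd_succ (ρ c : P) (n : ℕ) :
    linProd ρ c (n + 1) = linProd ρ c n * (1 + C ((ρ ^ (n + 1))⁻¹ * c) * Polynomial.X) :=
  Finset.prod_range_succ _ _

theorem linProd_dvd (ρ c : P) {m n : ℕ} (h : m ≤ n) : linProd ρ c m ∣ linProd ρ c n :=
  Finset.prod_dvd_prod_of_subset _ _ _ (Finset.range_subset_range.mpr h)

/-- The divisors that express `q`-multiplicities `m` at points with parameters `c`. -/
def fam (ρ : P) (L : List (P × ℕ)) (i : ℕ) : P[X] :=
  (L.map fun x => linProd ρ x.1 (x.2 - i)).prod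

theorem fam_cons (ρ : P) (x : P × ℕ) (L : List (P × ℕ)) (i : ℕ) :
    fam ρ (x :: L) i = linProd ρ x.1 (x.2 - i) * fam ρ L i := by
  rw [fam, List.map_cons, List.prod_cons, fam]

theorem fam_antitone (ρ : P) (L : List (P × ℕ)) (i : ℕ) : fam ρ L (i + 1) ∣ fam ρ L i := by
  induction L with
  | nil => exact dvd_rfl
  | cons x L ih =>
    rw [fam_cons, fam_cons]
    exact mul_dvd_mul (linProd_dvd _ _ (by omega)) ih

/-- Dropping `i` powers of `v` lowers every multiplicity by `i`; truncated subtraction makes this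
exact also when a multiplicity is exhausted. -/
theorem fam_add (ρ : P) (L : List (P × ℕ)) (i j : ℕ) :
    fam ρ L (i + j) = fam ρ (L.map fun x => (x.1, x.2 - i)) j := by
  rw [fam, fam, List.map_map]
  congr 1
  refine List.map_congr_left fun x _ => ?_
  simp only [Function.comp_apply, Nat.sub_sub]

namespace QPair

variable {S : QPair ι} {s : K →+* K} {φ : P →+* P} {α β : P[X]}

/-- The substitution `u ↦ u β(v) / α(v)`, regular at `v = 0`. -/
structure IsSubst (S : QPair ι) (s : K →+* K) (φ : P →+* P) (α β : P[X]) : Prop where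
  map_ι : ∀ a, s (ι a) = ι (φ a)
  map_ρ : φ S.ρ = S.ρ
  map_v : s S.v = S.v
  map_u : s S.u = S.u * S.evv β * (S.evv α)⁻¹
  coeff_ne_zero : α.coeff 0 ≠ 0

/-- The product is built up one linear factor at a time, over the points and over their
multiplicities. The image of a factor `1 + b u` is `(α + φ(b) u β) α⁻¹`, so `hat_mul_linear` adds it
and the denominator is harmless. The hypothesis `hL` says that the substitution at `v = 0` is
compensated by the motion of the parameter. -/
theorem IsSubst.linear_mem_hat (hs : S.IsSubst s φ α β) (L : List (P × ℕ))
    (hL : ∀ x ∈ L, φ x.1 * β.coeff 0 = x.1 * α.coeff 0) :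
    s (S.evu (fam S.ρ L 0)) ∈ S.hat (fam S.ρ L) := by
  induction L with
  | nil =>
    refine mem_hat_of_mem ?_
    have := term_mem_ideal (S := S) (D := fam S.ρ []) (i := 0) (p := 1) dvd_rfl
    rw [map_one, pow_zero, mul_one] at this
    rwa [show fam S.ρ [] 0 = 1 from rfl, map_one, map_one]
  | cons x L ih =>
    obtain ⟨c, m⟩ := x
    have hc := hL (c, m) List.mem_cons_self
    have ih := ih fun x hx => hL x (List.mem_cons_of_mem _ hx)
    clear hL
    induction m with
    | zero =>
      have : fam S.ρ ((c, 0) :: L) = fam S.ρ L := by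
        funext i; rw [fam_cons, Nat.zero_sub]; simp [linProd]
      rwa [this]
    | succ m ihm =>
      have ihm := ihm hc
      set b := (S.ρ ^ (m + 1))⁻¹ * c with hb
      have h0 : fam S.ρ ((c, m + 1) :: L) 0 = fam S.ρ ((c, m) :: L) 0 * (1 + C b * Polynomial.X) := by
        rw [fam_cons, fam_cons, Nat.sub_zero, Nat.sub_zero, linProd_succ]; ring
      have h1 : s (S.evu (1 + C b * Polynomial.X)) =
          (S.evv α + ι (φ b) * S.u * S.evv β) * (S.evv α)⁻¹ := by
        rw [map_add, map_add, map_one, map_one, map_mul, map_mul, evu_C, evu_X, hs.map_ι, hs.map_u,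
          add_mul, mul_inv_cancel₀ (S.evv_ne_zero_of_coeff hs.coeff_ne_zero)]
        simp only [mul_assoc]
      rw [h0, map_mul, map_mul, h1, ← mul_assoc]
      refine hat_mul_evv_inv (hat_mul_linear (fam_antitone _ _) (b := b) ?_ ?_ ?_ ihm)
        hs.coeff_ne_zero
      · intro i
        rw [fam_cons, fam_cons]
        rcases Nat.lt_or_ge m i with h | h
        · rw [show m + 1 - i = m - i by omega]
          exact dvd_mul_right _ _
        · rw [show m + 1 - i = m - i + 1 by omega, linProd_succ]
          -- At order `i` the twist by `ρ^i` turns the last factor of the string of length `m + 1`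
          -- into the last factor of the string of length `m + 1 - i`.
          have : S.ρ ^ i * b = (S.ρ ^ (m - i + 1))⁻¹ * c := by
            rw [hb, show m + 1 = i + (m - i + 1) by omega, pow_add, mul_inv, ← mul_assoc,
              mul_inv_cancel_left₀ (pow_ne_zero _ S.ρ_ne_zero)]
          rw [this]
          exact dvd_of_eq (by ring)
      · intro i
        rw [fam_cons, fam_cons]
        exact mul_dvd_mul (by rw [show m + 1 - (i + 1) = m - i by omega]) (fam_antitone _ _ _)
      · rw [hb, map_mul, map_inv₀, map_pow, hs.map_ρ, mul_assoc, hc, mul_assoc]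

/-- The image of `u` is `u` times a fraction in `v` regular at `0`, and `hat` is stable under both
kinds of factors. -/
theorem IsSubst.hat_mul (hs : S.IsSubst s φ α β) {D : ℕ → P[X]} (hD : ∀ i, D (i + 1) ∣ D i)
    {F : K} (hF : F ∈ S.hat D) (r : P[X]) : F * s (S.evu r) ∈ S.hat D := by
  induction r using Polynomial.induction_on' with
  | add p r hp hr => rw [map_add, map_add, mul_add]; exact hat_add hD hp hr
  | monomial n a =>
    induction n with
    | zero =>
      rw [monomial_zero_left, evu_C, hs.map_ι, ← S.evv_C]
      exact hat_mul_evv hD hF _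
    | succ n ih =>
      rw [← monomial_mul_X, map_mul, map_mul, evu_X, hs.map_u, ← mul_assoc, ← mul_assoc,
        ← mul_assoc]
      exact hat_mul_evv_inv (hat_mul_evv hD (hat_mul_u ih) _) hs.coeff_ne_zero

/-- Each term is `D_i(u) t(u) v^i`. Its divisor `D_i` is the order-zero divisor of the family with
all multiplicities lowered by `i`, to which `linear_mem_hat` applies; the power `v^i`, fixed by the
substitution, then shifts the family back. -/
theorem IsSubst.map_mem_hat (hs : S.IsSubst s φ α β) (L : List (P × ℕ))
    (hL : ∀ x ∈ L, φ x.1 * β.coeff 0 = x.1 * α.coeff 0) {F : K}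
    (hF : F ∈ S.ideal (fam S.ρ L)) : s F ∈ S.hat (fam S.ρ L) := by
  induction hF using ideal_induction with
  | h0 => rw [map_zero]; exact mem_hat_of_mem (zero_mem _)
  | hadd F G _ _ hF hG => rw [map_add]; exact hat_add (fam_antitone _ _) hF hG
  | ht i r hr =>
    obtain ⟨t, rfl⟩ := hr
    rw [map_mul, map_mul, map_mul, map_pow, hs.map_v, ← add_zero i, fam_add, add_zero]
    have h1 := hs.linear_mem_hat (L.map fun x => (x.1, x.2 - i)) fun x hx => by
      obtain ⟨y, hy, rfl⟩ := List.mem_map.mp hx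
      exact hL y hy
    obtain ⟨p, hp, h2⟩ := hs.hat_mul (fam_antitone _ _) h1 t
    refine ⟨p, hp, ?_⟩
    rw [mul_assoc, ← ((S.evv_commute_v p).pow_right i).eq, ← mul_assoc]
    generalize s (S.evu (fam S.ρ (L.map fun x => (x.1, x.2 - i)) 0)) * s (S.evu t) * S.evv p = z
      at h2
    induction h2 using ideal_induction with
    | h0 => rw [zero_mul]; exact zero_mem _
    | hadd F G _ _ hF hG => rw [add_mul]; exact add_mem hF hG
    | ht j r hr =>
      rw [mul_assoc, ← pow_add]
      refine term_mem_ideal ?_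
      rwa [add_comm, fam_add]

variable (S) in
/-- The rational functions in `v` that are regular and invertible at `v = 0`. -/
def RegUnit (w : K) : Prop :=
  ∃ a b : P[X], a.coeff 0 ≠ 0 ∧ b.coeff 0 ≠ 0 ∧ w = S.evv a * (S.evv b)⁻¹

theorem regUnit_evv {a : P[X]} (ha : a.coeff 0 ≠ 0) : S.RegUnit (S.evv a) :=
  ⟨a, 1, ha, by simp, by simp⟩

theorem RegUnit.mul {w z : K} (hw : S.RegUnit w) (hz : S.RegUnit z) : S.RegUnit (w * z) := by
  obtain ⟨a, b, ha, hb, rfl⟩ := hw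
  obtain ⟨c, d, hc, hd, rfl⟩ := hz
  refine ⟨a * c, b * d, by rw [mul_coeff_zero]; exact mul_ne_zero ha hc,
    by rw [mul_coeff_zero]; exact mul_ne_zero hb hd, ?_⟩
  rw [map_mul, mul_comm b, map_mul, mul_inv_rev, mul_assoc, mul_assoc, ← mul_assoc (S.evv b)⁻¹,
    (S.evv_commute b c).inv_left₀.eq, mul_assoc]

theorem RegUnit.inv {w : K} (hw : S.RegUnit w) : S.RegUnit w⁻¹ := by
  obtain ⟨a, b, ha, hb, rfl⟩ := hw
  exact ⟨b, a, hb, ha, by rw [mul_inv_rev, inv_inv]⟩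

/-- Substitutions that are regular at `v = 0` preserve `q`-multiplicities. -/
theorem IsSubst.fam_dvd_coeff (hs : S.IsSubst s φ α β) (L : List (P × ℕ))
    (hL : ∀ x ∈ L, φ x.1 * β.coeff 0 = x.1 * α.coeff 0) {g g' : P[X][X]}
    (hg : ∀ i, fam S.ρ L i ∣ g.coeff i) {w : K} (hw : S.RegUnit w)
    (h : S.ev g' = s (S.ev g) * w) (i : ℕ) : fam S.ρ L i ∣ g'.coeff i := by
  refine dvd_coeff_of_mem_hat (S := S) (fam_antitone _ _) ?_ i
  obtain ⟨a, b, ha, hb, rfl⟩ := hw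
  rw [h, ← mul_assoc]
  exact hat_mul_evv_inv (hat_mul_evv (fam_antitone _ _)
    (hs.map_mem_hat L hL ⟨g, hg, rfl⟩) _) hb

end QPair

end Local

variable {k : Type*} [Field k] {q : kˣ}

/-! ### The field of parameters -/

theorem commute_of_mem_closure {K : Type*} [DivisionRing K] {S : Set K} {w : K}
    (h : ∀ a ∈ S, Commute a w) {a : K} (ha : a ∈ Subfield.closure S) : Commute a w := by
  induction ha using Subfield.closure_induction with
  | mem a ha => exact h a ha
  | one => exact Commute.one_left w
  | add a b _ _ ha hb => exact ha.add_left hb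
  | neg a _ ha => exact ha.neg_left
  | inv a _ ha => exact ha.inv_left₀
  | mul a b _ _ ha hb => exact ha.mul_left hb

/-- Exponents of the monomials in the variables `h`, `e`. -/
def IsHE (a : Expo) : Prop := a .x = 0 ∧ a .y = 0 ∧ (∀ i, a (.σ i) = 0) ∧ ∀ i, a (.τ i) = 0

theorem isHE_δ_h (i : Fin 2) : IsHE (δ (.h i)) := by simp [IsHE]
theorem isHE_δ_e (i : Fin 11) : IsHE (δ (.e i)) := by simp [IsHE]

theorem IsHE.add {a b : Expo} (ha : IsHE a) (hb : IsHE b) : IsHE (a + b) := by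
  obtain ⟨h1, h2, h3, h4⟩ := ha
  obtain ⟨g1, g2, g3, g4⟩ := hb
  simp [IsHE, *]

theorem IsHE.form_left {a : Expo} (ha : IsHE a) (b : Expo) : form a b = 0 := by
  obtain ⟨h1, h2, h3, h4⟩ := ha
  simp [form, *]

/-- Exponents of the monomials in the variables `x`, `y`. -/
def IsXY (a : Expo) : Prop :=
  (∀ i, a (.h i) = 0) ∧ (∀ i, a (.e i) = 0) ∧ (∀ i, a (.σ i) = 0) ∧ ∀ i, a (.τ i) = 0

theorem IsXY.add {a b : Expo} (ha : IsXY a) (hb : IsXY b) : IsXY (a + b) := by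
  obtain ⟨h1, h2, h3, h4⟩ := ha
  obtain ⟨g1, g2, g3, g4⟩ := hb
  simp [IsXY, *]

theorem IsXY.nsmul {a : Expo} (ha : IsXY a) (n : ℕ) : IsXY (n • a) := by
  obtain ⟨h1, h2, h3, h4⟩ := ha
  simp [IsXY, *]

theorem IsHE.form_right {a b : Expo} (ha : IsHE a) (hb : IsXY b ∨ IsHE b) : form b a = 0 := by
  rcases hb with hb | hb
  · obtain ⟨h1, h2, h3, h4⟩ := ha
    obtain ⟨g1, g2, g3, g4⟩ := hb
    simp [form, *]
  · exact hb.form_left a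

variable (k q) in
/-- The Laurent polynomials in the variables `h`, `e`. -/
def heAlg : Subalgebra k (Torus k q) where
  carrier := {f | ∀ a, f.coeff a ≠ 0 → IsHE a}
  mul_mem' := by
    intro f g hf hg c hc
    rw [Torus.coeff_mul] at hc
    obtain ⟨a, ha, hc⟩ := Finset.exists_ne_zero_of_sum_ne_zero hc
    obtain ⟨b, hb, hc⟩ := Finset.exists_ne_zero_of_sum_ne_zero hc
    rw [ne_eq, ite_eq_right_iff, Classical.not_imp] at hc
    rw [← hc.1]
    exact (hf a (Torus.mem_supp.mp ha)).add (hg b (Torus.mem_supp.mp hb))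
  add_mem' := by
    intro f g hf hg c hc
    have h : (f + g).coeff c = f.coeff c + g.coeff c := rfl
    rw [h] at hc
    by_cases h0 : f.coeff c = 0
    · rw [h0, zero_add] at hc
      exact hg c hc
    · exact hf c h0
  algebraMap_mem' := by
    intro r a ha
    rw [Algebra.algebraMap_eq_smul_one, Torus.one_def, Torus.smul_term, Torus.coeff_term] at ha
    split_ifs at ha with h
    · rw [← h]; simp [IsHE]
    · exact absurd rfl ha

theorem term_mem_heAlg {a : Expo} (ha : IsHE a) (c : k) : Torus.term a c ∈ heAlg k q := by
  intro b hb
  rw [Torus.coeff_term] at hb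
  split_ifs at hb with h
  · rwa [← h]
  · exact absurd rfl hb

theorem heAlg_commute {f g : Torus k q} (hf : f ∈ heAlg k q) (hg : g ∈ heAlg k q) :
    f * g = g * f := by
  rw [Torus.mul_eq_sum, Torus.mul_eq_sum, Finset.sum_comm]
  refine Finset.sum_congr rfl fun b hb => Finset.sum_congr rfl fun a ha => ?_
  rw [(hf a (Torus.mem_supp.mp ha)).form_left, (hg b (Torus.mem_supp.mp hb)).form_left, add_comm,
    mul_comm (f.coeff a)]

/-- The generators of the field of parameters. -/
theorem exists_numA_of_mem_generators {z : SkewField k q}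
    (hz : z ∈ Set.range (algebraMap k (SkewField k q)) ∪
      (Set.range (fun i => X (.h i)) ∪ Set.range fun i => X (.e i))) :
    ∃ (a : Expo) (c : k), IsHE a ∧ z = c • mono a := by
  rcases hz with ⟨c, rfl⟩ | ⟨i, rfl⟩ | ⟨i, rfl⟩
  · exact ⟨0, c, by simp [IsHE], by rw [mono_zero, Algebra.algebraMap_eq_smul_one]⟩
  · exact ⟨_, 1, isHE_δ_h i, by rw [one_smul]; rfl⟩
  · exact ⟨_, 1, isHE_δ_e i, by rw [one_smul]; rfl⟩

theorem params_commute_mono {z : SkewField k q} (hz : z ∈ params k q) {b : Expo}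
    (hb : IsXY b ∨ IsHE b) : Commute z (mono b) := by
  refine commute_of_mem_closure (fun z hz => ?_) hz
  obtain ⟨a, c, ha, rfl⟩ := exists_numA_of_mem_generators hz
  exact (mono_commute (by rw [ha.form_left, ha.form_right hb])).smul_left c

theorem params_commute {z w : SkewField k q} (hz : z ∈ params k q) (hw : w ∈ params k q) :
    Commute z w := by
  refine (commute_of_mem_closure (fun w hw => ?_) hw).symm
  obtain ⟨a, c, ha, rfl⟩ := exists_numA_of_mem_generators hw
  exact (params_commute_mono hz (Or.inr ha)).symm.smul_left c

/-- Commutativity of the parameters makes ordinary polynomial arithmetic, in particular coprimality,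
available for the divisors. -/
instance : Field (params k q) :=
  { (inferInstance : DivisionRing (params k q)) with
    mul_comm := fun a b => Subtype.ext (params_commute a.2 b.2).eq }

/-- Laurent polynomials in `h`, `e` commute, so sums and products of fractions are fractions by the
usual rules. -/
theorem exists_denominator {z : SkewField k q} (hz : z ∈ params k q) :
    ∃ d ∈ heAlg k q, ∃ n ∈ heAlg k q, d ≠ 0 ∧ numA k q d * z = numA k q n := by
  induction hz using Subfield.closure_induction with
  | mem z hz =>
    obtain ⟨a, c, ha, rfl⟩ := exists_numA_of_mem_generators hz
    exact ⟨1, one_mem _, Torus.term a c, term_mem_heAlg ha c, one_ne_zero, by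
      rw [map_one, one_mul, numA_term]⟩
  | one => exact ⟨1, one_mem _, 1, one_mem _, one_ne_zero, mul_one _⟩
  | add z w _ _ hz hw =>
    obtain ⟨d, hd, n, hn, h0, h⟩ := hz
    obtain ⟨d', hd', n', hn', h0', h'⟩ := hw
    refine ⟨d * d', mul_mem hd hd', d' * n + d * n', add_mem (mul_mem hd' hn) (mul_mem hd hn'),
      mul_ne_zero h0 h0', ?_⟩
    rw [mul_add, map_add, map_mul _ d n', ← h', ← mul_assoc (numA k q d), ← map_mul,
      heAlg_commute hd hd', map_mul _ d' n, ← h, ← mul_assoc, ← map_mul]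
  | neg z _ hz =>
    obtain ⟨d, hd, n, hn, h0, h⟩ := hz
    exact ⟨d, hd, -n, neg_mem hn, h0, by rw [mul_neg, h, map_neg]⟩
  | inv z _ hz =>
    obtain ⟨d, hd, n, hn, h0, h⟩ := hz
    rcases eq_or_ne z 0 with rfl | hz
    · exact ⟨1, one_mem _, 0, zero_mem _, one_ne_zero, by simp⟩
    · refine ⟨n, hn, d, hd, ?_, by rw [← h, mul_inv_cancel_right₀ hz]⟩
      rintro rfl
      rw [map_zero] at h
      exact mul_ne_zero (numA_ne_zero h0) hz h
  | mul z w _ _ hz hw =>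
    obtain ⟨d, hd, n, hn, h0, h⟩ := hz
    obtain ⟨d', hd', n', hn', h0', h'⟩ := hw
    refine ⟨d' * d, mul_mem hd' hd, n * n', mul_mem hn hn', mul_ne_zero h0' h0, ?_⟩
    rw [map_mul, mul_assoc, ← mul_assoc (numA k q d), h, ← mul_assoc, ← map_mul,
      heAlg_commute hd' hn, map_mul, mul_assoc, h', ← map_mul]

theorem exists_common_denominator {κ : Type*} (s : Finset κ) (c : κ → params k q) :
    ∃ d ∈ heAlg k q, d ≠ 0 ∧ ∀ p ∈ s, ∃ n ∈ heAlg k q, numA k q d * c p = numA k q n := by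
  classical
  induction s using Finset.induction_on with
  | empty => exact ⟨1, one_mem _, one_ne_zero, by simp⟩
  | insert p s hp ih =>
    obtain ⟨d, hd, h0, h⟩ := ih
    obtain ⟨d', hd', n', hn', h0', h'⟩ := exists_denominator (c p).2
    refine ⟨d * d', mul_mem hd hd', mul_ne_zero h0 h0', fun r hr => ?_⟩
    rcases Finset.mem_insert.mp hr with rfl | hr
    · exact ⟨d * n', mul_mem hd hn', by rw [map_mul, mul_assoc, h', map_mul]⟩
    · obtain ⟨n, hn, h⟩ := h r hr
      exact ⟨d' * n, mul_mem hd' hn, by rw [heAlg_commute hd hd', map_mul, mul_assoc, h, map_mul]⟩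

theorem coeff_mul_term (f : Torus k q) (b e : Expo) :
    (f * Torus.term b 1).coeff e = f.coeff (e - b) * ((q ^ form (e - b) b : kˣ) : k) := by
  induction f using Torus.induct with
  | h0 => rw [zero_mul]; exact (zero_mul _).symm
  | hadd f g hf hg =>
    have hc : ∀ (f g : Torus k q) c, (f + g).coeff c = f.coeff c + g.coeff c := fun _ _ _ => rfl
    rw [add_mul, hc, hf, hg, hc, add_mul]
  | hs a c =>
    rw [Torus.term_mul_term, Torus.coeff_term, Torus.coeff_term]
    by_cases h : a + b = e
    · have h' : a = e - b := by rw [← h, add_sub_cancel_right]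
      rw [if_pos h, if_pos h', ← h', mul_one]
    · have h' : a ≠ e - b := fun h' => h (by rw [h', sub_add_cancel])
      rw [if_neg h, if_neg h', zero_mul]

/-- Distinct monomials in `x`, `y` are linearly independent over the parameters. -/
theorem mono_linearIndependent {κ : Type*} (s : Finset κ) (E : κ → Expo) (hE : Function.Injective E)
    (hXY : ∀ p, IsXY (E p)) (c : κ → params k q)
    (h : ∑ p ∈ s, (c p : SkewField k q) * mono (E p) = 0) {p : κ} (hp : p ∈ s) : c p = 0 := by
  obtain ⟨d, hd, h0, hn⟩ := exists_common_denominator s c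
  choose! n hn hn' using hn
  -- With denominators cleared, the relation holds in the torus itself.
  have h1 : ∑ p ∈ s, n p * Torus.term (E p) 1 = 0 := by
    refine numA_injective ?_
    rw [map_zero, map_sum, ← mul_zero (numA k q d), ← h, Finset.mul_sum]
    refine Finset.sum_congr rfl fun p hp => ?_
    rw [map_mul, ← hn' p hp, mul_assoc]; rfl
  have h2 : n p = 0 := by
    by_contra hne
    obtain ⟨a, ha⟩ := Torus.supp_nonempty hne
    rw [Torus.mem_supp] at ha
    -- The coefficients involve only `h`, `e` and the monomials only `x`, `y`, so the exponent `a +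
    -- E p` can arise from the summand `p` alone.
    have h3 : (∑ p ∈ s, n p * Torus.term (E p) 1).coeff (a + E p) = 0 := by rw [h1]; rfl
    rw [Torus.coeff_sum, Finset.sum_eq_single_of_mem p hp, coeff_mul_term, add_sub_cancel_right] at h3
    · exact mul_ne_zero ha (Units.ne_zero _) h3
    · intro r hr hrp
      rw [coeff_mul_term]
      refine mul_eq_zero_of_left ?_ _
      by_contra hr0
      have h4 := hn r hr _ hr0
      refine hrp (hE ?_)
      obtain ⟨a1, a2, a3, a4⟩ := hn p hp a ha
      obtain ⟨b1, b2, b3, b4⟩ := h4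
      obtain ⟨c1, c2, c3, c4⟩ := hXY p
      obtain ⟨d1, d2, d3, d4⟩ := hXY r
      simp only [Pi.add_apply, Pi.sub_apply] at b1 b2
      rw [Expo.ext_iff']
      refine ⟨fun i => by rw [c1, d1], fun i => by rw [c2, d2], by omega, by omega,
        fun i => by rw [c3, d3], fun i => by rw [c4, d4]⟩
  have h3 := hn' p hp
  rw [h2, map_zero] at h3
  exact Subtype.ext ((mul_eq_zero.mp h3).resolve_left (numA_ne_zero h0))

theorem algebraMap_mem_params (c : k) : algebraMap k (SkewField k q) c ∈ params k q :=
  Subfield.subset_closure (Or.inl ⟨c, rfl⟩)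

theorem X_h_mem_params (i : Fin 2) : (X (.h i) : SkewField k q) ∈ params k q :=
  Subfield.subset_closure (Or.inr (Or.inl ⟨i, rfl⟩))

theorem X_e_mem_params (i : Fin 11) : (X (.e i) : SkewField k q) ∈ params k q :=
  Subfield.subset_closure (Or.inr (Or.inr ⟨i, rfl⟩))

variable (k q) in
/-- The element `q` of the field of parameters. -/
def pq : params k q := ⟨algebraMap k (SkewField k q) q, algebraMap_mem_params _⟩

variable (k q) in
/-- The element `h_i` of the field of parameters. -/
def ph (i : Fin 2) : params k q := ⟨X (.h i), X_h_mem_params i⟩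

variable (k q) in
/-- The element `e_i` of the field of parameters. -/
def pe (i : Fin 11) : params k q := ⟨X (.e i), X_e_mem_params i⟩

variable (k q) in
/-- The inclusion of the field of parameters. -/
abbrev pι : params k q →+* SkewField k q := (params k q).subtype

theorem pι_pq_zpow_mul (n : ℤ) (z : SkewField k q) :
    pι k q (pq k q ^ n) * z = ((q ^ n : kˣ) : k) • z := by
  rw [map_zpow₀, Algebra.smul_def, Units.val_zpow_eq_zpow_val, map_zpow₀]; rfl

theorem pq_ne_zero : pq k q ≠ 0 := fun h => by
  have h1 : algebraMap k (SkewField k q) q = 0 := congrArg Subtype.val h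
  exact Units.ne_zero q ((map_eq_zero _).mp h1)

theorem ph_ne_zero (i : Fin 2) : ph k q i ≠ 0 := fun h =>
  mono_ne_zero (k := k) (q := q) (δ (.h i)) (congrArg Subtype.val h)

theorem pe_ne_zero (i : Fin 11) : pe k q i ≠ 0 := fun h =>
  mono_ne_zero (k := k) (q := q) (δ (.e i)) (congrArg Subtype.val h)

variable (k q) in
/-- The pair of monomials with exponents `a`, `b`. -/
def monoPair (a b : Expo) (n : ℤ) (ha : form a a = 0) (hb : form b b = 0) (hax : IsXY a)
    (hbx : IsXY b) (hn : form b a = n + form a b)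
    (hinj : Function.Injective fun p : ℕ × ℕ => p.1 • a + p.2 • b) : QPair (pι k q) where
  u := mono a
  v := mono b
  ρ := pq k q ^ n
  comm_u c := params_commute_mono c.2 (Or.inl hax)
  comm_v c := params_commute_mono c.2 (Or.inl hbx)
  rel := by
    rw [pι_pq_zpow_mul, mono_mul_mono, mono_mul_mono, hn, smul_smul, ← Units.val_mul, ← zpow_add,
      add_comm b]
  ρ_ne_zero := zpow_ne_zero _ pq_ne_zero
  indep g hg := by
    refine Polynomial.ext fun j => Polynomial.ext fun i => ?_
    rw [coeff_zero, coeff_zero]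
    by_contra hij
    have hc : ∀ p : ℕ × ℕ, (mono a ^ p.1 * mono b ^ p.2 : SkewField k q) =
        pι k q (pq k q ^ form (p.1 • a) (p.2 • b)) * mono (p.1 • a + p.2 • b) := fun p => by
      rw [mono_pow ha, mono_pow hb, mono_mul_mono, pι_pq_zpow_mul]
    rw [eval₂_eq_sum, Polynomial.sum_def] at hg
    have hg' : ∑ p ∈ g.support.sigma fun j => (g.coeff j).support,
        ((((g.coeff p.1).coeff p.2) * pq k q ^ form (p.2 • a) (p.1 • b) : params k q) :
          SkewField k q) * mono (p.2 • a + p.1 • b) = 0 := by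
      rw [← hg, Finset.sum_sigma]
      refine Finset.sum_congr rfl fun j _ => ?_
      change _ = (g.coeff j).eval₂ (pι k q) (mono a) * mono b ^ j
      rw [eval₂_eq_sum, Polynomial.sum_def, Finset.sum_mul]
      refine Finset.sum_congr rfl fun i _ => ?_
      rw [mul_assoc, hc (i, j), ← mul_assoc, ← map_mul]
      rfl
    have := mono_linearIndependent _ (fun p : Σ _ : ℕ, ℕ => p.2 • a + p.1 • b) ?_ ?_ _ hg'
      (p := ⟨j, i⟩) ?_
    · exact mul_ne_zero hij (zpow_ne_zero _ pq_ne_zero) this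
    · rintro ⟨j, i⟩ ⟨j', i'⟩ h
      have := @hinj (i, j) (i', j') h
      simp only [Prod.mk.injEq] at this
      obtain ⟨rfl, rfl⟩ := this
      rfl
    · exact fun p => (hax.nsmul _).add (hbx.nsmul _)
    · simp only [Finset.mem_sigma, mem_support_iff]
      exact ⟨fun h => hij (by rw [h, coeff_zero]), hij⟩

theorem injective_smul_add_smul {a b : Expo}
    (h : a .x * b .y - a .y * b .x ≠ 0) :
    Function.Injective fun p : ℕ × ℕ => p.1 • a + p.2 • b := by
  rintro ⟨i, j⟩ ⟨i', j'⟩ hp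
  have hx := congrFun hp .x
  have hy := congrFun hp .y
  simp only [Pi.add_apply, Pi.smul_apply] at hx hy
  simp only [nsmul_eq_mul] at hx hy
  have h1 : ((i : ℤ) - i') * (a .x * b .y - a .y * b .x) = 0 := by
    linear_combination b .y * hx - b .x * hy
  have h2 : ((j : ℤ) - j') * (a .x * b .y - a .y * b .x) = 0 := by
    linear_combination a .x * hy - a .y * hx
  have h3 := (mul_eq_zero.mp h1).resolve_right h
  have h4 := (mul_eq_zero.mp h2).resolve_right h
  exact Prod.ext (by simp only; omega) (by simp only; omega)

variable (k q) in
/-- The pair `(x, y)`. -/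
def pairXY : QPair (pι k q) := monoPair k q (δ .x) (δ .y) 1 (by decide) (by decide)
  (by simp [IsXY]) (by simp [IsXY]) (by decide) (injective_smul_add_smul (by decide))

variable (k q) in
/-- The pair `(x, y⁻¹)`. -/
def pairXY' : QPair (pι k q) := monoPair k q (δ .x) (-δ .y) (-1) (by decide) (by decide)
  (by simp [IsXY]) (by simp [IsXY]) (by decide) (injective_smul_add_smul (by decide))

variable (k q) in
/-- The pair `(y, x)`. -/
def pairYX : QPair (pι k q) := monoPair k q (δ .y) (δ .x) (-1) (by decide) (by decide)
  (by simp [IsXY]) (by simp [IsXY]) (by decide) (injective_smul_add_smul (by decide))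

variable (k q) in
/-- The pair `(y, x⁻¹)`. -/
def pairYX' : QPair (pι k q) := monoPair k q (δ .y) (-δ .x) 1 (by decide) (by decide)
  (by simp [IsXY]) (by simp [IsXY]) (by decide) (injective_smul_add_smul (by decide))

/-! ### The conditions in terms of polynomials with divisors -/

section Local

variable {P K : Type*} [Field P] [DivisionRing K] {ι : P →+* K}

theorem natDegree_linProd {ρ c : P} (hρ : ρ ≠ 0) (hc : c ≠ 0) (n : ℕ) :
    (linProd ρ c n).natDegree = n ∧ linProd ρ c n ≠ 0 := by
  induction n with
  | zero => simp [linProd]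
  | succ n ih =>
    have ha : (ρ ^ (n + 1))⁻¹ * c ≠ 0 := mul_ne_zero (inv_ne_zero (pow_ne_zero _ hρ)) hc
    have h1 : (1 + C ((ρ ^ (n + 1))⁻¹ * c) * Polynomial.X : P[X]).natDegree = 1 := by
      rw [add_comm, ← C_1, natDegree_linear ha]
    have h2 : (1 + C ((ρ ^ (n + 1))⁻¹ * c) * Polynomial.X : P[X]) ≠ 0 := fun h => by
      rw [h, natDegree_zero] at h1
      exact zero_ne_one h1
    rw [linProd_succ]
    exact ⟨by rw [natDegree_mul ih.2 h2, ih.1, h1], mul_ne_zero ih.2 h2⟩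

theorem natDegree_list_linProd {κ : Type*} {ρ : P} (hρ : ρ ≠ 0) (L : List κ) {c : κ → P}
    (hc : ∀ j, c j ≠ 0) (n : κ → ℕ) :
    (L.map fun j => linProd ρ (c j) (n j)).prod.natDegree = (L.map n).sum ∧
      (L.map fun j => linProd ρ (c j) (n j)).prod ≠ 0 := by
  induction L with
  | nil => simp
  | cons j L ih =>
    have h := natDegree_linProd hρ (hc j) (n j)
    rw [List.map_cons, List.prod_cons, List.map_cons, List.sum_cons]
    exact ⟨by rw [natDegree_mul h.2 ih.2, h.1, ih.1], mul_ne_zero h.2 ih.2⟩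

/-- Degree bounds are strict, so that bound `0` means the zero polynomial. With this convention
truncated subtraction is correct even when `A` exceeds the bound. -/
theorem coeff_mul_eq_zero_iff {A p : P[X]} (hA : A ≠ 0) (M : ℕ) :
    (∀ j, M ≤ j → (A * p).coeff j = 0) ↔ ∀ j, M - A.natDegree ≤ j → p.coeff j = 0 := by
  rcases eq_or_ne p 0 with rfl | hp
  · simp
  rw [← degree_lt_iff_coeff_zero, ← degree_lt_iff_coeff_zero, ← natDegree_lt_iff_degree_lt hp,
    ← natDegree_lt_iff_degree_lt (mul_ne_zero hA hp), natDegree_mul hA hp]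
  omega

namespace QPair

variable (S : QPair ι)

/-- `F = ∑ f_i(u) v^i` over `i < N` with polynomials `f_i` of degree `< M` divisible by `D i`. -/
def Form (N M : ℕ) (D : ℕ → P[X]) (F : K) : Prop :=
  ∃ g : P[X][X], (∀ i, N ≤ i → g.coeff i = 0) ∧ (∀ i j, M ≤ j → (g.coeff i).coeff j = 0) ∧
    (∀ i, D i ∣ g.coeff i) ∧ S.ev g = F

theorem ev_sum {κ : Type*} (s : Finset κ) (g : κ → P[X][X]) :
    S.ev (∑ i ∈ s, g i) = ∑ i ∈ s, S.ev (g i) :=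
  map_sum (⟨⟨S.ev, S.ev_zero⟩, S.ev_add⟩ : P[X][X] →+ K) g s

theorem coeff_sum_monomial {R : Type*} [Semiring R] (N : ℕ) (f : ℕ → R) (i : ℕ) :
    (∑ i ∈ Finset.range N, monomial i (f i)).coeff i = if i < N then f i else 0 := by
  rw [finsetSum_coeff]
  simp only [coeff_monomial, Finset.sum_ite_eq', Finset.mem_range]

theorem eq_sum_monomial {R : Type*} [Semiring R] {N : ℕ} {g : R[X]}
    (h : ∀ i, N ≤ i → g.coeff i = 0) : g = ∑ i ∈ Finset.range N, monomial i (g.coeff i) := by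
  ext i
  rw [coeff_sum_monomial]
  split_ifs with hi
  · rfl
  · exact h i (by omega)

theorem form_iff {N M : ℕ} {D : ℕ → P[X]} (hD : ∀ i, D i ≠ 0) (F : K) :
    S.Form N M D F ↔ ∃ p : ℕ → P[X],
      (∀ i ∈ Finset.range N, ∀ j, M - (D i).natDegree ≤ j → (p i).coeff j = 0) ∧
      F = ∑ i ∈ Finset.range N, S.evu (D i * p i) * S.v ^ i := by
  constructor
  · rintro ⟨g, hN, hM, hdvd, rfl⟩
    choose p hp using hdvd
    refine ⟨p, fun i _ => ?_, ?_⟩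
    · rw [← coeff_mul_eq_zero_iff (hD i), ← hp i]
      exact hM i
    · conv_lhs => rw [eq_sum_monomial hN, ev_sum]
      simp only [ev_monomial, hp]
  · rintro ⟨p, hp, rfl⟩
    refine ⟨∑ i ∈ Finset.range N, monomial i (D i * p i), fun i hi => ?_, fun i => ?_, fun i => ?_, ?_⟩
    · rw [coeff_sum_monomial, if_neg (by omega)]
    · rw [coeff_sum_monomial]
      split_ifs with h
      · exact (coeff_mul_eq_zero_iff (hD i) M).mpr (hp i (Finset.mem_range.mpr h))
      · simp
    · rw [coeff_sum_monomial]
      split_ifs with h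
      · exact dvd_mul_right _ _
      · exact dvd_zero _
    · rw [ev_sum]
      simp only [ev_monomial]

/-- Exchange of the order of the two variables. -/
theorem exists_ev_eq {S T : QPair ι} (hu : T.u = S.v) (hv : T.v = S.u) (g : P[X][X]) :
    ∃ h : P[X][X], T.ev h = S.ev g ∧
      ∀ i j, (h.coeff j).coeff i = (g.coeff i).coeff j * T.ρ ^ (i * j) := by
  induction g using Polynomial.induction_on' with
  | add g g' hg hg' =>
    obtain ⟨h, h1, h2⟩ := hg
    obtain ⟨h', h1', h2'⟩ := hg'
    exact ⟨h + h', by rw [ev_add, ev_add, h1, h1'], fun i j => by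
      simp only [coeff_add, h2, h2', add_mul]⟩
  | monomial n p =>
    induction p using Polynomial.induction_on' with
    | add p p' hg hg' =>
      obtain ⟨h, h1, h2⟩ := hg
      obtain ⟨h', h1', h2'⟩ := hg'
      refine ⟨h + h', by rw [ev_add, h1, h1', map_add, ev_add], fun i j => ?_⟩
      rw [coeff_add, coeff_add, h2, h2', map_add, coeff_add, coeff_add, add_mul]
    | monomial m a =>
      refine ⟨monomial m (monomial n (a * T.ρ ^ (n * m))), ?_, fun i j => ?_⟩
      · have h1 := T.v_pow_mul_evu m (monomial n a)
        have h2 : scale (T.ρ ^ m) (monomial n a) = monomial n (a * T.ρ ^ (n * m)) := by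
          ext i
          rw [scale_coeff, coeff_monomial, coeff_monomial]
          split_ifs with h
          · rw [← h, ← pow_mul, mul_comm m]
          · rw [zero_mul]
        rw [ev_monomial, ← h2, ← h1, ev_monomial, ← C_mul_X_pow_eq_monomial,
          ← C_mul_X_pow_eq_monomial, map_mul, map_mul, map_pow, map_pow, evu_C, evu_C, evu_X, evu_X,
          hu, hv, ← mul_assoc, ((S.comm_u a).pow_right m).eq]
      · rw [coeff_monomial, coeff_monomial]
        by_cases hj : m = j
        · subst hj
          by_cases hi : n = i
          · subst hi
            rw [if_pos rfl, if_pos rfl, coeff_monomial, coeff_monomial, if_pos rfl, if_pos rfl]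
          · rw [if_pos rfl, if_neg hi, coeff_monomial, if_neg hi, coeff_zero, zero_mul]
        · rw [if_neg hj, coeff_zero]
          by_cases hi : n = i
          · rw [if_pos hi, coeff_monomial, if_neg hj, zero_mul]
          · rw [if_neg hi, coeff_zero, zero_mul]

end QPair

end Local


/-! ### The conditions `(x)_λ`, `(y)_λ` as bidegree bounds and divisors. -/

theorem qProd_toNat (z : SkewField k q) (n : ℤ) : qProd z 0 n.toNat = qProd z 0 n := by
  rcases le_or_gt 0 n with h | h
  · rw [Int.toNat_of_nonneg h]
  · rw [qProd_of_le h.le, qProd_of_le (by omega)]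

theorem qProd_neg_toNat (z : SkewField k q) (n : ℤ) : qProd z (-n.toNat) 0 = qProd z (-n) 0 := by
  rcases le_or_gt 0 n with h | h
  · rw [Int.toNat_of_nonneg h]
  · rw [qProd_of_le (by omega), qProd_of_le (by omega)]

variable (k q) in
/-- The product of `1 + q^t c X` over `-n ≤ t < 0`. -/
def low (c : params k q) (n : ℕ) : (params k q)[X] := linProd (pq k q) c n

variable (k q) in
/-- The product of `1 + q^t c X` over `0 ≤ t < n`. -/
def upp (c : params k q) (n : ℕ) : (params k q)[X] :=
  linProd (pq k q)⁻¹ ((pq k q)⁻¹ * c) n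

theorem evu_linear (S : QPair (pι k q)) (c : params k q) (n : ℤ) :
    S.evu (1 + C (pq k q ^ n * c) * Polynomial.X) =
      1 + ((q ^ n : kˣ) : k) • (pι k q c * S.u) := by
  rw [map_add, map_one, map_mul, S.evu_C, S.evu_X, map_mul, mul_assoc, pι_pq_zpow_mul]

theorem evu_low (S : QPair (pι k q)) (c : params k q) (n : ℕ) :
    S.evu (low k q c n) = qProd (pι k q c * S.u) (-n) 0 := by
  induction n with
  | zero => rw [qProd_of_le (by simp)]; simp [low, linProd]
  | succ n ih =>
    rw [qProd_eq_mul (by omega), show (-((n + 1 : ℕ) : ℤ)) + 1 = -n by push_cast; ring, ← ih, low,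
      linProd_succ, mul_comm, map_mul, ← evu_linear, zpow_neg, zpow_natCast]
    rfl

theorem evu_upp (S : QPair (pι k q)) (c : params k q) (n : ℕ) :
    S.evu (upp k q c n) = qProd (pι k q c * S.u) 0 n := by
  induction n with
  | zero => rw [qProd_of_le (by simp)]; simp [upp, linProd]
  | succ n ih =>
    rw [Nat.cast_succ, qProd_add_one (by omega), ← ih, upp, linProd_succ, map_mul, ← evu_linear]
    congr 5
    rw [zpow_natCast, inv_pow, inv_inv, pow_succ, mul_assoc, mul_inv_cancel_left₀ pq_ne_zero]

theorem semiconj_qProd {w z : SkewField k q} {n : ℤ} (h : w * z = (((q ^ n : kˣ) : k) • z) * w)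
    (a b : ℤ) : w * qProd z a b = qProd z (a + n) (b + n) * w := by
  rw [qProd, qProd, show b + n - (a + n) = b - a by ring]
  generalize List.range _ = L
  induction L with
  | nil => simp
  | cons j L ih =>
    simp only [List.map_cons, List.prod_cons]
    rw [mul_assoc, ← ih, ← mul_assoc, ← mul_assoc]
    congr 1
    rw [mul_add, add_mul, mul_one, one_mul, mul_smul_comm, h, show a + n + (j : ℤ) = a + j + n by ring,
      zpow_add q (a + j) n, Units.val_mul, mul_smul]
    simp only [smul_mul_assoc]

theorem isPolyOfDegreeLE_iff (S : QPair (pι k q)) (n : ℤ) (U : SkewField k q) :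
    IsPolyOfDegreeLE S.u n U ↔
      ∃ p : (params k q)[X], (∀ j, (n + 1).toNat ≤ j → p.coeff j = 0) ∧ S.evu p = U := by
  have hm : ∀ j c, S.evu (monomial j c) = pι k q c * S.u ^ j := fun j c => by
    rw [← C_mul_X_pow_eq_monomial, map_mul, map_pow, S.evu_C, S.evu_X]
  constructor
  · rintro ⟨c, rfl⟩
    refine ⟨∑ j ∈ Finset.range (n + 1).toNat, monomial j (c j), fun j hj => ?_, ?_⟩
    · rw [QPair.coeff_sum_monomial, if_neg (by omega)]
    · rw [map_sum]
      simp only [hm]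
      rfl
  · rintro ⟨p, hp, rfl⟩
    refine ⟨p.coeff, ?_⟩
    conv_lhs => rw [QPair.eq_sum_monomial hp, map_sum]
    simp only [hm]
    rfl

variable (k q) in
/-- The divisors in the condition `(x)_λ`. -/
def divX (l : Pic) (i : ℕ) : (params k q)[X] :=
  upp k q (pe k q 10) (l.m 10 - i).toNat *
    low k q (ph k q 1 / pe k q 9) (l.m 9 - (l.d 0 - i)).toNat

variable (k q) in
/-- The divisors in the condition `(y)_λ` that express the multiplicities at `y = 0`. -/
def divY₀ (l : Pic) (i : ℕ) : (params k q)[X] :=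
  (([0, 1, 2, 3, 4, 5] : List (Fin 11)).map fun j => low k q (pe k q j)⁻¹ (l.m j - i).toNat).prod

variable (k q) in
/-- The divisors in the condition `(y)_λ` that express the multiplicities at `y = ∞`. -/
def divY₁ (l : Pic) (i : ℕ) : (params k q)[X] :=
  (([6, 7, 8] : List (Fin 11)).map fun j =>
    upp k q (pe k q j / ph k q 0) (l.m j - (l.d 1 - i)).toNat).prod

theorem natDegree_low {c : params k q} (hc : c ≠ 0) (n : ℕ) :
    (low k q c n).natDegree = n ∧ low k q c n ≠ 0 :=
  natDegree_linProd pq_ne_zero hc n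

theorem natDegree_upp {c : params k q} (hc : c ≠ 0) (n : ℕ) :
    (upp k q c n).natDegree = n ∧ upp k q c n ≠ 0 :=
  natDegree_linProd (inv_ne_zero pq_ne_zero) (mul_ne_zero (inv_ne_zero pq_ne_zero) hc) n

theorem natDegree_divX (l : Pic) (i : ℕ) :
    (divX k q l i).natDegree = (l.m 10 - i).toNat + (l.m 9 - (l.d 0 - i)).toNat ∧
      divX k q l i ≠ 0 := by
  have h1 := natDegree_upp (pe_ne_zero (k := k) (q := q) 10) (l.m 10 - i).toNat
  have h2 := natDegree_low (div_ne_zero (ph_ne_zero (k := k) (q := q) 1) (pe_ne_zero 9))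
    (l.m 9 - (l.d 0 - i)).toNat
  exact ⟨by rw [divX, natDegree_mul h1.2 h2.2, h1.1, h2.1], mul_ne_zero h1.2 h2.2⟩

theorem natDegree_divY₀ (l : Pic) (i : ℕ) :
    (divY₀ k q l i).natDegree =
      (([0, 1, 2, 3, 4, 5] : List (Fin 11)).map fun j => (l.m j - i).toNat).sum ∧
      divY₀ k q l i ≠ 0 :=
  natDegree_list_linProd pq_ne_zero _ (fun j => inv_ne_zero (pe_ne_zero j)) _

theorem natDegree_divY₁ (l : Pic) (i : ℕ) :
    (divY₁ k q l i).natDegree =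
      (([6, 7, 8] : List (Fin 11)).map fun j => (l.m j - (l.d 1 - i)).toNat).sum ∧
      divY₁ k q l i ≠ 0 :=
  have hq : (pq k q)⁻¹ ≠ 0 := inv_ne_zero pq_ne_zero
  natDegree_list_linProd hq _
    (fun j => mul_ne_zero hq (div_ne_zero (pe_ne_zero j) (ph_ne_zero 0))) _

theorem sum_max_eq {κ : Type*} (L : List κ) (f : κ → ℤ) :
    (L.map fun j => max (f j) 0).sum = ((L.map fun j => (f j).toNat).sum : ℕ) := by
  induction L with
  | nil => rfl
  | cons j L ih =>
    rw [List.map_cons, List.map_cons, List.sum_cons, List.sum_cons, ih, Nat.cast_add,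
      Int.toNat_eq_max]

/-- In `(x)_λ` the powers of `x` stand on the left. Moving `x^i` to the right shifts the ranges of
`t` by `-i`, which gives `divX`, and rescales the argument of `U_i`, which leaves its degree bound
intact. Negative degrees match the empty sums through `toNat`. -/
theorem condX_iff (l : Pic) (F : SkewField k q) :
    CondX l F ↔ (pairYX k q).Form (l.d 0 + 1).toNat (l.d 1 + 1).toNat (divX k q l) F := by
  rw [QPair.form_iff _ fun i => (natDegree_divX l i).2]
  have hdeg : ∀ i : ℕ, (l.d 1 - max ((i : ℤ) - l.d 0 + l.m 9) 0 - max (l.m 10 - i) 0 + 1).toNat =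
      (l.d 1 + 1).toNat - (divX k q l i).natDegree := fun i => by
    rw [(natDegree_divX l i).1]; omega
  have hcomm : ∀ (i : ℕ) (c : params k q) (a b : ℤ),
      (X .x : SkewField k q) ^ i * qProd (pι k q c * X .y) a b =
        qProd (pι k q c * X .y) (a - i) (b - i) * X .x ^ i := by
    intro i c a b
    refine semiconj_qProd ?_ a b
    have hc : mono (δ .x) ^ i * pι k q c = pι k q c * mono (δ .x) ^ i :=
      (((pairYX k q).comm_v c).pow_right i).eq.symm
    change mono (δ .x) ^ i * (pι k q c * mono (δ .y)) =
      _ • (pι k q c * mono (δ .y)) * mono (δ .x) ^ i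
    rw [← mul_assoc, hc, mul_assoc]
    have hk : kap (δ .y) (i • δ .x) = -i := by simp [kap_apply, form]
    rw [mono_pow (by decide), mono_mul_comm, hk]
    simp only [smul_mul_assoc, mul_smul_comm, mul_assoc]
  have hterm : ∀ (i : ℕ) (r p : (params k q)[X]), p = scale ((pairYX k q).ρ ^ i) r →
      X .x ^ i * qProd (X (.e 10) * X .y) i (l.m 10) *
        qProd (X (.h 1) / X (.e 9) * X .y) (l.d 0 - l.m 9) i * (pairYX k q).evu r =
      (pairYX k q).evu (divX k q l i * p) * (pairYX k q).v ^ i := by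
    rintro i r p rfl
    have h1 := hcomm i (pe k q 10) i (l.m 10)
    have h2 := hcomm i (ph k q 1 / pe k q 9) (l.d 0 - l.m 9) i
    rw [map_div₀] at h2
    change _ * qProd (X (.e 10) * X .y) _ _ = qProd (X (.e 10) * X .y) _ _ * _ at h1
    change _ * qProd (X (.h 1) / X (.e 9) * X .y) _ _ =
      qProd (X (.h 1) / X (.e 9) * X .y) _ _ * _ at h2
    have h3 := (pairYX k q).v_pow_mul_evu i r
    have h4 := evu_upp (pairYX k q) (pe k q 10) (l.m 10 - i).toNat
    have h5 := evu_low (pairYX k q) (ph k q 1 / pe k q 9) (l.m 9 - (l.d 0 - i)).toNat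
    rw [qProd_toNat] at h4
    rw [qProd_neg_toNat, map_div₀] at h5
    rw [divX, map_mul, map_mul, h4, h5, mul_assoc _ _ ((pairYX k q).v ^ i), ← h3, h1, sub_self,
      mul_assoc (qProd _ _ _), h2, sub_self]
    rw [show -(l.m 9 - (l.d 0 - (i : ℤ))) = l.d 0 - l.m 9 - i by ring]
    simp only [mul_assoc]
    rfl
  have hρ := (pairYX k q).ρ_ne_zero
  have hsc : ∀ (i : ℕ) (r : (params k q)[X]),
      scale ((pairYX k q).ρ ^ i) (scale ((pairYX k q).ρ ^ i)⁻¹ r) = r := fun i r => by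
    ext j
    rw [scale_coeff, scale_coeff, mul_assoc, ← mul_pow, inv_mul_cancel₀ (pow_ne_zero _ hρ), one_pow,
      mul_one]
  constructor
  · rintro ⟨U, hU, rfl⟩
    have hU' : ∀ i ∈ Finset.range (l.d 0 + 1).toNat, ∃ p : (params k q)[X], _ ∧ _ := fun i hi =>
      (isPolyOfDegreeLE_iff (pairYX k q) _ _).mp (hU i hi)
    choose! r hr hr' using hU'
    refine ⟨fun i => scale ((pairYX k q).ρ ^ i) (r i), fun i hi j hj => ?_,
      Finset.sum_congr rfl fun i hi => ?_⟩
    · rw [← hdeg] at hj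
      rw [scale_coeff, hr i hi j hj, zero_mul]
    · rw [← hr' i hi]
      exact hterm i _ _ rfl
  · rintro ⟨p, hp, rfl⟩
    refine ⟨fun i => (pairYX k q).evu (scale ((pairYX k q).ρ ^ i)⁻¹ (p i)), fun i hi => ?_,
      Finset.sum_congr rfl fun i hi => ?_⟩
    · refine (isPolyOfDegreeLE_iff (pairYX k q) _ _).mpr ⟨_, fun j hj => ?_, rfl⟩
      rw [hdeg] at hj
      rw [scale_coeff, hp i hi j hj, zero_mul]
    · exact (hterm i _ _ (hsc i (p i)).symm).symm

theorem condY_iff (l : Pic) (F : SkewField k q) :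
    CondY l F ↔ (pairXY k q).Form (l.d 1 + 1).toNat (l.d 0 + 1).toNat
      (fun i => divY₀ k q l i * divY₁ k q l i) F := by
  have hD : ∀ i, divY₀ k q l i * divY₁ k q l i ≠ 0 := fun i =>
    mul_ne_zero (natDegree_divY₀ l i).2 (natDegree_divY₁ l i).2
  rw [QPair.form_iff _ hD]
  have hdeg : ∀ i : ℕ, (l.d 0 - (([0, 1, 2, 3, 4, 5] : List (Fin 11)).map fun j =>
      max (l.m j - i) 0).sum - (([6, 7, 8] : List (Fin 11)).map fun j =>
        max ((i : ℤ) - l.d 1 + l.m j) 0).sum + 1).toNat =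
      (l.d 0 + 1).toNat - (divY₀ k q l i * divY₁ k q l i).natDegree := fun i => by
    rw [natDegree_mul (natDegree_divY₀ (k := k) (q := q) l i).2 (natDegree_divY₁ (k := k) (q := q) l i).2, (natDegree_divY₀ l i).1,
      (natDegree_divY₁ l i).1, sum_max_eq, sum_max_eq]
    have : ∀ j, (i : ℤ) - l.d 1 + l.m j = l.m j - (l.d 1 - i) := fun j => by ring
    simp only [this]
    omega
  have hterm : ∀ (i : ℕ) (r : (params k q)[X]),
      (([0, 1, 2, 3, 4, 5] : List (Fin 11)).map fun j =>
          qProd (1 / X (.e j) * X .x) (i - l.m j) 0).prod *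
        (([6, 7, 8] : List (Fin 11)).map fun j =>
          qProd (X (.e j) / X (.h 0) * X .x) 0 (i - l.d 1 + l.m j)).prod *
        (pairXY k q).evu r * X .y ^ i =
      (pairXY k q).evu (divY₀ k q l i * divY₁ k q l i * r) * (pairXY k q).v ^ i := by
    intro i r
    rw [map_mul, map_mul, divY₀, divY₁, map_list_prod, map_list_prod, List.map_map, List.map_map]
    have e1 : ((pairXY k q).evu : (params k q)[X] → SkewField k q) ∘
        (fun j => low k q (pe k q j)⁻¹ (l.m j - i).toNat) =
        fun j => qProd (1 / X (.e j) * X .x) (i - l.m j) 0 := by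
      funext j
      rw [Function.comp_apply, evu_low, qProd_neg_toNat, map_inv₀, neg_sub, one_div]
      rfl
    have e2 : ((pairXY k q).evu : (params k q)[X] → SkewField k q) ∘
        (fun j => upp k q (pe k q j / ph k q 0) (l.m j - (l.d 1 - i)).toNat) =
        fun j => qProd (X (.e j) / X (.h 0) * X .x) 0 (i - l.d 1 + l.m j) := by
      funext j
      rw [Function.comp_apply, evu_upp, qProd_toNat, map_div₀,
        show l.m j - (l.d 1 - (i : ℤ)) = i - l.d 1 + l.m j by ring]
      rfl
    rw [e1, e2]
    rfl
  constructor
  · rintro ⟨U, hU, rfl⟩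
    have hU' : ∀ i ∈ Finset.range (l.d 1 + 1).toNat, ∃ p : (params k q)[X], _ ∧ _ := fun i hi =>
      (isPolyOfDegreeLE_iff (pairXY k q) _ _).mp (hU i hi)
    choose! r hr hr' using hU'
    refine ⟨r, fun i hi j hj => ?_, Finset.sum_congr rfl fun i hi => ?_⟩
    · rw [← hdeg] at hj
      exact hr i hi j hj
    · rw [← hr' i hi]
      exact hterm i _
  · rintro ⟨p, hp, rfl⟩
    refine ⟨fun i => (pairXY k q).evu (p i), fun i hi => ?_, Finset.sum_congr rfl fun i hi => ?_⟩
    · refine (isPolyOfDegreeLE_iff (pairXY k q) _ _).mpr ⟨_, fun j hj => ?_, rfl⟩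
      rw [hdeg] at hj
      exact hp i hi j hj
    · exact (hterm i _).symm

/-! ### Transformation of the two conditions -/

section Local

variable {P K : Type*} [Field P] [DivisionRing K] {ι : P →+* K}

namespace QPair

/-- Reversing coefficients is the passage to the coordinate `v⁻¹` after division by `v^n`.
Multiplicities at `v = ∞` thereby become multiplicities at `0`. -/
theorem ev_reflect {S T : QPair ι} (hu : T.u = S.u) (hv : T.v = S.v⁻¹) (hv0 : S.v ≠ 0) {n : ℕ}
    {g : P[X][X]} (hg : ∀ i, n + 1 ≤ i → g.coeff i = 0) :
    T.ev (Polynomial.reflect n g) = S.ev g * (S.v ^ n)⁻¹ := by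
  have hevu : T.evu = S.evu := by
    ext
    · simp [evu_C]
    · simp [evu_X, hu]
  have h1 : ∀ i, n + 1 ≤ i → (Polynomial.reflect n g).coeff i = 0 := fun i hi => by
    rw [coeff_reflect, revAt_eq_self_of_lt (by omega)]
    exact hg i hi
  rw [eq_sum_monomial h1, ev_sum, ← Finset.sum_range_reflect]
  conv_rhs => rw [eq_sum_monomial hg, ev_sum, Finset.sum_mul]
  refine Finset.sum_congr rfl fun i hi => ?_
  have hi : i ≤ n := by have := Finset.mem_range.mp hi; omega
  rw [ev_monomial, ev_monomial, coeff_reflect, revAt_le (by omega), hevu, hv,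
    show n - (n + 1 - 1 - i) = i by omega, show n + 1 - 1 - i = n - i by omega, mul_assoc]
  congr 1
  rw [eq_mul_inv_iff_mul_eq₀ (pow_ne_zero _ hv0), inv_pow, inv_mul_eq_iff_eq_mul₀ (pow_ne_zero _ hv0),
    ← pow_add, Nat.sub_add_cancel hi]

/-- Multiplicities at `v = 0` and `v = ∞` are preserved by substitutions that are regular there. -/
theorem dvd_coeff_of_subst {S T : QPair ι} (hu : T.u = S.u) (hv : T.v = S.v⁻¹) (hv0 : S.v ≠ 0)
    {s : K →+* K} {φ : P →+* P} {α β α' β' : P[X]} (hs : S.IsSubst s φ α β)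
    (hs' : T.IsSubst s φ α' β') {L L' : List (P × ℕ)}
    (hL : ∀ x ∈ L, φ x.1 * β.coeff 0 = x.1 * α.coeff 0)
    (hL' : ∀ x ∈ L', φ x.1 * β'.coeff 0 = x.1 * α'.coeff 0) {w : K} {n n' : ℤ}
    (hw : S.RegUnit w) (hw' : T.RegUnit (w * S.v ^ (n - n'))) {g h : P[X][X]}
    (hg : ∀ i, (n + 1).toNat ≤ i → g.coeff i = 0) (hh : ∀ i, (n' + 1).toNat ≤ i → h.coeff i = 0)
    (hgL : ∀ i, fam S.ρ L i ∣ g.coeff i)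
    (hgL' : ∀ i : ℕ, i ≤ n → fam T.ρ L' (n - i).toNat ∣ g.coeff i)
    (heq : S.ev h = s (S.ev g) * w) :
    (∀ i, fam S.ρ L i ∣ h.coeff i) ∧ ∀ i : ℕ, i ≤ n' → fam T.ρ L' (n' - i).toNat ∣ h.coeff i := by
  refine ⟨fun i => hs.fam_dvd_coeff L hL hgL hw heq i, fun i hi => ?_⟩
  -- For a negative degree `g` is zero, hence so is `h`; otherwise both degrees are natural numbers
  -- and reversal makes sense.
  rcases lt_or_ge n 0 with hn | hn
  · have hg0 : g = 0 := by
      ext1 i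
      exact hg i (by omega)
    rw [hg0, ev_zero, map_zero, zero_mul, ← S.ev_zero] at heq
    rw [S.ev_injective heq, coeff_zero]
    exact dvd_zero _
  · obtain ⟨N, rfl⟩ := Int.eq_ofNat_of_zero_le hn
    obtain ⟨N', rfl⟩ := Int.eq_ofNat_of_zero_le (a := n') (by omega)
    have hi' : i ≤ N' := by exact_mod_cast hi
    have e1 := ev_reflect hu hv hv0 (n := N) (g := g) fun i hi => hg i (by omega)
    have e2 := ev_reflect hu hv hv0 (n := N') (g := h) fun i hi => hh i (by omega)
    -- Both sides are divided by their top powers of `v`; the change of degree enters only through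
    -- `w v^(n - n')`, a unit at infinity.
    have e3 : T.ev (Polynomial.reflect N' h) = s (T.ev (Polynomial.reflect N g)) * (w * S.v ^ ((N : ℤ) - N')) := by
      obtain ⟨a, b, ha, hb, rfl⟩ := hw
      have hc : Commute (S.evv a * (S.evv b)⁻¹) S.v :=
        (S.evv_commute_v a).mul_left (S.evv_commute_v b).inv_left₀
      rw [e1, e2, heq, map_mul, map_inv₀, map_pow, hs.map_v, ← (hc.zpow_right₀ _).eq.symm,
        zpow_sub₀ hv0, zpow_natCast, zpow_natCast, div_eq_mul_inv]
      rw [mul_assoc (s _) (S.v ^ N)⁻¹, mul_assoc (S.v ^ N), inv_mul_cancel_left₀ (pow_ne_zero _ hv0), mul_assoc (s _),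
        ((hc.pow_right N').inv_right₀).eq]
    have hgL'' : ∀ k, fam T.ρ L' k ∣ (Polynomial.reflect N g).coeff k := by
      intro k
      rw [coeff_reflect]
      rcases Nat.lt_or_ge N k with hk | hk
      · rw [revAt_eq_self_of_lt hk, hg k (by omega)]
        exact dvd_zero _
      · rw [revAt_le hk]
        have := hgL' (N - k) (by omega)
        rwa [show ((N : ℤ) - ((N - k : ℕ) : ℤ)).toNat = k by omega] at this
    have := hs'.fam_dvd_coeff L' hL' hgL'' hw' e3 (N' - i)
    rwa [coeff_reflect, revAt_le (by omega), Nat.sub_sub_self hi',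
      show N' - i = ((N' : ℤ) - i).toNat by omega] at this

/-- A fraction in `v` standing to the left of `u` is moved to the right, which rescales numerator
and denominator by `ρ`. -/
theorem isSubst_of_left {S : QPair ι} {s : K →+* K} {φ : P →+* P} {α β : P[X]}
    (h1 : ∀ a, s (ι a) = ι (φ a)) (h2 : φ S.ρ = S.ρ) (h3 : s S.v = S.v)
    (h4 : s S.u = S.evv β * (S.evv α)⁻¹ * S.u) (h5 : α.coeff 0 ≠ 0) :
    S.IsSubst s φ (scale S.ρ α) (scale S.ρ β) where
  map_ι := h1
  map_ρ := h2
  map_v := h3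
  map_u := by
    have hα : (scale S.ρ α).coeff 0 ≠ 0 := by rwa [scale_coeff, pow_zero, mul_one]
    rw [h4, eq_mul_inv_iff_mul_eq₀ (S.evv_ne_zero_of_coeff hα), mul_assoc, ← evv_mul_u, mul_assoc,
      inv_mul_cancel_left₀ (S.evv_ne_zero_of_coeff h5), evv_mul_u]
  coeff_ne_zero := by rwa [scale_coeff, pow_zero, mul_one]

end QPair

end Local


/-! ### The term by term action of a reflection. -/

theorem linProd_coeff_zero {P : Type*} [Field P] (ρ c : P) (n : ℕ) : (linProd ρ c n).coeff 0 = 1 := by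
  induction n with
  | zero => simp [linProd]
  | succ n ih => rw [linProd_succ, mul_coeff_zero, ih]; simp

theorem map_linProd {P : Type*} [Field P] (φ : P →+* P) (ρ c : P) (n : ℕ) :
    (linProd ρ c n).map φ = linProd (φ ρ) (φ c) n := by
  simp [linProd, Polynomial.map_prod]

/-- All factors commute, and `gq z n * qProd z n 0 = qProd z 0 n` holds for both arguments. So the
quotient of q-factorials cancels the divisor present in the input and creates the one required in
the output, whatever the signs of `m` and `n`. -/
theorem gq_mul_evu (S : QPair (pι k q)) {cZ cW : params k q} (hZ : QRegular (pι k q cZ * S.u))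
    (hW : QRegular (pι k q cW * S.u)) (m n : ℤ) (r : (params k q)[X]) :
    (gq (pι k q cW * S.u) n)⁻¹ * gq (pι k q cZ * S.u) m *
        S.evu (upp k q cW n.toNat * low k q cZ (-m).toNat * r) =
      S.evu (upp k q cZ m.toNat * low k q cW (-n).toNat * r) := by
  have hcomm : ∀ p r : (params k q)[X], Commute (S.evu p) (S.evu r) := fun p r => by
    rw [Commute, SemiconjBy, ← map_mul, ← map_mul, mul_comm]
  have hu : ∀ c : params k q, pι k q c * S.u = S.evu (C c * Polynomial.X) := fun c => by
    rw [map_mul, S.evu_C, S.evu_X]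
  simp only [map_mul, evu_upp, evu_low, qProd_toNat, qProd_neg_toNat, neg_neg]
  have h1 := hZ.gq_mul_qProd m
  have h2 := hW.gq_mul_qProd n
  have hZW : Commute (pι k q cZ * S.u) (pι k q cW * S.u) := by
    rw [hu, hu]; exact hcomm _ _
  rw [← h2, ← h1]
  generalize hA : gq (pι k q cW * S.u) n = A
  generalize hB : gq (pι k q cZ * S.u) m = B
  have hA0 : A ≠ 0 := by rw [← hA]; exact hW.gq_ne_zero n
  have hAB : A * B = B * A := by
    rw [← hA, ← hB]; exact (gq_commute_gq hZW.symm _ _).eq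
  have hAD : Commute A (qProd (pι k q cZ * S.u) m 0) := by
    rw [← hA]; exact gq_commute (qProd_commute hZW _ _).symm _
  have hED : Commute (qProd (pι k q cW * S.u) n 0) (qProd (pι k q cZ * S.u) m 0) :=
    qProd_commute (qProd_commute hZW _ _).symm _ _
  rw [mul_assoc, inv_mul_eq_iff_eq_mul₀ hA0]
  simp only [← mul_assoc]
  rw [hAB]
  congr 1
  rw [mul_assoc, mul_assoc, mul_assoc, mul_assoc, hED.eq]

/-- The action of a reflection on the condition that it preserves term by term. -/
theorem exists_form_of_reflection (S : QPair (pι k q)) (s : SkewField k q →ₐ[k] SkewField k q)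
    (φ : params k q →+* params k q) (hι : ∀ a, s (pι k q a) = pι k q (φ a)) (hu : s S.u = S.u)
    {cZ cW : params k q} (hZW : φ cZ = cW) (hWZ : φ cW = cZ) (hZ : QRegular (pι k q cZ * S.u))
    (hW : QRegular (pι k q cW * S.u)) (hcZ : cZ ≠ 0) (hcW : cW ≠ 0) (m n : ℕ → ℤ)
    (t : ℕ → (params k q)[X]) (ht : ∀ i, (t i).map φ = t i) (ht0 : ∀ i, (t i).coeff 0 = 1)
    {τ τ' : SkewField k q} (hτ : ∀ i, s (S.v ^ i * τ) =
      (gq (pι k q cW * S.u) (n i))⁻¹ * gq (pι k q cZ * S.u) (m i) * (S.v ^ i * τ')) {N M M' : ℕ}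
    (hM : ∀ i, M - ((n i).toNat + (-m i).toNat + (t i).natDegree) =
      M' - ((m i).toNat + (-n i).toNat + (t i).natDegree)) {g : (params k q)[X][X]}
    (hgN : ∀ i, N ≤ i → g.coeff i = 0) (hgM : ∀ i j, M ≤ j → (g.coeff i).coeff j = 0)
    (hg : ∀ i, upp k q cZ (n i).toNat * low k q cW (-m i).toNat * t i ∣ g.coeff i) :
    ∃ g' : (params k q)[X][X], (∀ i, N ≤ i → g'.coeff i = 0) ∧
      (∀ i j, M' ≤ j → (g'.coeff i).coeff j = 0) ∧
      (∀ i, upp k q cZ (m i).toNat * low k q cW (-n i).toNat * t i ∣ g'.coeff i) ∧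
      s (S.ev g * τ) = S.ev g' * τ' ∧ (g'.coeff 0).coeff 0 = φ ((g.coeff 0).coeff 0) := by
  choose p hp using hg
  have hq : φ (pq k q) = pq k q := Subtype.ext <| by
    have := hι (pq k q)
    change pι k q (φ (pq k q)) = pι k q (pq k q)
    rw [← this]
    exact s.commutes _
  have hne : ∀ (a b : params k q) (m n : ℕ), a ≠ 0 → b ≠ 0 → ∀ i,
      (upp k q a m * low k q b n * t i).natDegree = m + n + (t i).natDegree ∧
        upp k q a m * low k q b n * t i ≠ 0 := by
    intro a b m n ha hb i
    have h1 := natDegree_upp ha m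
    have h2 := natDegree_low hb n
    have h3 : t i ≠ 0 := fun h => by
      have := ht0 i
      rw [h, coeff_zero] at this
      exact zero_ne_one this
    exact ⟨by rw [natDegree_mul (mul_ne_zero h1.2 h2.2) h3, natDegree_mul h1.2 h2.2, h1.1, h2.1],
      mul_ne_zero (mul_ne_zero h1.2 h2.2) h3⟩
  set f : ℕ → (params k q)[X] := fun i =>
    upp k q cZ (m i).toNat * low k q cW (-n i).toNat * t i * (p i).map φ with hf
  have hpN : ∀ i, N ≤ i → p i = 0 := fun i hi => by
    have h1 := hp i
    rw [hgN i hi] at h1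
    exact (mul_eq_zero.mp h1.symm).resolve_left (hne _ _ _ _ hcZ hcW i).2
  have hcoeff : ∀ i, (∑ i ∈ Finset.range N, monomial i (f i)).coeff i = f i := fun i => by
    rw [QPair.coeff_sum_monomial]
    split_ifs with h
    · rfl
    · simp only [hf, hpN i (by omega), Polynomial.map_zero, mul_zero]
  have hmap : ∀ r : (params k q)[X], s (S.evu r) = S.evu (r.map φ) := by
    intro r
    induction r using Polynomial.induction_on' with
    | add p r hp hr => rw [map_add, map_add, hp, hr, Polynomial.map_add, map_add]
    | monomial n a =>
      rw [Polynomial.map_monomial, ← C_mul_X_pow_eq_monomial, ← C_mul_X_pow_eq_monomial, map_mul,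
        map_mul, map_mul, map_pow, map_pow, S.evu_C, S.evu_C, S.evu_X, hι, hu]
  refine ⟨∑ i ∈ Finset.range N, monomial i (f i), fun i hi => ?_, fun i => ?_, fun i => ?_, ?_, ?_⟩
  · rw [hcoeff, hf]
    simp only [hpN i hi, Polynomial.map_zero, mul_zero]
  · rw [hcoeff, hf]
    -- By `hM` the old and the new divisor leave the same degree for the cofactor, so the bound on
    -- `p i` carries over.
    refine (coeff_mul_eq_zero_iff (hne _ _ _ _ hcZ hcW i).2 M').mpr fun j hj => ?_
    rw [(hne _ _ _ _ hcZ hcW i).1, ← hM] at hj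
    have h1 := hgM i
    rw [hp i, coeff_mul_eq_zero_iff (hne _ _ _ _ hcZ hcW i).2, (hne _ _ _ _ hcZ hcW i).1] at h1
    rw [coeff_map, h1 j hj, map_zero]
  · rw [hcoeff]
    exact dvd_mul_right _ _
  · conv_lhs => rw [QPair.eq_sum_monomial hgN]
    rw [QPair.ev_sum, QPair.ev_sum, Finset.sum_mul, Finset.sum_mul, map_sum]
    refine Finset.sum_congr rfl fun i _ => ?_
    rw [QPair.ev_monomial, QPair.ev_monomial, mul_assoc, map_mul, hτ, hmap, hp i, hf, mul_assoc _ _ τ',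
      ← mul_assoc]
    congr 1
    -- The reflection exchanges the parameters of `Z` and `W`, which gives the divisor its shape in
    -- `gq_mul_evu`.
    have e1 : (upp k q cZ (n i).toNat * low k q cW (-m i).toNat * t i * p i).map φ =
        upp k q cW (n i).toNat * low k q cZ (-m i).toNat * (t i * (p i).map φ) := by
      simp only [Polynomial.map_mul, upp, low, map_linProd, map_mul, map_inv₀, hq, hZW, hWZ, ht]
      ring
    change _ = S.evu (upp k q cZ (m i).toNat * low k q cW (-n i).toNat * t i * (p i).map φ)
    rw [e1, mul_assoc (_ * _) (t i), ← gq_mul_evu S hZ hW]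
    have hcomm : ∀ a b (c : params k q) z, Commute (qProd (pι k q c * S.u) a b) (S.evu z) := by
      intro a b c z
      refine qProd_commute ?_ _ _
      rw [← S.evu_X, ← S.evu_C, ← map_mul, Commute, SemiconjBy, ← map_mul, ← map_mul, mul_comm]
    have hcomm' : ∀ a (c : params k q) z, Commute (gq (pι k q c * S.u) a) (S.evu z) := fun a c z =>
      (hcomm _ _ _ _).mul_left (hcomm _ _ _ _).inv_left₀
    exact ((hcomm' _ _ _).inv_left₀.mul_left (hcomm' _ _ _)).eq.symm
  · rw [hcoeff, hp 0, hf]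
    -- Every divisor has constant term `1`, so the constant term is the one of the cofactor.
    have h0 : ∀ (c : params k q) (n : ℕ), (upp k q c n).coeff 0 = 1 ∧ (low k q c n).coeff 0 = 1 :=
      fun c n => ⟨linProd_coeff_zero _ _ _, linProd_coeff_zero _ _ _⟩
    simp only [mul_coeff_zero, (h0 _ _).1, (h0 _ _).2, ht0, one_mul, coeff_map]

/-! ### The action of the reflections on the parameters -/

theorem ePow_mem_params (l : Pic) : (ePow l : SkewField k q) ∈ params k q := by
  refine mul_mem (mul_mem (zpow_mem (X_h_mem_params _) _) (zpow_mem (X_h_mem_params _) _)) ?_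
  refine list_prod_mem fun z hz => ?_
  obtain ⟨i, rfl⟩ := (List.mem_ofFn' _ _).mp hz
  exact zpow_mem (X_e_mem_params _) _

theorem IsHE.exists_heExp {a : Expo} (ha : IsHE a) : ∃ l, heExp l = a := by
  obtain ⟨h1, h2, h3, h4⟩ := ha
  refine ⟨⟨fun i => a (.h i), fun i => -a (.e i)⟩, ?_⟩
  rw [Expo.ext_iff']
  exact ⟨fun i => rfl, fun i => neg_neg _, h1.symm, h2.symm, fun i => (h3 i).symm,
    fun i => (h4 i).symm⟩

theorem sRefl_mem_params (i : Fin 9) {z : SkewField k q} (hz : z ∈ params k q) :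
    sRefl k q i z ∈ params k q := by
  induction hz using Subfield.closure_induction with
  | mem z hz =>
    obtain ⟨a, c, ha, rfl⟩ := exists_numA_of_mem_generators hz
    obtain ⟨l, rfl⟩ := ha.exists_heExp
    rw [← ePow_eq_mono, map_smul, sRefl_ePow, Algebra.smul_def]
    exact mul_mem (algebraMap_mem_params c) (ePow_mem_params _)
  | one => rw [map_one]; exact one_mem _
  | add z w _ _ hz hw => rw [map_add]; exact add_mem hz hw
  | neg z _ hz => rw [map_neg]; exact neg_mem hz
  | inv z _ hz => rw [map_inv₀]; exact inv_mem hz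
  | mul z w _ _ hz hw => rw [map_mul]; exact mul_mem hz hw

variable (k q) in
/-- The action of the simple reflections on the field of parameters. -/
def paramsRefl (i : Fin 9) : params k q →+* params k q :=
  (sRefl k q i : SkewField k q →+* SkewField k q).restrict (params k q) (params k q)
    fun _ hz => sRefl_mem_params i hz

theorem pι_paramsRefl (i : Fin 9) (a : params k q) :
    sRefl k q i (pι k q a) = pι k q (paramsRefl k q i a) := rfl

theorem paramsRefl_pq (i : Fin 9) : paramsRefl k q i (pq k q) = pq k q :=
  Subtype.ext ((sRefl k q i).commutes _)

theorem paramsRefl_pe {i : Fin 9} (h0 : i ≠ 0) (h3 : i ≠ 3) (j : Fin 11) :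
    paramsRefl k q i (pe k q j) = pe k q (Equiv.swap (swapIdx i).1 (swapIdx i).2 j) :=
  Subtype.ext (sRefl_X h0 h3 (.e j))

theorem paramsRefl_ph {i : Fin 9} (h0 : i ≠ 0) (h3 : i ≠ 3) (j : Fin 2) :
    paramsRefl k q i (ph k q j) = ph k q j :=
  Subtype.ext (sRefl_X h0 h3 (.h j))

theorem paramsRefl_zero_pe_nine : paramsRefl k q 0 (pe k q 9) = ph k q 1 / pe k q 10 :=
  Subtype.ext (sRefl_zero_X (.e 9))

theorem paramsRefl_zero_pe_ten : paramsRefl k q 0 (pe k q 10) = ph k q 1 / pe k q 9 :=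
  Subtype.ext (sRefl_zero_X (.e 10))

theorem paramsRefl_zero_ph_zero :
    paramsRefl k q 0 (ph k q 0) = ph k q 0 * ph k q 1 / (pe k q 9 * pe k q 10) :=
  Subtype.ext (sRefl_zero_X (.h 0))

theorem paramsRefl_zero_ph_one : paramsRefl k q 0 (ph k q 1) = ph k q 1 :=
  Subtype.ext (sRefl_zero_X (.h 1))

theorem paramsRefl_zero_pe {j : Fin 11} (h9 : j ≠ 9) (h10 : j ≠ 10) :
    paramsRefl k q 0 (pe k q j) = pe k q j := by
  refine Subtype.ext ((sRefl_zero_X (.e j)).trans ?_)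
  fin_cases j <;> first | rfl | contradiction

theorem paramsRefl_three_pe_zero : paramsRefl k q 3 (pe k q 0) = ph k q 0 / pe k q 6 :=
  Subtype.ext (sRefl_three_X (.e 0))

theorem paramsRefl_three_pe_six : paramsRefl k q 3 (pe k q 6) = ph k q 0 / pe k q 0 :=
  Subtype.ext (sRefl_three_X (.e 6))

theorem paramsRefl_three_ph_one :
    paramsRefl k q 3 (ph k q 1) = ph k q 0 * ph k q 1 / (pe k q 0 * pe k q 6) :=
  Subtype.ext (sRefl_three_X (.h 1))

theorem paramsRefl_three_ph_zero : paramsRefl k q 3 (ph k q 0) = ph k q 0 :=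
  Subtype.ext (sRefl_three_X (.h 0))

theorem paramsRefl_three_pe {j : Fin 11} (h0 : j ≠ 0) (h6 : j ≠ 6) :
    paramsRefl k q 3 (pe k q j) = pe k q j := by
  refine Subtype.ext ((sRefl_three_X (.e j)).trans ?_)
  fin_cases j <;> first | rfl | contradiction

/-! ### Units at the points of the coordinate axes -/

theorem evv_linear (S : QPair (pι k q)) (c : params k q) (n : ℤ) :
    S.evv (1 + C (pq k q ^ n * c) * Polynomial.X) =
      1 + ((q ^ n : kˣ) : k) • (pι k q c * S.v) := by
  rw [map_add, map_one, map_mul, S.evv_C, S.evv_X, map_mul, mul_assoc, pι_pq_zpow_mul]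

theorem regUnit_qProd (S : QPair (pι k q)) (c : params k q) (a b : ℤ) :
    S.RegUnit (qProd (pι k q c * S.v) a b) := by
  rw [qProd]
  generalize List.range _ = L
  induction L with
  | nil => exact ⟨1, 1, by simp, by simp, by simp⟩
  | cons j L ih =>
    rw [List.map_cons, List.prod_cons, ← evv_linear]
    exact (QPair.regUnit_evv (by simp)).mul ih

theorem regUnit_gq (S : QPair (pι k q)) (c : params k q) (n : ℤ) :
    S.RegUnit (gq (pι k q c * S.v) n) :=
  (regUnit_qProd S c _ _).mul (regUnit_qProd S c _ _).inv

/-- Divided by `v`, a factor `1 + q^t c v` becomes `v⁻¹ + q^t c`, whose value at `v⁻¹ = 0` is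
nonzero. -/
theorem regUnit_qProd_mul_pow (T : QPair (pι k q)) {c : params k q} (hc : c ≠ 0) {v : SkewField k q}
    (hv : T.v = v⁻¹) (hv0 : v ≠ 0) (a b : ℤ) :
    T.RegUnit (qProd (pι k q c * v) a b * (v ^ (b - a).toNat)⁻¹) := by
  rw [qProd]
  generalize (b - a).toNat = n
  induction n with
  | zero => exact ⟨1, 1, by simp, by simp, by simp⟩
  | succ n ih =>
    rw [List.range_succ, List.map_append, List.prod_append, List.map_singleton, List.prod_singleton,
      pow_succ', mul_inv_rev]
    have h1 : (1 + ((q ^ (a + n) : kˣ) : k) • (pι k q c * v)) * v⁻¹ =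
        T.evv (Polynomial.X + C (pq k q ^ (a + n) * c)) := by
      rw [map_add, T.evv_X, T.evv_C, add_mul, one_mul, smul_mul_assoc, mul_assoc,
        mul_inv_cancel₀ hv0, mul_one, map_mul, pι_pq_zpow_mul, hv]
    have h2 : Commute (T.evv (Polynomial.X + C (pq k q ^ (a + n) * c))) (v ^ n)⁻¹ := by
      rw [← inv_pow, ← hv]
      exact (T.evv_commute_v _).pow_right n
    have h3 : Commute v⁻¹ (v ^ n)⁻¹ := by
      have : Commute v (v ^ n) := (Commute.refl v).pow_right n
      exact this.inv_left₀.inv_right₀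
    rw [← h3.eq, mul_assoc, ← mul_assoc _ v⁻¹, h1, h2.eq, ← mul_assoc]
    refine ih.mul (QPair.regUnit_evv ?_)
    rw [coeff_add, coeff_X_zero, coeff_C_zero, zero_add]
    exact mul_ne_zero (zpow_ne_zero _ pq_ne_zero) hc

/-- `gq (c v) n` grows like `v^n` at infinity, for either sign of `n`. -/
theorem regUnit_gq_mul_zpow (T : QPair (pι k q)) {c : params k q} (hc : c ≠ 0) {v : SkewField k q}
    (hv : T.v = v⁻¹) (hv0 : v ≠ 0) (hcv : Commute (pι k q c) v) (n : ℤ) :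
    T.RegUnit (gq (pι k q c * v) n * v ^ (-n)) := by
  have hcomm : ∀ a b, Commute (qProd (pι k q c * v) a b) v := fun a b =>
    qProd_commute (hcv.mul_left (Commute.refl v)) a b
  rcases le_total 0 n with hn | hn
  · have := regUnit_qProd_mul_pow T hc hv hv0 0 n
    rwa [sub_zero, ← zpow_natCast, Int.toNat_of_nonneg hn, ← zpow_neg, ← gq_of_nonneg _ hn] at this
  · have := (regUnit_qProd_mul_pow T hc hv hv0 n 0).inv
    rw [← zpow_natCast, Int.toNat_of_nonneg (by omega), zero_sub, mul_inv_rev, inv_inv] at this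
    rwa [gq_of_nonpos _ hn, ((hcomm n 0).inv_left₀.zpow_right₀ (-n)).eq]

/-! ### Coprimality of divisors -/

theorem isCoprime_linear {P : Type*} [Field P] {a b : P} (h : a ≠ b) :
    IsCoprime (1 + C a * Polynomial.X : P[X]) (1 + C b * Polynomial.X) := by
  refine ⟨C (b * (b - a)⁻¹), C (-a * (b - a)⁻¹), ?_⟩
  have h1 : (b - a) * (b - a)⁻¹ = 1 := mul_inv_cancel₀ (sub_ne_zero.mpr h.symm)
  have h2 : C b * C (b - a)⁻¹ - C a * C (b - a)⁻¹ = (1 : P[X]) := by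
    rw [← C_mul, ← C_mul, ← C_sub, ← sub_mul, h1, C_1]
  simp only [C_mul, C_neg]
  linear_combination h2

theorem isCoprime_linProd {P : Type*} [Field P] {ρ σ a b : P}
    (h : ∀ s t : ℕ, (ρ ^ (s + 1))⁻¹ * a ≠ (σ ^ (t + 1))⁻¹ * b) (m n : ℕ) :
    IsCoprime (linProd ρ a m) (linProd σ b n) :=
  IsCoprime.prod_left fun s _ => IsCoprime.prod_right fun t _ => isCoprime_linear (h s t)

theorem isCoprime_fam {P : Type*} [Field P] {ρ σ : P} {L L' : List (P × ℕ)}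
    (h : ∀ x ∈ L, ∀ y ∈ L', ∀ s t : ℕ, (ρ ^ (s + 1))⁻¹ * x.1 ≠ (σ ^ (t + 1))⁻¹ * y.1) (i j : ℕ) :
    IsCoprime (fam ρ L i) (fam σ L' j) := by
  have haux : ∀ (M : List P[X]) (r : P[X]), (∀ p ∈ M, IsCoprime p r) → IsCoprime M.prod r := by
    intro M r hM
    induction M with
    | nil => exact isCoprime_one_left
    | cons p M ih =>
      rw [List.prod_cons]
      exact (hM p List.mem_cons_self).mul_left (ih fun p hp => hM p (List.mem_cons_of_mem _ hp))
  refine haux _ _ fun p hp => (haux _ _ fun r hr => ?_).symm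
  obtain ⟨x, hx, rfl⟩ := List.mem_map.mp hp
  obtain ⟨y, hy, rfl⟩ := List.mem_map.mp hr
  exact (isCoprime_linProd (h x hx y hy) _ _).symm

theorem smul_mono_ne {a b : Expo} (h : a ≠ b) (c : k) : c • (mono a : SkewField k q) ≠ mono b := by
  intro h1
  rw [← numA_term] at h1
  have h2 := congrArg (fun f => Torus.coeff f b) (numA_injective h1)
  simp only [Torus.coeff_term, if_neg h] at h2
  exact zero_ne_one h2

/-- Distinct monomials are independent over `k`, which contains `q`. Hence q-strings based at
distinct monomials never meet, even if `q` is a root of unity. -/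
theorem pq_zpow_mul_ne {c d : params k q} {a b : Expo} (hc : pι k q c = mono a)
    (hd : pι k q d = mono b) (h : a ≠ b) (m n : ℤ) : pq k q ^ m * c ≠ pq k q ^ n * d := by
  intro h1
  have h2 : pq k q ^ (m - n) * c = d := by
    rw [zpow_sub₀ pq_ne_zero, div_mul_eq_mul_div, h1, mul_div_cancel_left₀ _ (zpow_ne_zero _ pq_ne_zero)]
  have h3 := congrArg (pι k q) h2
  rw [map_mul, pι_pq_zpow_mul, hc, hd] at h3
  exact smul_mono_ne h _ h3

/-! ### The transformation of both conditions -/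

/-- `F` is a polynomial in `u`, `v` with constant term `c`. -/
def QPair.HasConst {P K : Type*} [Field P] [DivisionRing K] {ι : P →+* K} (S : QPair ι) (F : K)
    (c : P) : Prop :=
  ∃ g : P[X][X], S.ev g = F ∧ (g.coeff 0).coeff 0 = c

theorem QPair.HasConst.swap {P K : Type*} [Field P] [DivisionRing K] {ι : P →+* K} {S T : QPair ι}
    (hu : T.u = S.v) (hv : T.v = S.u) {F : K} {c : P} (h : S.HasConst F c) : T.HasConst F c := by
  obtain ⟨g, rfl, rfl⟩ := h
  obtain ⟨h, h1, h2⟩ := exists_ev_eq hu hv g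
  exact ⟨h, h1, by rw [h2, mul_zero, pow_zero, mul_one]⟩

/-- The common argument for `s_0` and `s_3`. The pair `S` is ordered so that the reflection fixes
`u`, and its condition is transported by `exists_form_of_reflection`. The pairs `T` and `T'` have
the fixed variable, respectively its inverse, as `v`; the other condition is transported there by
`dvd_coeff_of_subst`. The polynomial found from `S` is rewritten in the order of `T`, so nothing
about polynomiality remains to be shown. -/
theorem exists_form_step (r : Fin 9) {S T T' : QPair (pι k q)} (hTu : T.u = S.v) (hTv : T.v = S.u)
    (hTu' : T'.u = T.u) (hTv' : T'.v = T.v⁻¹) (hv0 : S.u ≠ 0) (hu : sRefl k q r S.u = S.u)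
    {cZ cW : params k q} (hZW : paramsRefl k q r cZ = cW) (hWZ : paramsRefl k q r cW = cZ)
    (hZ : QRegular (pι k q cZ * S.u)) (hW : QRegular (pι k q cW * S.u)) (hcZ : cZ ≠ 0)
    (hcW : cW ≠ 0) (m n : ℕ → ℤ) (t : ℕ → (params k q)[X])
    (ht : ∀ i, (t i).map (paramsRefl k q r) = t i) (ht0 : ∀ i, (t i).coeff 0 = 1)
    {τ τ' : SkewField k q} (hτ0 : τ' ≠ 0) (hτ : ∀ i, sRefl k q r (S.v ^ i * τ) =
      (gq (pι k q cW * S.u) (n i))⁻¹ * gq (pι k q cZ * S.u) (m i) * (S.v ^ i * τ')) {N : ℕ}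
    {b b' : ℤ} (hb : ∀ i, b - b' = n i - m i) {α β α' β' : (params k q)[X]}
    (hs : T.IsSubst (sRefl k q r : SkewField k q →+* SkewField k q) (paramsRefl k q r) α β)
    (hs' : T'.IsSubst (sRefl k q r : SkewField k q →+* SkewField k q) (paramsRefl k q r) α' β')
    {L L' : List (params k q × ℕ)}
    (hL : ∀ x ∈ L, paramsRefl k q r x.1 * β.coeff 0 = x.1 * α.coeff 0)
    (hL' : ∀ x ∈ L', paramsRefl k q r x.1 * β'.coeff 0 = x.1 * α'.coeff 0)
    (hcop : ∀ i j, IsCoprime (fam T.ρ L i) (fam T'.ρ L' j)) {D D' A A' : ℕ → (params k q)[X]}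
    (hD : ∀ i, D i = upp k q cZ (n i).toNat * low k q cW (-m i).toNat * t i)
    (hD' : ∀ i, D' i = upp k q cZ (m i).toNat * low k q cW (-n i).toNat * t i)
    (hA : ∀ i : ℕ, i ≤ b → A i = fam T.ρ L i * fam T'.ρ L' (b - i).toNat)
    (hA' : ∀ i : ℕ, i ≤ b' → A' i = fam T.ρ L i * fam T'.ρ L' (b' - i).toNat)
    {F : SkewField k q} (hF : S.Form N (b + 1).toNat D F) (hF' : T.Form (b + 1).toNat N A F) :
    ∃ F', sRefl k q r (F * τ) = F' * τ' ∧ S.Form N (b' + 1).toNat D' F' ∧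
      T.Form (b' + 1).toNat N A' F' ∧ ∀ c, S.HasConst F c → S.HasConst F' (paramsRefl k q r c) := by
  obtain ⟨g, hgN, hgM, hgD, rfl⟩ := hF
  obtain ⟨g', h1, h2, h3, h4, h5⟩ := exists_form_of_reflection S
    (sRefl k q r : SkewField k q →ₐ[k] SkewField k q) (paramsRefl k q r) (fun a => rfl) hu hZW hWZ
    hZ hW hcZ hcW m n t ht ht0 hτ (M := (b + 1).toNat) (M' := (b' + 1).toNat)
    (fun i => by have := hb i; omega) hgN hgM fun i => by rw [← hD]; exact hgD i
  refine ⟨S.ev g', h4, ⟨g', h1, h2, fun i => by rw [hD']; exact h3 i, rfl⟩, ?_, ?_⟩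
  · obtain ⟨f, hfN, hfM, hfA, hf⟩ := hF'
    obtain ⟨h, hh, hhc⟩ := QPair.exists_ev_eq hTu hTv g'
    have hhN : ∀ i, (b' + 1).toNat ≤ i → h.coeff i = 0 := fun i hi => Polynomial.ext fun j => by
      rw [hhc, h2 j i hi, zero_mul, coeff_zero]
    refine ⟨h, hhN, fun i j hj => by rw [hhc, h1 j hj, coeff_zero, zero_mul], ?_, hh⟩
    have hcomm : ∀ c : params k q, Commute (pι k q c * T.v) T.v := fun c =>
      (T.comm_v c).mul_left (Commute.refl _)
    have hw : T.RegUnit ((gq (pι k q cW * T.v) (n 0))⁻¹ * gq (pι k q cZ * T.v) (m 0)) :=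
      (regUnit_gq T cW _).inv.mul (regUnit_gq T cZ _)
    have hv0' : T.v ≠ 0 := by rwa [hTv]
    -- At infinity the factor grows like `v^(m 0 - n 0)`, and `m 0 - n 0 = b' - b` by `hb`; the
    -- power `v^(b - b')` compensates it.
    have hw' : T'.RegUnit ((gq (pι k q cW * T.v) (n 0))⁻¹ * gq (pι k q cZ * T.v) (m 0) *
        T.v ^ (b - b')) := by
      have e1 := (regUnit_gq_mul_zpow T' hcW hTv' hv0' (T.comm_v cW) (n 0)).inv.mul
        (regUnit_gq_mul_zpow T' hcZ hTv' hv0' (T.comm_v cZ) (m 0))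
      rw [mul_inv_rev, ← zpow_neg, neg_neg] at e1
      convert e1 using 1
      rw [hb 0, sub_eq_add_neg, zpow_add₀ hv0',
        ((gq_commute (hcomm cW) (n 0)).inv_left₀.zpow_right₀ (n 0)).eq.symm]
      simp only [mul_assoc]
      congr 1
      rw [← mul_assoc, ((gq_commute (hcomm cZ) (m 0)).zpow_right₀ (n 0)).eq, mul_assoc]
    -- The case `i = 0` of `hτ` is the image of `τ` itself, which yields `F' = s(F) w`.
    have heq : T.ev h = sRefl k q r (T.ev f) *
        ((gq (pι k q cW * T.v) (n 0))⁻¹ * gq (pι k q cZ * T.v) (m 0)) := by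
      refine mul_right_cancel₀ hτ0 ?_
      have e1 := hτ 0
      rw [pow_zero, one_mul, one_mul] at e1
      rw [hh, hf, mul_assoc, hTv, ← e1, ← map_mul]
      exact h4.symm
    have hfL : ∀ i, fam T.ρ L i ∣ f.coeff i := fun i => by
      rcases le_or_gt (i : ℤ) b with hi | hi
      · exact (Dvd.intro _ (hA i hi).symm).trans (hfA i)
      · rw [hfN i (by omega)]
        exact dvd_zero _
    obtain ⟨d1, d2⟩ := QPair.dvd_coeff_of_subst hTu' hTv' hv0' hs hs' hL hL' hw hw' hfN hhN
      hfL (fun i hi => (Dvd.intro_left _ (hA i hi).symm).trans (hfA i)) heq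
    intro i
    rcases le_or_gt (i : ℤ) b' with hi | hi
    · rw [hA' i hi]
      -- The divisors at `0` and `∞` were obtained separately; coprimality gives their product.
      exact (hcop _ _).mul_dvd (d1 i) (d2 i hi)
    · rw [hhN i (by omega)]
      exact dvd_zero _
  · rintro c ⟨f, hf, rfl⟩
    rw [S.ev_injective hf]
    exact ⟨g', rfl, h5⟩

theorem mono_nsmul_mul_tauPow (v : QVar) (hv : form (δ v) (δ v) = 0) (l : Pic)
    (hv' : form (δ v) (tauExp l) = 0) (i : ℕ) :
    (mono (δ v) ^ i * tauPow l : SkewField k q) = mono (i • δ v + tauExp l) := by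
  rw [mono_pow hv, tauPow_eq_mono, mono_mul_mono_of_form_eq_zero]
  rw [form_nsmul_left, hv', mul_zero]

/-- The order at `x = ∞` of the `i`-th term is `d₁ - i`, a natural number only in the range of `hi`.
A negative multiplicity imposes nothing and may be replaced by `0`. -/
theorem divX_eq_fam (l : Pic) (i : ℕ) (hi : (i : ℤ) ≤ l.d 0) :
    divX k q l i = fam (pq k q ^ (-1 : ℤ)) [((pq k q)⁻¹ * pe k q 10, (l.m 10).toNat)] i *
      fam (pq k q ^ (1 : ℤ)) [(ph k q 1 / pe k q 9, (l.m 9).toNat)] (l.d 0 - i).toNat := by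
  rw [divX, fam, fam, zpow_neg_one, zpow_one]
  simp only [List.map_cons, List.map_nil, List.prod_cons, List.prod_nil, mul_one]
  rw [upp, low, show (l.m 10).toNat - i = (l.m 10 - i).toNat by omega,
    show (l.m 9).toNat - (l.d 0 - i).toNat = (l.m 9 - (l.d 0 - i)).toNat by omega]

theorem divY_eq_fam (l : Pic) (i : ℕ) (hi : (i : ℤ) ≤ l.d 1) :
    divY₀ k q l i * divY₁ k q l i =
      fam (pq k q ^ (1 : ℤ))
        (([0, 1, 2, 3, 4, 5] : List (Fin 11)).map fun j => ((pe k q j)⁻¹, (l.m j).toNat)) i *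
      fam (pq k q ^ (-1 : ℤ)) (([6, 7, 8] : List (Fin 11)).map fun j =>
        ((pq k q)⁻¹ * (pe k q j / ph k q 0), (l.m j).toNat)) (l.d 1 - i).toNat := by
  rw [divY₀, divY₁, fam, fam, zpow_neg_one, zpow_one, List.map_map, List.map_map]
  have h1 : ∀ j, (l.m j).toNat - i = (l.m j - i).toNat := fun j => by omega
  have h2 : ∀ j, (l.m j).toNat - (l.d 1 - i).toNat = (l.m j - (l.d 1 - i)).toNat := fun j => by omega
  congr 1
  · congr 1
    refine List.map_congr_left fun j _ => ?_
    rw [Function.comp_apply, h1, low]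
  · congr 1
    refine List.map_congr_left fun j _ => ?_
    rw [Function.comp_apply, h2, upp]

theorem pι_pe_inv (j : Fin 11) : pι k q (pe k q j)⁻¹ = mono (-δ (.e j)) := by
  rw [map_inv₀, ← mono_inv (by simp [form])]; rfl

theorem pι_pe_div_ph (j : Fin 11) :
    pι k q (pe k q j / ph k q 0) = mono (δ (.e j) - δ (.h 0)) := by
  rw [map_div₀, ← mono_div_mono (by simp [form])]; rfl

theorem pι_ph_div_pe : pι k q (ph k q 1 / pe k q 9) = mono (δ (.h 1) - δ (.e 9)) := by
  rw [map_div₀, ← mono_div_mono (by simp [form])]; rfl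

theorem isCoprime_fam_divY (l : Pic) (i j : ℕ) : IsCoprime
    (fam (pq k q ^ (1 : ℤ))
      (([0, 1, 2, 3, 4, 5] : List (Fin 11)).map fun j => ((pe k q j)⁻¹, (l.m j).toNat)) i)
    (fam (pq k q ^ (-1 : ℤ)) (([6, 7, 8] : List (Fin 11)).map fun j =>
        ((pq k q)⁻¹ * (pe k q j / ph k q 0), (l.m j).toNat)) j) := by
  refine isCoprime_fam (fun x hx y hy s t => ?_) i j
  obtain ⟨a, _, rfl⟩ := List.mem_map.mp hx
  obtain ⟨b, _, rfl⟩ := List.mem_map.mp hy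
  have h := pq_zpow_mul_ne (pι_pe_inv (k := k) (q := q) a) (pι_pe_div_ph b) (fun h => by
    have := congrFun h (.h 0)
    simp at this) (-(s + 1)) t
  simp only [zpow_one, zpow_neg_one]
  convert h using 1
  · rw [← zpow_natCast, ← zpow_neg]; push_cast; rfl
  · rw [inv_pow, inv_inv, pow_succ, mul_assoc, mul_inv_cancel_left₀ pq_ne_zero, zpow_natCast]

theorem isCoprime_fam_divX (l : Pic) (i j : ℕ) : IsCoprime
    (fam (pq k q ^ (-1 : ℤ)) [((pq k q)⁻¹ * pe k q 10, (l.m 10).toNat)] i)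
    (fam (pq k q ^ (1 : ℤ)) [(ph k q 1 / pe k q 9, (l.m 9).toNat)] j) := by
  refine isCoprime_fam (fun x hx y hy s t => ?_) i j
  rw [List.mem_singleton] at hx hy
  subst hx hy
  have h := pq_zpow_mul_ne (a := δ (.e 10)) rfl (pι_ph_div_pe (k := k) (q := q)) (by decide) s
    (-(t + 1)) (c := pe k q 10)
  simp only [zpow_one, zpow_neg_one]
  convert h using 1
  · rw [inv_pow, inv_inv, pow_succ, mul_assoc, mul_inv_cancel_left₀ pq_ne_zero, zpow_natCast]
  · rw [← zpow_natCast, ← zpow_neg]; push_cast; rfl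

/-! ### The steps of the induction -/

theorem evv_one_add (S : QPair (pι k q)) (c : params k q) :
    S.evv (1 + C c * Polynomial.X) = 1 + pι k q c * S.v := by
  rw [map_add, map_one, map_mul, S.evv_C, S.evv_X]

theorem evv_X_add (S : QPair (pι k q)) (c : params k q) :
    S.evv (Polynomial.X + C c) = S.v + pι k q c := by
  rw [map_add, S.evv_C, S.evv_X]

theorem one_add_coeff_zero {P : Type*} [Field P] (c : P) :
    (1 + C c * Polynomial.X : P[X]).coeff 0 = 1 := by simp

theorem X_add_coeff_zero {P : Type*} [Field P] (c : P) :
    (Polynomial.X + C c : P[X]).coeff 0 = c := by simp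

theorem sRefl_zero_mono_mul_tauPow (l : Pic) (i : ℕ) :
    sRefl k q 0 (mono (δ .x) ^ i * tauPow l) =
      (gq (mono expoW₀) (l.m 10 - i))⁻¹ * gq (mono expoZ₀) (l.d 0 - l.m 9 - i) *
        (mono (δ .x) ^ i * tauPow (sStar 0 l)) := by
  have h1 : ∀ l, form (δ .x) (tauExp l) = 0 := fun l => by simp [form, tauExp]
  have h2 : expoFun₀ (i • δ .x + tauExp l) = i • δ .x + tauExp (sStar 0 l) := by
    rw [expoFun₀_add, expoFun₀_tauExp]
    congr 1
    rw [Expo.ext_iff']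
    refine ⟨fun j => ?_, fun j => ?_, rfl, rfl, fun j => ?_, fun j => ?_⟩ <;> fin_cases j <;>
      simp [expoFun₀]
  rw [mono_nsmul_mul_tauPow _ (by decide) l (h1 l), mono_nsmul_mul_tauPow _ (by decide) _ (h1 _)]
  exact sRefl_zero_of_kap h2 (by simp [tauExp, sStar]; ring) (by simp [tauExp, sStar]; ring)

theorem sRefl_three_mono_mul_tauPow (l : Pic) (i : ℕ) :
    sRefl k q 3 (mono (δ .y) ^ i * tauPow l) =
      (gq (mono expoW₃) (i - l.d 1 + l.m 6))⁻¹ * gq (mono expoZ₃) (i - l.m 0) *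
        (mono (δ .y) ^ i * tauPow (sStar 3 l)) := by
  have h1 : ∀ l, form (δ .y) (tauExp l) = 0 := fun l => by simp [form, tauExp]
  have h2 : expoFun₃ (i • δ .y + tauExp l) = i • δ .y + tauExp (sStar 3 l) := by
    rw [expoFun₃_add, expoFun₃_tauExp]
    congr 1
    rw [Expo.ext_iff']
    refine ⟨fun j => ?_, fun j => ?_, rfl, rfl, fun j => ?_, fun j => ?_⟩ <;> fin_cases j <;>
      simp [expoFun₃]
  rw [mono_nsmul_mul_tauPow _ (by decide) l (h1 l), mono_nsmul_mul_tauPow _ (by decide) _ (h1 _)]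
  exact sRefl_three_of_kap h2 (by simp [tauExp, sStar]) (by simp [tauExp, sStar]; ring)

theorem pι_mul_expoZ₀ : pι k q (pe k q 10) * mono (δ .y) = mono expoZ₀ := mono_expoZ₀.symm

theorem pι_mul_expoW₀ : pι k q (ph k q 1 / pe k q 9) * mono (δ .y) = mono expoW₀ := by
  rw [map_div₀]; exact mono_expoW₀.symm

theorem pι_mul_expoZ₃ : pι k q (pe k q 6 / ph k q 0) * mono (δ .x) = mono expoZ₃ := by
  rw [map_div₀]; exact mono_expoZ₃.symm

theorem pι_mul_expoW₃ : pι k q (pe k q 0)⁻¹ * mono (δ .x) = mono expoW₃ := by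
  rw [map_inv₀, ← one_div]; exact mono_expoW₃.symm

theorem mono_neg_δ_y : (mono (-δ .y) : SkewField k q) = (mono (δ .y))⁻¹ :=
  (mono_inv (by decide)).symm

theorem mono_neg_δ_x : (mono (-δ .x) : SkewField k q) = (mono (δ .x))⁻¹ :=
  (mono_inv (by decide)).symm

theorem add_mul_inv_of_ne_zero {K : Type*} [DivisionRing K] {v : K} (hv : v ≠ 0) (c : K) :
    v⁻¹ + c = (1 + c * v) * v⁻¹ := by
  rw [add_mul, one_mul, mul_assoc, mul_inv_cancel₀ hv, mul_one]

theorem one_add_mono_mul_inv {a b : Expo} (v : SkewField k q) (hv : v ≠ 0) :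
    ((1 + mono a) * v⁻¹) * ((1 + mono b) * v⁻¹)⁻¹ = (1 + mono a) * (1 + mono b)⁻¹ := by
  rw [mul_inv_rev, inv_inv, mul_assoc, inv_mul_cancel_left₀ hv]

theorem sRefl_zero_y : sRefl k q 0 (mono (δ .y)) = mono (δ .y) := sRefl_zero_X .y

theorem sRefl_three_x : sRefl k q 3 (mono (δ .x)) = mono (δ .x) := sRefl_three_X .x

theorem sRefl_zero_x : sRefl k q 0 (mono (δ .x)) =
    mono (δ .x) * ((1 + mono expoW₀) * (1 + mono expoZ₀)⁻¹) := by
  refine (sRefl_zero_X .x).trans ?_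
  rw [reflect₀, X_y_mul_e, X_y_mul_h_div_e, div_eq_mul_inv]; rfl

theorem sRefl_three_y : sRefl k q 3 (mono (δ .y)) =
    ((1 + mono expoZ₃) * (1 + mono expoW₃)⁻¹) * mono (δ .y) := by
  refine (sRefl_three_X .y).trans ?_
  rw [reflect₃, X_x_mul_e_div_h, X_x_div_e, div_eq_mul_inv]; rfl

theorem isSubst_zero : (pairXY k q).IsSubst (sRefl k q 0 : SkewField k q →+* SkewField k q)
    (paramsRefl k q 0) (1 + C (pe k q 10) * Polynomial.X)
    (1 + C (ph k q 1 / pe k q 9) * Polynomial.X) where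
  map_ι _ := rfl
  map_ρ := by
    change paramsRefl k q 0 (pq k q ^ (1 : ℤ)) = _
    rw [map_zpow₀, paramsRefl_pq]; rfl
  map_v := sRefl_zero_y
  map_u := by
    rw [evv_one_add, evv_one_add]
    change sRefl k q 0 (mono (δ .x)) = mono (δ .x) * (1 + pι k q _ * mono (δ .y)) *
      (1 + pι k q _ * mono (δ .y))⁻¹
    rw [pι_mul_expoZ₀, pι_mul_expoW₀, sRefl_zero_x, mul_assoc]
  coeff_ne_zero := by rw [one_add_coeff_zero]; exact one_ne_zero

/-- In the coordinate `y⁻¹` each `1 + c y` is `(y⁻¹ + c) y`, and the factors `y` cancel in the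
quotient. -/
theorem isSubst_zero' : (pairXY' k q).IsSubst (sRefl k q 0 : SkewField k q →+* SkewField k q)
    (paramsRefl k q 0) (Polynomial.X + C (pe k q 10))
    (Polynomial.X + C (ph k q 1 / pe k q 9)) where
  map_ι _ := rfl
  map_ρ := by
    change paramsRefl k q 0 (pq k q ^ (-1 : ℤ)) = _
    rw [map_zpow₀, paramsRefl_pq]; rfl
  map_v := by
    change sRefl k q 0 (mono (-δ .y)) = mono (-δ .y)
    rw [mono_neg_δ_y, map_inv₀, sRefl_zero_y]
  map_u := by
    rw [evv_X_add, evv_X_add]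
    change sRefl k q 0 (mono (δ .x)) = mono (δ .x) * (mono (-δ .y) + pι k q _) *
      (mono (-δ .y) + pι k q _)⁻¹
    rw [mono_neg_δ_y, add_mul_inv_of_ne_zero (mono_ne_zero _), add_mul_inv_of_ne_zero (mono_ne_zero _),
      pι_mul_expoZ₀, pι_mul_expoW₀, mul_assoc, one_add_mono_mul_inv _ (mono_ne_zero _), sRefl_zero_x]
  coeff_ne_zero := by rw [X_add_coeff_zero]; exact pe_ne_zero 10

theorem isSubst_three : (pairYX k q).IsSubst (sRefl k q 3 : SkewField k q →+* SkewField k q)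
    (paramsRefl k q 3) (scale (pairYX k q).ρ (1 + C (pe k q 0)⁻¹ * Polynomial.X))
    (scale (pairYX k q).ρ (1 + C (pe k q 6 / ph k q 0) * Polynomial.X)) := by
  refine QPair.isSubst_of_left (fun _ => rfl) ?_ sRefl_three_x ?_ ?_
  · change paramsRefl k q 3 (pq k q ^ (-1 : ℤ)) = _
    rw [map_zpow₀, paramsRefl_pq]; rfl
  · rw [evv_one_add, evv_one_add]
    change sRefl k q 3 (mono (δ .y)) = (1 + pι k q _ * mono (δ .x)) *
      (1 + pι k q _ * mono (δ .x))⁻¹ * mono (δ .y)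
    rw [pι_mul_expoZ₃, pι_mul_expoW₃, sRefl_three_y]
  · rw [one_add_coeff_zero]; exact one_ne_zero

theorem isSubst_three' : (pairYX' k q).IsSubst (sRefl k q 3 : SkewField k q →+* SkewField k q)
    (paramsRefl k q 3) (scale (pairYX' k q).ρ (Polynomial.X + C (pe k q 0)⁻¹))
    (scale (pairYX' k q).ρ (Polynomial.X + C (pe k q 6 / ph k q 0))) := by
  refine QPair.isSubst_of_left (fun _ => rfl) ?_ ?_ ?_ ?_
  · change paramsRefl k q 3 (pq k q ^ (1 : ℤ)) = _
    rw [map_zpow₀, paramsRefl_pq]; rfl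
  · change sRefl k q 3 (mono (-δ .x)) = mono (-δ .x)
    rw [mono_neg_δ_x, map_inv₀, sRefl_three_x]
  · rw [evv_X_add, evv_X_add]
    change sRefl k q 3 (mono (δ .y)) = (mono (-δ .x) + pι k q _) *
      (mono (-δ .x) + pι k q _)⁻¹ * mono (δ .y)
    rw [mono_neg_δ_x, add_mul_inv_of_ne_zero (mono_ne_zero _), add_mul_inv_of_ne_zero (mono_ne_zero _),
      pι_mul_expoZ₃, pι_mul_expoW₃, one_add_mono_mul_inv _ (mono_ne_zero _), sRefl_three_y]
  · rw [X_add_coeff_zero]; exact inv_ne_zero (pe_ne_zero 0)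

theorem tauPow_ne_zero (l : Pic) : (tauPow l : SkewField k q) ≠ 0 := by
  rw [tauPow_eq_mono]; exact mono_ne_zero _

/-- Here `(x)_λ` is transported term by term in powers of `x`, and `(y)_λ` locally at `y = 0` and `y
= ∞`. -/
theorem exists_isF_zero {l : Pic} {F : SkewField k q} (hF : IsF l F) :
    ∃ F', sRefl k q 0 (F * tauPow l) = F' * tauPow (sStar 0 l) ∧ IsF (sStar 0 l) F' ∧
      ∀ c, (pairXY k q).HasConst F c → (pairXY k q).HasConst F' (paramsRefl k q 0 c) := by
  have hcW : ph k q 1 / pe k q 9 ≠ 0 := div_ne_zero (ph_ne_zero 1) (pe_ne_zero 9)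
  have e0 := paramsRefl_zero_pe_nine (k := k) (q := q)
  have e1 := paramsRefl_zero_pe_ten (k := k) (q := q)
  have e2 := paramsRefl_zero_ph_zero (k := k) (q := q)
  have e3 := paramsRefl_zero_ph_one (k := k) (q := q)
  have h9 := pe_ne_zero (k := k) (q := q) 9
  have h10 := pe_ne_zero (k := k) (q := q) 10
  have hh0 := ph_ne_zero (k := k) (q := q) 0
  have hh1 := ph_ne_zero (k := k) (q := q) 1
  refine (exists_form_step 0 (S := pairYX k q) (T := pairXY k q)
    (T' := pairXY' k q) (D' := divX k q (sStar 0 l))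
    (A' := fun i => divY₀ k q (sStar 0 l) i * divY₁ k q (sStar 0 l) i) rfl rfl rfl mono_neg_δ_y
    (mono_ne_zero _) sRefl_zero_y (cZ := pe k q 10) (cW := ph k q 1 / pe k q 9) e1
    (by rw [map_div₀, e0, e3, div_div_cancel₀ hh1])
    (by
      change QRegular (pι k q _ * mono (δ .y))
      rw [pι_mul_expoZ₀]; exact qRegular_mono expoZ₀_ne_zero)
    (by
      change QRegular (pι k q _ * mono (δ .y))
      rw [pι_mul_expoW₀]; exact qRegular_mono expoW₀_ne_zero) h10 hcW
    (fun i => l.d 0 - l.m 9 - i) (fun i => l.m 10 - i) (fun _ => 1) (fun _ => Polynomial.map_one _)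
    (fun _ => by simp) (tauPow_ne_zero (sStar 0 l))
    (fun i => by
      change sRefl k q 0 (mono (δ .x) ^ i * tauPow l) = (gq (pι k q _ * mono (δ .y)) _)⁻¹ *
        gq (pι k q _ * mono (δ .y)) _ * (mono (δ .x) ^ i * _)
      rw [pι_mul_expoZ₀, pι_mul_expoW₀]
      exact sRefl_zero_mono_mul_tauPow l i)
    (b := l.d 1) (b' := (sStar 0 l).d 1) (fun i => by simp [sStar]; ring) isSubst_zero isSubst_zero'
    (fun x hx => ?_) (fun x hx => ?_) (isCoprime_fam_divY l) (fun i => ?_) (fun i => ?_)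
    (divY_eq_fam l) (divY_eq_fam (sStar 0 l)) ((condX_iff l F).mp hF.1) ((condY_iff l F).mp hF.2)).imp
    fun F' ⟨h1, h2, h3, h4⟩ => ⟨h1, ⟨(condX_iff _ _).mpr h2, (condY_iff _ _).mpr h3⟩,
      fun c hc => (h4 c (hc.swap rfl rfl)).swap rfl rfl⟩
  · obtain ⟨j, hj, rfl⟩ := List.mem_map.mp hx
    have h9 : j ≠ 9 := by rintro rfl; revert hj; decide
    have h10 : j ≠ 10 := by rintro rfl; revert hj; decide
    rw [one_add_coeff_zero, one_add_coeff_zero, map_inv₀, paramsRefl_zero_pe h9 h10]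
  -- At `y = ∞` the substitution multiplies `x` by `β'(0)/α'(0) = h₂/(e₁₀ e₁₁)`. The parameters
  -- `e_j/h₁` are divided by the same quantity, because `s_0` multiplies `h₁` by it.
  · obtain ⟨j, hj, rfl⟩ := List.mem_map.mp hx
    have h9' : j ≠ 9 := by rintro rfl; revert hj; decide
    have h10' : j ≠ 10 := by rintro rfl; revert hj; decide
    rw [X_add_coeff_zero, X_add_coeff_zero, map_mul, map_div₀, map_inv₀, paramsRefl_pq,
      paramsRefl_zero_pe h9' h10', e2]
    field_simp
  · rw [divX, mul_one, show l.m 9 - (l.d 0 - (i : ℤ)) = -(l.d 0 - l.m 9 - i) by ring]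
  · rw [divX, mul_one]
    congr 2
    simp [sStar]

/-- The roles of the variables are interchanged. The divisor of `(y)_λ` contains, besides the points
`e₁` and `e₇` that are exchanged, the factors of the remaining seven points, which `s_3` fixes;
these form the spectator `t`. -/
theorem exists_isF_three {l : Pic} {F : SkewField k q} (hF : IsF l F) :
    ∃ F', sRefl k q 3 (F * tauPow l) = F' * tauPow (sStar 3 l) ∧ IsF (sStar 3 l) F' ∧
      ∀ c, (pairXY k q).HasConst F c → (pairXY k q).HasConst F' (paramsRefl k q 3 c) := by
  have hcZ : pe k q 6 / ph k q 0 ≠ 0 := div_ne_zero (pe_ne_zero 6) (ph_ne_zero 0)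
  have e0 := paramsRefl_three_pe_zero (k := k) (q := q)
  have e1 := paramsRefl_three_pe_six (k := k) (q := q)
  have e2 := paramsRefl_three_ph_zero (k := k) (q := q)
  have e3 := paramsRefl_three_ph_one (k := k) (q := q)
  have h0 := pe_ne_zero (k := k) (q := q) 0
  have h6 := pe_ne_zero (k := k) (q := q) 6
  have h9 := pe_ne_zero (k := k) (q := q) 9
  have hh0 := ph_ne_zero (k := k) (q := q) 0
  have hh1 := ph_ne_zero (k := k) (q := q) 1
  have hfix : ∀ j : Fin 11, j ≠ 0 → j ≠ 6 → paramsRefl k q 3 (pe k q j) = pe k q j :=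
    fun j => paramsRefl_three_pe
  refine (exists_form_step 3 (S := pairXY k q) (T := pairYX k q)
    (T' := pairYX' k q) (D' := fun i => divY₀ k q (sStar 3 l) i * divY₁ k q (sStar 3 l) i)
    (A' := divX k q (sStar 3 l)) rfl rfl rfl mono_neg_δ_x
    (mono_ne_zero _) sRefl_three_x (cZ := pe k q 6 / ph k q 0) (cW := (pe k q 0)⁻¹)
    (by rw [map_div₀, e1, e2, div_div_cancel_left' hh0])
    (by rw [map_inv₀, e0, inv_div])
    (by
      change QRegular (pι k q _ * mono (δ .x))
      rw [pι_mul_expoZ₃]; exact qRegular_mono expoZ₃_ne_zero)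
    (by
      change QRegular (pι k q _ * mono (δ .x))
      rw [pι_mul_expoW₃]; exact qRegular_mono expoW₃_ne_zero) hcZ (inv_ne_zero h0)
    (fun i => i - l.m 0) (fun i => i - l.d 1 + l.m 6)
    (fun i => (([1, 2, 3, 4, 5] : List (Fin 11)).map fun j =>
      low k q (pe k q j)⁻¹ (l.m j - i).toNat).prod *
      (([7, 8] : List (Fin 11)).map fun j =>
        upp k q (pe k q j / ph k q 0) (l.m j - (l.d 1 - i)).toNat).prod)
    (fun i => ?_)
    (fun i => ?_) (tauPow_ne_zero (sStar 3 l))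
    (fun i => by
      change sRefl k q 3 (mono (δ .y) ^ i * tauPow l) = (gq (pι k q _ * mono (δ .x)) _)⁻¹ *
        gq (pι k q _ * mono (δ .x)) _ * (mono (δ .y) ^ i * _)
      rw [pι_mul_expoZ₃, pι_mul_expoW₃]
      exact sRefl_three_mono_mul_tauPow l i)
    (b := l.d 0) (b' := (sStar 3 l).d 0) (fun i => by simp [sStar]; ring) isSubst_three isSubst_three'
    (fun x hx => ?_) (fun x hx => ?_) (isCoprime_fam_divX l) (fun i => ?_) (fun i => ?_)
    (divX_eq_fam l) (divX_eq_fam (sStar 3 l)) ((condY_iff l F).mp hF.2) ((condX_iff l F).mp hF.1)).imp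
    fun F' ⟨h1, h2, h3, h4⟩ => ⟨h1, ⟨(condX_iff _ _).mpr h3, (condY_iff _ _).mpr h2⟩, h4⟩
  · simp only [List.map_cons, List.map_nil, List.prod_cons, List.prod_nil, Polynomial.map_mul,
      Polynomial.map_one, low, upp, map_linProd, map_inv₀, map_mul, map_div₀, paramsRefl_pq, e2]
    simp only [hfix _ (show (1 : Fin 11) ≠ 0 by decide) (by decide),
      hfix _ (show (2 : Fin 11) ≠ 0 by decide) (by decide),
      hfix _ (show (3 : Fin 11) ≠ 0 by decide) (by decide),
      hfix _ (show (4 : Fin 11) ≠ 0 by decide) (by decide),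
      hfix _ (show (5 : Fin 11) ≠ 0 by decide) (by decide),
      hfix _ (show (7 : Fin 11) ≠ 0 by decide) (by decide),
      hfix _ (show (8 : Fin 11) ≠ 0 by decide) (by decide)]
  · simp only [List.map_cons, List.map_nil, List.prod_cons, List.prod_nil, mul_coeff_zero, low, upp,
      linProd_coeff_zero, mul_one]
  · rw [List.mem_singleton] at hx
    subst hx
    rw [scale_coeff, scale_coeff, one_add_coeff_zero, one_add_coeff_zero, map_mul, map_inv₀,
      paramsRefl_pq, hfix 10 (by decide) (by decide)]
  -- At `x = ∞` the quotient `α'(0)/β'(0)` is `h₁/(e₁ e₇)`, exactly the factor by which `s_3`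
  -- multiplies `h₂` and hence the parameter `h₂/e₁₀`.
  · rw [List.mem_singleton] at hx
    subst hx
    rw [scale_coeff, scale_coeff, X_add_coeff_zero, X_add_coeff_zero, map_div₀, e3,
      hfix 9 (by decide) (by decide)]
    field_simp
  · simp only [divY₀, divY₁, List.map_cons, List.map_nil, List.prod_cons, List.prod_nil, mul_one]
    rw [show (i : ℤ) - l.d 1 + l.m 6 = l.m 6 - (l.d 1 - i) by ring, neg_sub]
    ring
  · simp only [divY₀, divY₁, List.map_cons, List.map_nil, List.prod_cons, List.prod_nil, mul_one]
    have h1 : (sStar 3 l).m 0 - (i : ℤ) = -(i - l.d 1 + l.m 6) := by simp [sStar]; ring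
    have h2 : (sStar 3 l).m 6 - ((sStar 3 l).d 1 - (i : ℤ)) = i - l.m 0 := by simp [sStar]
    have h3 : (sStar 3 l).d 1 = l.d 1 := rfl
    rw [h1, h2, h3]
    change low k q _ _ * (low k q _ (l.m 1 - i).toNat * (low k q _ (l.m 2 - i).toNat *
      (low k q _ (l.m 3 - i).toNat * (low k q _ (l.m 4 - i).toNat * low k q _ (l.m 5 - i).toNat)))) *
      (upp k q _ _ * (upp k q _ (l.m 7 - (l.d 1 - i)).toNat * upp k q _ (l.m 8 - (l.d 1 - i)).toNat)) = _
    ring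

theorem sRefl_ev (S : QPair (pι k q)) {i : Fin 9} (hu : sRefl k q i S.u = S.u)
    (hv : sRefl k q i S.v = S.v) (g : (params k q)[X][X]) :
    sRefl k q i (S.ev g) = S.ev (g.map (mapRingHom (paramsRefl k q i))) := by
  have hmap : ∀ r : (params k q)[X],
      sRefl k q i (S.evu r) = S.evu (r.map (paramsRefl k q i)) := fun r => by
    induction r using Polynomial.induction_on' with
    | add p r hp hr => rw [map_add, map_add, hp, hr, Polynomial.map_add, map_add]
    | monomial n a =>
      rw [Polynomial.map_monomial, ← C_mul_X_pow_eq_monomial, ← C_mul_X_pow_eq_monomial, map_mul,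
        map_mul, map_mul, map_pow, map_pow, S.evu_C, S.evu_C, S.evu_X, pι_paramsRefl, hu]
  induction g using Polynomial.induction_on' with
  | add p r hp hr => rw [S.ev_add, map_add, hp, hr, Polynomial.map_add, S.ev_add]
  | monomial n a =>
    rw [Polynomial.map_monomial, S.ev_monomial, S.ev_monomial, map_mul, map_pow, hv, hmap]; rfl

theorem form_map (S : QPair (pι k q)) {i : Fin 9} (hu : sRefl k q i S.u = S.u)
    (hv : sRefl k q i S.v = S.v) {N M : ℕ} {D D' : ℕ → (params k q)[X]}
    (hD : ∀ j, (D j).map (paramsRefl k q i) = D' j) {F : SkewField k q} (hF : S.Form N M D F) :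
    S.Form N M D' (sRefl k q i F) := by
  obtain ⟨g, hN, hM, hg, rfl⟩ := hF
  refine ⟨g.map (mapRingHom (paramsRefl k q i)), fun j hj => ?_, fun j l hl => ?_, fun j => ?_,
    (sRefl_ev S hu hv g).symm⟩
  · rw [coeff_map, hN j hj, map_zero]
  · rw [coeff_map, coe_mapRingHom, coeff_map, hM j l hl, map_zero]
  · rw [coeff_map, coe_mapRingHom, ← hD]
    exact map_dvd (mapRingHom (paramsRefl k q i)) (hg j)

theorem map_divX {i : Fin 9} (h0 : i ≠ 0) (h3 : i ≠ 3) (l : Pic) (j : ℕ) :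
    (divX k q l j).map (paramsRefl k q i) = divX k q (sStar i l) j := by
  have h : Equiv.swap (swapIdx i).1 (swapIdx i).2 9 = 9 ∧
      Equiv.swap (swapIdx i).1 (swapIdx i).2 10 = 10 := by revert i; decide
  rw [sStar_eq h0 h3]
  simp only [divX, upp, low, Polynomial.map_mul, map_linProd, map_mul, map_inv₀, map_div₀,
    paramsRefl_pq, paramsRefl_ph h0 h3, paramsRefl_pe h0 h3, h.1, h.2, Function.comp_apply]

theorem prod_map_swap {R : Type*} [CommMonoid R] (a b : Fin 11) {L : List (Fin 11)}
    (hL : (L.map (Equiv.swap a b)).Perm L) (f : Fin 11 → R) :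
    (L.map f).prod = (L.map fun j => f (Equiv.swap a b j)).prod := by
  rw [← (hL.map f).prod_eq, List.map_map]; rfl

/-- Every exchange preserves the two groups of indices on `y = 0` and `y = ∞`, so it only permutes
the factors. -/
theorem map_divY {i : Fin 9} (h0 : i ≠ 0) (h3 : i ≠ 3) (l : Pic) (j : ℕ) :
    (divY₀ k q l j * divY₁ k q l j).map (paramsRefl k q i) =
      divY₀ k q (sStar i l) j * divY₁ k q (sStar i l) j := by
  have h : (([0, 1, 2, 3, 4, 5] : List (Fin 11)).map
        (Equiv.swap (swapIdx i).1 (swapIdx i).2)).Perm [0, 1, 2, 3, 4, 5] ∧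
      (([6, 7, 8] : List (Fin 11)).map
        (Equiv.swap (swapIdx i).1 (swapIdx i).2)).Perm [6, 7, 8] := by
    revert i; decide
  rw [sStar_eq h0 h3, divY₀, divY₁, Polynomial.map_mul, Polynomial.map_list_prod,
    Polynomial.map_list_prod, List.map_map, List.map_map, prod_map_swap _ _ h.1,
    prod_map_swap _ _ h.2]
  simp only [Function.comp_def, upp, low, map_linProd, map_mul, map_inv₀, map_div₀,
    paramsRefl_pq, paramsRefl_ph h0 h3, paramsRefl_pe h0 h3, Equiv.swap_apply_self]
  rfl

theorem exists_isF_swap {i : Fin 9} (h0 : i ≠ 0) (h3 : i ≠ 3) {l : Pic} {F : SkewField k q}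
    (hF : IsF l F) :
    ∃ F', sRefl k q i (F * tauPow l) = F' * tauPow (sStar i l) ∧ IsF (sStar i l) F' ∧
      ∀ c, (pairXY k q).HasConst F c → (pairXY k q).HasConst F' (paramsRefl k q i c) := by
  have hx : sRefl k q i (mono (δ .x)) = mono (δ .x) := sRefl_X h0 h3 .x
  have hy : sRefl k q i (mono (δ .y)) = mono (δ .y) := sRefl_X h0 h3 .y
  have hd : (sStar i l).d = l.d := by rw [sStar_eq h0 h3]
  refine ⟨sRefl k q i F, ?_, ⟨?_, ?_⟩, ?_⟩
  · rw [map_mul, tauPow_eq_mono, sRefl_mono h0 h3, expoSwap_tauExp h0 h3, tauPow_eq_mono]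
  · rw [condX_iff, hd]
    exact form_map _ hy hx (map_divX h0 h3 l) ((condX_iff l F).mp hF.1)
  · rw [condY_iff, hd]
    exact form_map _ hx hy (map_divY h0 h3 l) ((condY_iff l F).mp hF.2)
  · rintro c ⟨g, rfl, rfl⟩
    exact ⟨_, (sRefl_ev _ hx hy g).symm, by rw [coeff_map, coe_mapRingHom, coeff_map]⟩

/-- The simple reflections transform the conditions for `λ` into those for `s_i^* λ`. -/
theorem exists_isF_sStar (i : Fin 9) {l : Pic} {F : SkewField k q} (hF : IsF l F) :
    ∃ F', sRefl k q i (F * tauPow l) = F' * tauPow (sStar i l) ∧ IsF (sStar i l) F' ∧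
      ∀ c, (pairXY k q).HasConst F c → (pairXY k q).HasConst F' (paramsRefl k q i c) := by
  by_cases h0 : i = 0
  · subst h0; exact exists_isF_zero hF
  by_cases h3 : i = 3
  · subst h3; exact exists_isF_three hF
  exact exists_isF_swap h0 h3 hF

/-! ### Constant terms -/

theorem polyEval_add (c d : ℕ × ℕ →₀ params k q) : polyEval (c + d) = polyEval c + polyEval d := by
  rw [polyEval, Finsupp.sum_add_index']
  · rfl
  · simp
  · intro p a b
    rw [Subfield.coe_add, add_mul, add_mul]

theorem polyEval_single (i j : ℕ) (a : params k q) :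
    polyEval (Finsupp.single (i, j) a) = (pairXY k q).ev (monomial j (monomial i a)) := by
  rw [polyEval, Finsupp.sum_single_index (by simp), (pairXY k q).ev_monomial,
    ← C_mul_X_pow_eq_monomial, map_mul, map_pow, (pairXY k q).evu_C, (pairXY k q).evu_X]
  rfl

theorem exists_polyEval_eq (g : (params k q)[X][X]) :
    ∃ c, polyEval c = (pairXY k q).ev g ∧ c (0, 0) = (g.coeff 0).coeff 0 := by
  induction g using Polynomial.induction_on' with
  | add g h hg hh =>
    obtain ⟨c, hc, hc'⟩ := hg
    obtain ⟨d, hd, hd'⟩ := hh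
    exact ⟨c + d, by rw [polyEval_add, hc, hd, (pairXY k q).ev_add], by
      rw [Finsupp.add_apply, hc', hd', coeff_add, coeff_add]⟩
  | monomial j p =>
    induction p using Polynomial.induction_on' with
    | add g h hg hh =>
      obtain ⟨c, hc, hc'⟩ := hg
      obtain ⟨d, hd, hd'⟩ := hh
      exact ⟨c + d, by rw [polyEval_add, hc, hd, map_add, (pairXY k q).ev_add], by
        rw [Finsupp.add_apply, hc', hd', map_add, coeff_add, coeff_add]⟩
    | monomial i a =>
      refine ⟨Finsupp.single (i, j) a, polyEval_single i j a, ?_⟩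
      rw [Finsupp.single_apply, coeff_monomial]
      rcases eq_or_ne j 0 with rfl | hj
      · rw [if_pos rfl, coeff_monomial]; simp
      · rw [if_neg hj, if_neg (by simp [hj]), coeff_zero]

theorem hasConst_polyEval (c : ℕ × ℕ →₀ params k q) :
    (pairXY k q).HasConst (polyEval c) (c (0, 0)) := by
  induction c using Finsupp.induction_linear with
  | zero => exact ⟨0, by rw [(pairXY k q).ev_zero]; simp [polyEval], by simp⟩
  | add c d hc hd =>
    obtain ⟨g, hg, hg'⟩ := hc
    obtain ⟨h, hh, hh'⟩ := hd
    exact ⟨g + h, by rw [polyEval_add, ← hg, ← hh, (pairXY k q).ev_add], by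
      rw [Finsupp.add_apply, ← hg', ← hh', coeff_add, coeff_add]⟩
  | single p a =>
    obtain ⟨i, j⟩ := p
    refine ⟨_, (polyEval_single i j a).symm, ?_⟩
    rw [Finsupp.single_apply, coeff_monomial]
    rcases eq_or_ne j 0 with rfl | hj
    · rw [if_pos rfl, coeff_monomial]; simp
    · rw [if_neg hj, if_neg (by simp [hj]), coeff_zero]

theorem isNormalized_iff {F : SkewField k q} : IsNormalized F ↔ (pairXY k q).HasConst F 1 := by
  constructor
  · rintro ⟨c, rfl, h⟩
    rw [← h]
    exact hasConst_polyEval c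
  · rintro ⟨g, rfl, h⟩
    obtain ⟨c, hc, hc'⟩ := exists_polyEval_eq g
    exact ⟨c, hc, hc'.trans h⟩

theorem IsF.isNCPoly {l : Pic} {F : SkewField k q} (hF : IsF l F) : IsNCPoly F := by
  obtain ⟨g, -, -, -, rfl⟩ := (condY_iff l F).mp hF.2
  obtain ⟨c, hc, -⟩ := exists_polyEval_eq g
  exact ⟨c, hc⟩

theorem QPair.HasConst.unique {P K : Type*} [Field P] [DivisionRing K] {ι : P →+* K} {S : QPair ι}
    {F : K} {c d : P} (hc : S.HasConst F c) (hd : S.HasConst F d) : c = d := by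
  obtain ⟨g, rfl, rfl⟩ := hc
  obtain ⟨h, hh, rfl⟩ := hd
  rw [S.ev_injective hh]

theorem QPair.HasConst.const_mul {P K : Type*} [Field P] [DivisionRing K] {ι : P →+* K}
    {S : QPair ι} {F : K} {a : P} (h : S.HasConst F a) (c : P) :
    S.HasConst (ι c * F) (c * a) := by
  obtain ⟨g, rfl, rfl⟩ := h
  refine ⟨C (C c) * g, ?_, by rw [coeff_C_mul, coeff_C_mul]⟩
  induction g using Polynomial.induction_on' with
  | add g h hg hh => rw [mul_add, S.ev_add, hg, hh, S.ev_add, mul_add]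
  | monomial n p =>
    rw [C_mul_monomial, S.ev_monomial, S.ev_monomial, map_mul, S.evu_C, mul_assoc]

/-! ### The orbit of the classes `E_j` -/

/-- The multiplicities of `E_j` are `0` or `-1` and the bidegree is zero, so the divisors at order
zero are empty. -/
theorem isF_E_one (j : Fin 11) : IsF (E j) (1 : SkewField k q) := by
  have hm : ∀ (i : Fin 11) (n : ℕ), ((E j).m i - n).toNat = 0 := fun i n => by
    simp only [E, Pi.neg_apply, Pi.single_apply]
    split_ifs <;> omega
  have hm' : ∀ i : Fin 11, ((E j).m i - (0 - (0 : ℕ))).toNat = 0 := fun i => by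
    have := hm i 0
    simpa using this
  have hd : (E j).d = 0 := rfl
  have hone : ∀ (S : QPair (pι k q)) (D : ℕ → (params k q)[X]), D 0 = 1 → S.Form 1 1 D 1 := by
    intro S D hD
    refine ⟨1, fun i hi => ?_, fun i n hn => ?_, fun i => ?_, ?_⟩
    · rw [coeff_one, if_neg (by omega)]
    · rw [coeff_one]
      split_ifs
      · rw [coeff_one, if_neg (by omega)]
      · exact coeff_zero _
    · rcases eq_or_ne i 0 with rfl | hi
      · rw [hD]; exact one_dvd _
      · rw [coeff_one, if_neg hi]; exact dvd_zero _
    · rw [← monomial_zero_one, S.ev_monomial, map_one, pow_zero, mul_one]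
  constructor
  · rw [condX_iff, hd]
    refine hone _ _ ?_
    rw [divX, hm, hd, Pi.zero_apply, hm']
    simp [upp, low, linProd]
  · rw [condY_iff, hd]
    refine hone _ _ ?_
    rw [divY₀, divY₁, hd]
    simp only [Pi.zero_apply, hm, hm']
    simp [upp, low, linProd]

theorem mem_params_of_isF_E {j : Fin 11} {G : SkewField k q} (hG : IsF (E j) G) :
    G ∈ params k q := by
  obtain ⟨g, hN, hM, -, rfl⟩ := (condY_iff _ _).mp hG.2
  have hg : g = C (C ((g.coeff 0).coeff 0)) := by
    ext1 i
    rw [coeff_C]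
    split_ifs with hi
    · subst hi
      ext1 n
      rw [coeff_C]
      split_ifs with hn
      · rw [hn]
      · exact hM 0 n (Nat.one_le_iff_ne_zero.mpr hn)
    · exact hN i (Nat.one_le_iff_ne_zero.mpr hi)
  rw [hg, ← monomial_zero_left, (pairXY k q).ev_monomial, pow_zero, mul_one, (pairXY k q).evu_C]
  exact Subtype.property _

theorem hasConst_one : (pairXY k q).HasConst (1 : SkewField k q) 1 :=
  ⟨1, by rw [← monomial_zero_one, (pairXY k q).ev_monomial, map_one, pow_zero, mul_one], by simp⟩

/-- Existence, normalization and uniqueness up to scalars are carried together along the word. The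
constant term stays `1` because each reflection acts on it by a ring homomorphism. -/
theorem exists_wordAct_eq (w : List (Fin 9)) (j : Fin 11) : ∃ F : SkewField k q,
    wordAct (sRefl k q) w (1 * tauPow (E j)) = F * tauPow (wordStar w (E j)) ∧
      IsF (wordStar w (E j)) F ∧ (pairXY k q).HasConst F 1 ∧
      ∀ G, IsF (wordStar w (E j)) G → ∃ c ∈ params k q, G = c * F := by
  induction w with
  | nil => exact ⟨1, rfl, isF_E_one j, hasConst_one, fun G hG =>
      ⟨G, mem_params_of_isF_E hG, (mul_one G).symm⟩⟩
  | cons i w ih =>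
    obtain ⟨F, h1, h2, h3, h4⟩ := ih
    obtain ⟨F', h5, h6, h7⟩ := exists_isF_sStar i h2
    have h8 := h7 1 h3
    rw [map_one] at h8
    refine ⟨F', ?_, h6, h8, fun G hG => ?_⟩
    · change sRefl k q i (wordAct (sRefl k q) w _) = _
      rw [h1, h5]; rfl
    · change IsF (sStar i (wordStar w (E j))) G at hG
      -- A solution for the longer word is moved back by the involution `s_i`, compared with `F`
      -- there, and moved forward again.
      obtain ⟨G', h9, h10, -⟩ := exists_isF_sStar i hG
      rw [sStar_involutive i] at h9 h10
      obtain ⟨c, hc, rfl⟩ := h4 G' h10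
      refine ⟨sRefl k q i c, sRefl_mem_params i hc,
        mul_right_cancel₀ (tauPow_ne_zero (sStar i (wordStar w (E j)))) ?_⟩
      rw [mul_assoc, ← h5, ← map_mul, ← mul_assoc, ← h9, sRefl_sRefl]

theorem wordStar_append (v w : List (Fin 9)) (l : Pic) :
    wordStar (v ++ w) l = wordStar v (wordStar w l) := List.foldr_append

theorem wordStar_wordStar_reverse (w : List (Fin 9)) (l : Pic) :
    wordStar w (wordStar w.reverse l) = l := by
  induction w generalizing l with
  | nil => rfl
  | cons i w ih =>
    rw [List.reverse_cons, wordStar_append]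
    change sStar i (wordStar w (wordStar w.reverse (sStar i l))) = l
    rw [ih, sStar_involutive i]

theorem exists_wordStar_eq {l : Pic} (hl : l ∈ excOrbit) :
    ∃ (w : List (Fin 9)) (j : Fin 11), wordStar w (E j) = l := by
  obtain ⟨g, hg, j, rfl⟩ := hl
  have h : ∃ w, ∀ l, g l = wordStar w l := by
    induction hg using Subgroup.closure_induction with
    | mem g hg =>
      obtain ⟨i, rfl⟩ := hg
      exact ⟨[i], fun l => rfl⟩
    | one => exact ⟨[], fun l => rfl⟩
    | mul g h _ _ hg hh =>
      obtain ⟨v, hv⟩ := hg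
      obtain ⟨w, hw⟩ := hh
      exact ⟨v ++ w, fun l => by rw [wordStar_append, Equiv.Perm.mul_apply, hw, hv]⟩
    | inv g _ hg =>
      obtain ⟨w, hw⟩ := hg
      exact ⟨w.reverse, fun l => by
        rw [Equiv.Perm.inv_eq_iff_eq, hw, wordStar_wordStar_reverse]⟩
  obtain ⟨w, hw⟩ := h
  exact ⟨w, j, (hw _).symm⟩

/-- The constant term is well defined by linear independence of the monomials and scales with `c`,
which forces `c = 1`. -/
theorem eq_of_hasConst_one {F G : SkewField k q}
    (hF : (pairXY k q).HasConst F 1) (h : ∃ c ∈ params k q, G = c * F)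
    (hG : (pairXY k q).HasConst G 1) : G = F := by
  obtain ⟨c, hc, rfl⟩ := h
  have h1 := (hF.const_mul ⟨c, hc⟩).unique hG
  rw [mul_one] at h1
  rw [show c = 1 from congrArg Subtype.val h1, one_mul]

end QuantumE8

end

/-! ### The theorem. -/

theorem mainTheorem1 (k : Type*) [Field k] (q : kˣ) :
    (∃! s : Fin 9 → (SkewField k q ≃ₐ[k] SkewField k q), IsReflections s) ∧
    ∀ s : Fin 9 → (SkewField k q ≃ₐ[k] SkewField k q), IsReflections s →
      (∀ (i : Fin 9) (l : Pic), s i (ePow l) = ePow (sStar i l)) ∧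
      (∀ (i : Fin 9) (l : Pic) (F : SkewField k q), IsF l F →
        ∃ F' : SkewField k q, s i (F * tauPow l) = F' * tauPow (sStar i l) ∧
          IsNCPoly F' ∧ IsF (sStar i l) F') ∧
      (∀ j : Fin 11, IsF (E j) (1 : SkewField k q) ∧ IsNormalized (1 : SkewField k q)) ∧
      ∀ l ∈ excOrbit,
        (∃! F : SkewField k q, IsF l F ∧ IsNormalized F) ∧
        (∀ F G : SkewField k q, IsF l F → IsNormalized F → IsF l G →
          ∃ c ∈ params k q, G = c * F) ∧
        (∃ (w : List (Fin 9)) (j : Fin 11), wordStar w (E j) = l) ∧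
        ∀ (w : List (Fin 9)) (j : Fin 11) (F : SkewField k q), wordStar w (E j) = l →
          IsF l F → IsNormalized F →
          wordAct s w (1 * tauPow (E j)) = F * tauPow l := by
  refine ⟨⟨sRefl k q, isReflections_sRefl, fun s hs => hs.unique isReflections_sRefl⟩, ?_⟩
  intro s hs
  obtain rfl := hs.unique isReflections_sRefl
  refine ⟨sRefl_ePow, fun i l F hF => ?_, fun j => ⟨isF_E_one j, isNormalized_iff.mpr hasConst_one⟩,
    fun l hl => ?_⟩
  · obtain ⟨F', h1, h2, -⟩ := exists_isF_sStar i hF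
    exact ⟨F', h1, h2.isNCPoly, h2⟩
  -- An arbitrary normalized solution coincides with the one produced by the given word, so the
  -- result does not depend on the word or on the index.
  have key : ∀ (w : List (Fin 9)) (j : Fin 11) (F : SkewField k q), wordStar w (E j) = l →
      IsF l F → IsNormalized F → wordAct (sRefl k q) w (1 * tauPow (E j)) = F * tauPow l ∧
        ∀ G, IsF l G → ∃ c ∈ params k q, G = c * F := by
    rintro w j F rfl hF hF'
    obtain ⟨F', h1, h2, h3, h4⟩ := exists_wordAct_eq (k := k) (q := q) w j
    rw [eq_of_hasConst_one h3 (h4 F hF) (isNormalized_iff.mp hF')]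
    exact ⟨h1, h4⟩
  obtain ⟨w, j, hw⟩ := exists_wordStar_eq hl
  refine ⟨?_, fun F G hF hF' hG => (key w j F hw hF hF').2 G hG, ⟨w, j, hw⟩,
    fun w j F hw hF hF' => (key w j F hw hF hF').1⟩
  subst hw
  obtain ⟨F, h1, h2, h3, h4⟩ := exists_wordAct_eq (k := k) (q := q) w j
  exact ⟨F, ⟨h2, isNormalized_iff.mpr h3⟩, fun G hG =>
    eq_of_hasConst_one h3 (h4 G hG.1) (isNormalized_iff.mp hG.2)⟩
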